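/- Let $\mathbb K$ be a field of characteristic $0$. **Conventions.** For a vector space $V$, $T(V)=\bigoplus_{n\ge 0}V^{\otimes n}$ is written in terms of words, $\Delta(v_1\cdots v_n)=\sum_{i=0}^n v_1\cdots v_i\otimes v_{i+1}\cdots v_n$ is the deconcatenation coproduct, $\varepsilon$ and $\pi_V$ are the projections of $T(V)$ onto $V^{\otimes 0}=\mathbb K$ and $V^{\otimes 1}=V$, and $T_+(V)=\ker\varepsilon$. If $V=\bigoplus_{n\ge1}V_n$ is graded (with $V_0=0$), $T^g(V)$ is $T(V)$ graded by $|v_1\cdots v_n|=|v_1|+\cdots+|v_n|$. A *$B_\infty$-algebra structure* on $V$ is a linear map $\langle-,-\rangle:T(V)\otimes T(V)\to V$ with $\langle 1,w\rangle=\langle w,1\rangle=\pi_V(w)$ and $\langle w,w'*w''\rangle=\langle w*w',w''\rangle$ for $w,w',w''\in T_+(V)$, where $1*1=1$ and, for words not both empty, $w*w'=\sum_{k\ge1}\sum\langle w_1,w'_1\rangle\cdots\langle w_k,w'_k\rangle$, the inner sum being over all factorizations $w=w_1\cdots w_k$, $w'=w'_1\cdots w'_k$ into possibly empty words. It is *commutative*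 if $\langle w,w'\rangle=\langle w',w\rangle$ on $T_+(V)$, and *graded* if $\langle-,-\rangle:T^g(V)\otimes T^g(V)\to V$ respects degrees. When $\langle w,w'\rangle=0$ for all $w,w'\in T_+(V)$, $*$ is the shuffle product $\mathbin{\sqcup\!\sqcup}$. If $C$ is a connected graded coalgebra and $\pi:C\to V$ is a graded linear map, the coalgebra morphism *induced* by $\pi$ is $\Phi=\varepsilon+\sum_{k\ge1}\pi^{\otimes k}\circ\bar\Delta_k:C\to T^g(V)$, with $\bar\Delta_k$ the iterated reduced coproduct ($\bar\Delta_1$ being the projection onto $\ker\varepsilon$). A graded map $\pi$ from $C$ to $V$ makes $C$ a *cofree graded coalgebra over $V$* if every graded linear map $\phi:D\to V$, with $D$ a connected graded coalgebra, lifts uniquely to a morphism of graded coalgebras $\Phi:D\to C$ with $\pi\circ\Phi=\phi$. The *descent algebra* $\mathrm{Desc}=\bigoplus_n\mathrm{Desc}_n$, $\mathrm{Desc}_n\subset\mathbb K[S_n]$, has the basis $De_S=\sum_{\mathrm{desc}(\sigma)\subseteq S}\sigma$, where $S=\{s_1<\dots<s_k=n\}$ runs over the subsets of $\{1,\dots,n\}$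 containing $n$. For the convolution product it is the free associative algebra on the identity permutations $1_n\in S_n$, $n\ge1$, with $De_S=1_{s_1}*1_{s_2-s_1}*\cdots*1_{s_k-s_{k-1}}$, and it is a Hopf algebra for the coproduct $\Delta(1_n)=\sum_{i+j=n}1_i\otimes1_j$. It acts on any graded connected cocommutative Hopf algebra $H$ by the algebra morphism from $\mathrm{Desc}$ to the convolution algebra of linear endomorphisms of $H$ that sends $1_n$ to the projection of $H$ onto $H_n$. A *Lie idempotent family* is a family $(\psi_n)_{n\ge1}$ of primitive elements $\psi_n\in\mathrm{Desc}_n$ in which $1_n=De_{\{n\}}$ has coefficient $1$ in the basis $(De_S)$. (Then $\psi_n$ acts on $H_n$ as a projector onto $\mathrm{Prim}(H)\cap H_n$.) If $A=\bigoplus_n A_n$ is a graded connected commutative Hopf algebra with finite dimensional components and $H=\bigoplus_nA_n^*$ is its graded dual, $\psi_n^*:A_n\to A_n$ denotes the transpose of the action of $\psi_n$ on $H_n=A_n^*$. **Theorem.** Let $(\psi_n)_{n\ge1}$ be a Lie idempotent family. 1. *(Graded commutative $B_\infty$-algebras.)* Let $V=\bigoplus_{n\ge1}V_n$ be a graded vector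 space with finite dimensional components, with a graded commutative $B_\infty$-algebra structure, and let $*$ be the associated product. Then $(T^g(V),*,\Delta)$ and $(T^g(V),\mathbin{\sqcup\!\sqcup},\Delta)$ are graded connected commutative Hopf algebras, and the coalgebra morphism $\Phi:T^g(V)\to T^g(V)$ induced by the structure map $\pi=\sum_{n\ge1}\pi_V\circ\psi_n^*$ satisfies $\pi_V\circ\Phi=\pi$ and is an isomorphism of graded Hopf algebras $$(T^g(V),*,\Delta)\cong(T^g(V),\mathbin{\sqcup\!\sqcup},\Delta).$$ 2. *(Cofree graded commutative Hopf algebras.)* Let $A$ be a graded connected commutative Hopf algebra with finite dimensional components, and $\phi:A\to\mathrm{Prim}(A)$ a graded map making $A$ a cofree graded coalgebra over $\mathrm{Prim}(A)$. Then $\pi=\sum_{n\ge1}\phi\circ\psi_n^*$ makes $A$ a cofree graded coalgebra over $\mathrm{Prim}(A)$ as well, isomorphic to the first one: there is an automorphism $\Theta$ of the graded coalgebra $A$ with $\phi\circ\Theta=\pi$. Furthermore the coalgebra morphism $\Phi:A\to T^g(\mathrm{Prim}(A))$ induced by $\pi$ satisfies $\pi_{\mathrm{Prim}(A)}\circ\Phi=\pi$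 and is an isomorphism of graded Hopf algebras $A\cong(T^g(\mathrm{Prim}(A)),\mathbin{\sqcup\!\sqcup},\Delta)$. -/

import Mathlib

open scoped TensorProduct DirectSum

universe u v w

noncomputable section

namespace CofreeHopf

/-! ## Raw (co)algebra data and convolution

`BialgData` only packages four structure maps, so that one module can be considered with several
products. The laws are stated separately, in `IsGradedCommHopf`. -/

section Raw

/-- The four structure maps of a bialgebra on a vector space `A`. -/
structure BialgData (K : Type u) [Field K] (A : Type v) [AddCommGroup A] [Module K A] where
  mul : A ⊗[K] A →ₗ[K] A
  one : A
  comul : A →ₗ[K] A ⊗[K] A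
  counit : A →ₗ[K] K

/-- The structure maps of a Mathlib bialgebra. -/
def BialgData.ofBialgebra (K : Type u) [Field K] (A : Type v) [CommRing A] [Bialgebra K A] :
    BialgData K A where
  mul := LinearMap.mul' K A
  one := 1
  comul := Coalgebra.comul
  counit := Coalgebra.counit

variable {K : Type u} [Field K]

/-- The convolution power `f ⊛ ⋯ ⊛ f` (`k` factors) of a linear map `f` from a coalgebra
`(C, Δ, ε)` to an associative algebra `R`: it sends `c` to `∑ f(c₁) ⋯ f(cₖ)`, where
`∑ c₁ ⊗ ⋯ ⊗ cₖ` is the iterated coproduct of `c`. For `k = 0` it is `c ↦ ε(c) 1`. -/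
def convPow {C : Type v} [AddCommGroup C] [Module K C] (Δ : C →ₗ[K] C ⊗[K] C) (ε : C →ₗ[K] K)
    {R : Type w} [Ring R] [Algebra K R] (f : C →ₗ[K] R) : ℕ → (C →ₗ[K] R)
  | 0 => Algebra.linearMap K R ∘ₗ ε
  | k + 1 => LinearMap.mul' K R ∘ₗ TensorProduct.map f (convPow Δ ε f k) ∘ₗ Δ

/-- The linear map on a graded vector space that equals `F n` on the degree `n` component. -/
def byDegree {A : Type v} [AddCommGroup A] [Module K A] (𝒜 : ℕ → Submodule K A)
    [DirectSum.Decomposition 𝒜] {M : Type w} [AddCommGroup M] [Module K M]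
    (F : ℕ → (A →ₗ[K] M)) : A →ₗ[K] M :=
  DirectSum.toModule K ℕ M (fun n => F n ∘ₗ (𝒜 n).subtype) ∘ₗ
    (DirectSum.decomposeLinearEquiv 𝒜).toLinearMap

/-- The projection of a graded vector space onto its degree `n` component. -/
def proj {A : Type v} [AddCommGroup A] [Module K A] (𝒜 : ℕ → Submodule K A)
    [DirectSum.Decomposition 𝒜] (n : ℕ) : A →ₗ[K] 𝒜 n :=
  DirectSum.component K ℕ (fun i => 𝒜 i) n ∘ₗ (DirectSum.decomposeLinearEquiv 𝒜).toLinearMap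

/-- The degree `n` component of the tensor square of a graded vector space. -/
def tensorGr {A : Type v} [AddCommGroup A] [Module K A] (𝒜 : ℕ → Submodule K A) (n : ℕ) :
    Submodule K (A ⊗[K] A) :=
  ⨆ p ∈ Finset.HasAntidiagonal.antidiagonal n,
    LinearMap.range (TensorProduct.map (𝒜 p.1).subtype (𝒜 p.2).subtype)

/-- `(A, B)` is a graded connected commutative bialgebra for the grading `𝒜` (equivalently a graded
connected commutative Hopf algebra: the antipode exists automatically). -/
structure IsGradedCommHopf {A : Type v} [AddCommGroup A] [Module K A] (B : BialgData K A)
    (𝒜 : ℕ → Submodule K A) : Prop where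
  mul_assoc : ∀ x y z, B.mul (B.mul (x ⊗ₜ y) ⊗ₜ z) = B.mul (x ⊗ₜ B.mul (y ⊗ₜ z))
  one_mul : ∀ x, B.mul (B.one ⊗ₜ x) = x
  mul_one : ∀ x, B.mul (x ⊗ₜ B.one) = x
  mul_comm : ∀ x y, B.mul (x ⊗ₜ y) = B.mul (y ⊗ₜ x)
  coassoc : TensorProduct.assoc K A A A ∘ₗ B.comul.rTensor A ∘ₗ B.comul =
    B.comul.lTensor A ∘ₗ B.comul
  counit_comul : B.counit.rTensor A ∘ₗ B.comul = TensorProduct.mk K K A 1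
  comul_counit : B.counit.lTensor A ∘ₗ B.comul = (TensorProduct.mk K A K).flip 1
  comul_mul : B.comul ∘ₗ B.mul = TensorProduct.map B.mul B.mul ∘ₗ
    (TensorProduct.tensorTensorTensorComm K A A A A).toLinearMap ∘ₗ
      TensorProduct.map B.comul B.comul
  comul_one : B.comul B.one = B.one ⊗ₜ B.one
  counit_mul : ∀ x y, B.counit (B.mul (x ⊗ₜ y)) = B.counit x * B.counit y
  counit_one : B.counit B.one = 1
  isInternal : DirectSum.IsInternal 𝒜
  mul_mem : ∀ p q x y, x ∈ 𝒜 p → y ∈ 𝒜 q → B.mul (x ⊗ₜ y) ∈ 𝒜 (p + q)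
  comul_mem : ∀ n, ∀ x ∈ 𝒜 n, B.comul x ∈ tensorGr 𝒜 n
  counit_eq_zero : ∀ n, n ≠ 0 → ∀ x ∈ 𝒜 n, B.counit x = 0
  connected : 𝒜 0 = Submodule.span K {B.one}

/-- `Φ` is an isomorphism of graded bialgebras (equivalently of graded connected Hopf algebras). -/
structure IsGradedHopfIso {A : Type v} [AddCommGroup A] [Module K A] (B : BialgData K A)
    (𝒜 : ℕ → Submodule K A) {A' : Type w} [AddCommGroup A'] [Module K A'] (B' : BialgData K A')
    (𝒜' : ℕ → Submodule K A') (Φ : A →ₗ[K] A') : Prop where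
  bijective : Function.Bijective Φ
  map_mul : ∀ x y, Φ (B.mul (x ⊗ₜ y)) = B'.mul (Φ x ⊗ₜ Φ y)
  map_one : Φ B.one = B'.one
  map_comul : TensorProduct.map Φ Φ ∘ₗ B.comul = B'.comul ∘ₗ Φ
  map_counit : B'.counit ∘ₗ Φ = B.counit
  map_mem : ∀ n, ∀ x ∈ 𝒜 n, Φ x ∈ 𝒜' n

end Raw

/-! ## The tensor gebra: deconcatenation and the grading of `T^g(V)` -/

section TensorGebra

variable (K : Type u) [Field K] (V : Type v) [AddCommGroup V] [Module K V]

/-- The projection `ε` of `T(V)` onto `V^{⊗ 0} = K`. -/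
def eps : TensorAlgebra K V →ₗ[K] K := (TensorAlgebra.algebraMapInv (M := V)).toLinearMap

/-- The projection `π_V` of `T(V)` onto `V^{⊗ 1} = V`. -/
def piV : TensorAlgebra K V →ₗ[K] V := TensorAlgebra.ιInv

/-- Auxiliary map for the recursion `Δ(v w) = 1 ⊗ v w + (v ⊗ 1) Δ(w)`: it sends `v` to the
endomorphism `(w, d) ↦ (v w, 1 ⊗ v w + (v ⊗ 1) d)`. -/
def deconcatStep : V →ₗ[K] Module.End K
    (TensorAlgebra K V × (TensorAlgebra K V ⊗[K] TensorAlgebra K V)) where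
  toFun v :=
    LinearMap.prod
      (LinearMap.mulLeft K (TensorAlgebra.ι K v) ∘ₗ LinearMap.fst K _ _)
      (TensorProduct.mk K _ _ 1 ∘ₗ LinearMap.mulLeft K (TensorAlgebra.ι K v) ∘ₗ LinearMap.fst K _ _
        + LinearMap.mulLeft K (TensorAlgebra.ι K v ⊗ₜ[K] (1 : TensorAlgebra K V)) ∘ₗ
          LinearMap.snd K _ _)
  map_add' v v' := by
    refine LinearMap.ext fun x => Prod.ext ?_ ?_
    · simp [add_mul]
    · simp [add_mul, TensorProduct.add_tmul, TensorProduct.tmul_add]; abel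
  map_smul' c v := by
    refine LinearMap.ext fun x => Prod.ext ?_ ?_
    · simp
    · simp [← TensorProduct.smul_tmul']

/-- The deconcatenation coproduct `Δ(v₁ ⋯ vₙ) = ∑_{0 ≤ i ≤ n} v₁ ⋯ vᵢ ⊗ vᵢ₊₁ ⋯ vₙ`,
see `deconcat_word`. -/
def deconcat : TensorAlgebra K V →ₗ[K] TensorAlgebra K V ⊗[K] TensorAlgebra K V :=
  LinearMap.snd K _ _ ∘ₗ LinearMap.applyₗ (1, 1 ⊗ₜ 1) ∘ₗ
    (TensorAlgebra.lift K (deconcatStep K V)).toLinearMap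

variable {K V}

/-- The word `v₁ ⋯ vₙ` in `T(V)`. -/
def word (l : List V) : TensorAlgebra K V := (l.map (TensorAlgebra.ι K)).prod

theorem deconcat_word (l : List V) :
    deconcat K V (word l) =
      ∑ i ∈ Finset.range (l.length + 1), word (l.take i) ⊗ₜ[K] word (l.drop i) := by
  have key : ∀ l : List V, (TensorAlgebra.lift K (deconcatStep K V)) (word l) (1, 1 ⊗ₜ 1) =
      (word l, ∑ i ∈ Finset.range (l.length + 1), word (l.take i) ⊗ₜ[K] word (l.drop i)) := by
    intro l
    induction l with
    | nil => simp [word]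
    | cons v l ih =>
      have h : word (K := K) (v :: l) = TensorAlgebra.ι K v * word l := by simp [word]
      rw [h, map_mul, TensorAlgebra.lift_ι_apply, Module.End.mul_apply, ih]
      refine Prod.ext ?_ ?_
      · simp [deconcatStep]
      · rw [List.length_cons, Finset.sum_range_succ' _ (l.length + 1)]
        simp [deconcatStep, word, add_comm]
  have := congrArg Prod.snd (key l)
  simpa [deconcat] using this

/-- The degree `n` component of `T^g(V)`, for a graded vector space `V`: it is spanned by the words
`v₁ ⋯ vₖ` of homogeneous elements with `|v₁| + ⋯ + |vₖ| = n`. -/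
def gr (𝒱 : ℕ → Submodule K V) (n : ℕ) : Submodule K (TensorAlgebra K V) :=
  Submodule.span K {x | ∃ l : List (ℕ × V), (∀ p ∈ l, p.2 ∈ 𝒱 p.1) ∧ (l.map Prod.fst).sum = n ∧
    x = word (l.map Prod.snd)}

instance gr_gradedMonoid (𝒱 : ℕ → Submodule K V) : SetLike.GradedMonoid (gr 𝒱) where
  one_mem := Submodule.subset_span ⟨[], by simp, by simp, by simp [word]⟩
  mul_mem := by
    intro i j x y hx hy
    have : x * y ∈ gr 𝒱 i * gr 𝒱 j := Submodule.mul_mem_mul hx hy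
    rw [gr, gr, Submodule.span_mul_span] at this
    refine Submodule.span_mono ?_ this
    rintro _ ⟨_, ⟨l, hl, hli, rfl⟩, _, ⟨m, hm, hmj, rfl⟩, rfl⟩
    refine ⟨l ++ m, ?_, by simp [hli, hmj], by simp [word]⟩
    intro p hp
    rcases List.mem_append.1 hp with h | h
    exacts [hl p h, hm p h]

theorem ι_mem_gr {𝒱 : ℕ → Submodule K V} {n : ℕ} {v : V} (hv : v ∈ 𝒱 n) :
    TensorAlgebra.ι K v ∈ gr 𝒱 n :=
  Submodule.subset_span ⟨[(n, v)], by simpa using hv, by simp, by simp [word]⟩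

/-- Auxiliary map for the decomposition of `T^g(V)`. -/
def grι (𝒱 : ℕ → Submodule K V) [DirectSum.Decomposition 𝒱] : V →ₗ[K] ⨁ n, gr 𝒱 n :=
  DirectSum.toModule K ℕ _ (fun n => DirectSum.lof K ℕ (fun n => gr 𝒱 n) n ∘ₗ
    ((TensorAlgebra.ι K).restrict (p := 𝒱 n) (q := gr 𝒱 n) fun _ hv => ι_mem_gr hv)) ∘ₗ
  (DirectSum.decomposeLinearEquiv 𝒱).toLinearMap

theorem grι_of_mem (𝒱 : ℕ → Submodule K V) [DirectSum.Decomposition 𝒱] {n : ℕ} {v : V}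
    (hv : v ∈ 𝒱 n) :
    grι 𝒱 v = DirectSum.of (fun n => gr 𝒱 n) n ⟨TensorAlgebra.ι K v, ι_mem_gr hv⟩ := by
  simp only [grι, LinearMap.comp_apply, LinearEquiv.coe_coe, DirectSum.decomposeLinearEquiv_apply,
    DirectSum.decompose_of_mem 𝒱 hv]
  rw [← DirectSum.lof_eq_of K, DirectSum.toModule_lof]
  rfl

theorem lift_grι_word (𝒱 : ℕ → Submodule K V) [DirectSum.Decomposition 𝒱] :
    ∀ (l : List (ℕ × V)), (∀ p ∈ l, p.2 ∈ 𝒱 p.1) → ∀ x (hx : x ∈ gr 𝒱 (l.map Prod.fst).sum),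
      x = word (l.map Prod.snd) → TensorAlgebra.lift K (grι 𝒱) x =
        DirectSum.of (fun n => gr 𝒱 n) (l.map Prod.fst).sum ⟨x, hx⟩
  | [], _, x, hx, h => by
    obtain rfl : x = 1 := by simpa [word] using h
    rw [map_one]
    rfl
  | p :: l, hl, x, hx, h => by
    have hw : word (K := K) (l.map Prod.snd) ∈ gr 𝒱 (l.map Prod.fst).sum :=
      Submodule.subset_span ⟨l, fun q hq => hl q (List.mem_cons_of_mem _ hq), rfl, rfl⟩
    have ih := lift_grι_word 𝒱 l (fun q hq => hl q (List.mem_cons_of_mem _ hq)) _ hw rfl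
    have h' : x = TensorAlgebra.ι K p.2 * word (l.map Prod.snd) := by simp [h, word]
    have : TensorAlgebra.lift K (grι 𝒱) x = TensorAlgebra.lift K (grι 𝒱)
        (TensorAlgebra.ι K p.2) * TensorAlgebra.lift K (grι 𝒱) (word (l.map Prod.snd)) := by
      rw [← map_mul, ← h']
    rw [this, ih, TensorAlgebra.lift_ι_apply, grι_of_mem 𝒱 (hl p List.mem_cons_self),
      DirectSum.of_mul_of]
    exact DirectSum.of_eq_of_gradedMonoid_eq (Sigma.subtype_ext rfl h'.symm)

/-- `T^g(V)` is the direct sum of its components. -/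
instance gr_gradedAlgebra (𝒱 : ℕ → Submodule K V) [DirectSum.Decomposition 𝒱] :
    GradedAlgebra (gr 𝒱) :=
  GradedAlgebra.ofAlgHom _ (TensorAlgebra.lift K (grι 𝒱))
    (by
      refine TensorAlgebra.hom_ext (LinearMap.ext fun v => ?_)
      simp only [LinearMap.comp_apply, AlgHom.toLinearMap_apply, AlgHom.comp_apply,
        AlgHom.id_apply, TensorAlgebra.lift_ι_apply]
      induction v using DirectSum.Decomposition.inductionOn 𝒱 with
      | zero => simp
      | homogeneous v => rw [grι_of_mem 𝒱 v.2, DirectSum.coeAlgHom_of]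
      | add v w hv hw => rw [map_add, map_add, hv, hw, map_add])
    (by
      have key : ∀ n x (hx : x ∈ gr 𝒱 n), TensorAlgebra.lift K (grι 𝒱) x =
          DirectSum.lof K ℕ (fun n => gr 𝒱 n) n ⟨x, hx⟩ := by
        intro n x hx
        induction hx using Submodule.span_induction with
        | zero => exact (map_zero _).trans (map_zero (DirectSum.lof K ℕ (fun n => gr 𝒱 n) n)).symm
        | add x y hx hy ihx ihy =>
          rw [map_add, ihx, ihy]
          exact (map_add (DirectSum.lof K ℕ (fun n => gr 𝒱 n) n) ⟨x, hx⟩ ⟨y, hy⟩).symm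
        | smul c x hx ih =>
          rw [map_smul, ih]
          exact (map_smul (DirectSum.lof K ℕ (fun n => gr 𝒱 n) n) c ⟨x, hx⟩).symm
        | mem x h =>
          obtain ⟨l, hl, rfl, h⟩ := h
          exact lift_grι_word 𝒱 l hl x _ h
      exact fun n x => key n x x.2)

/-- The graded vector space `V` is reduced (`V₀ = 0`) and locally finite dimensional. -/
class ReducedLocallyFinite (𝒱 : ℕ → Submodule K V) : Prop where
  zero : 𝒱 0 = ⊥
  finite : ∀ n, Module.Finite K (𝒱 n)

/-- If `V` is reduced and locally finite, then so are the components of `T^g(V)`. -/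
instance gr_finite (𝒱 : ℕ → Submodule K V) [h : ReducedLocallyFinite 𝒱] (n : ℕ) :
    Module.Finite K (gr 𝒱 n) := by
  have hf : ∀ i, (𝒱 i).FG := fun i => Module.Finite.iff_fg.1 (h.finite i)
  have hlist : ∀ L : List ℕ, (L.map fun i => (𝒱 i).map (TensorAlgebra.ι K)).prod.FG := by
    intro L
    induction L with
    | nil => 
      rw [List.map_nil, List.prod_nil, Submodule.one_eq_span]
      exact Submodule.fg_span_singleton _
    | cons i L ih => simpa using Submodule.FG.mul ((hf i).map _) ih
  have hS : (⨆ c : Composition n,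
      (c.blocks.map fun i => (𝒱 i).map (TensorAlgebra.ι K)).prod).FG :=
    Submodule.fg_iSup _ fun c => hlist _
  have hmem : ∀ l : List (ℕ × V), (∀ p ∈ l, p.2 ∈ 𝒱 p.1) → word (K := K) (l.map Prod.snd) ∈
      ((l.map Prod.fst).map fun i => (𝒱 i).map (TensorAlgebra.ι K)).prod := by
    intro l hl
    induction l with
    | nil => simp [word]
    | cons p l ih =>
      have hw : word (K := K) ((p :: l).map Prod.snd) =
        TensorAlgebra.ι K p.2 * word (l.map Prod.snd) := by simp [word]
      rw [hw, List.map_cons, List.map_cons, List.prod_cons]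
      exact Submodule.mul_mem_mul (Submodule.mem_map_of_mem (hl p List.mem_cons_self))
        (ih fun q hq => hl q (List.mem_cons_of_mem _ hq))
  have := Module.Finite.iff_fg.2 hS
  refine Submodule.finiteDimensional_of_le (S₂ := ⨆ c : Composition n,
      (c.blocks.map fun i => (𝒱 i).map (TensorAlgebra.ι K)).prod) ?_
  refine Submodule.span_le.2 ?_
  rintro _ ⟨l, hl, hn, rfl⟩
  by_cases h0 : ∃ p ∈ l, p.1 = 0
  · obtain ⟨p, hp, hp0⟩ := h0
    have hp2 : p.2 = 0 := by
      have := hl p hp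
      rwa [hp0, h.zero, Submodule.mem_bot] at this
    have : word (K := K) (l.map Prod.snd) = 0 :=
      List.prod_eq_zero (by
        simp only [List.map_map, List.mem_map, Function.comp]
        exact ⟨p, hp, by rw [hp2, map_zero]⟩)
    rw [this]
    exact Submodule.zero_mem _
  · push Not at h0
    let c : Composition n :=
      ⟨l.map Prod.fst, fun {i} hi => by
        obtain ⟨p, hp, rfl⟩ := List.mem_map.1 hi
        exact Nat.pos_of_ne_zero (h0 p hp), hn⟩
    exact (le_iSup (fun c : Composition n =>
      (c.blocks.map fun i => (𝒱 i).map (TensorAlgebra.ι K)).prod) c) (hmem l hl)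

end TensorGebra

/-! ## `B_∞`-algebras -/

section BInfinity

variable {K : Type u} [Field K] {V : Type v} [AddCommGroup V] [Module K V]

/-- The coproduct of the tensor square `T(V) ⊗ T(V)` of the deconcatenation coalgebra. -/
def deconcat₂ : TensorAlgebra K V ⊗[K] TensorAlgebra K V →ₗ[K]
    (TensorAlgebra K V ⊗[K] TensorAlgebra K V) ⊗[K]
      (TensorAlgebra K V ⊗[K] TensorAlgebra K V) :=
  (TensorProduct.tensorTensorTensorComm K _ _ _ _).toLinearMap ∘ₗ
    TensorProduct.map (deconcat K V) (deconcat K V)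

/-- The counit of `T(V) ⊗ T(V)`. -/
def eps₂ : TensorAlgebra K V ⊗[K] TensorAlgebra K V →ₗ[K] K :=
  LinearMap.mul' K K ∘ₗ TensorProduct.map (eps K V) (eps K V)

/-- The product on `T(V)` associated with a bracket `⟨-,-⟩ : T(V) ⊗ T(V) → V`,
`w * w' = ∑ₖ ∑ ⟨w₁, w₁'⟩ ⋯ ⟨wₖ, wₖ'⟩`, where the inner sum is over all factorizations
`w = w₁ ⋯ wₖ`, `w' = w₁' ⋯ wₖ'` into possibly empty words. The inner sum is a `k`-th
convolution power. When `⟨1, 1⟩ = 0` and `w`, `w'` have lengths `i`, `j`, its terms vanish for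
`k > i + j`, whence the bound on `k`; the term `k = 0` only accounts for `1 * 1 = 1`. -/
def binfMul (br : TensorAlgebra K V ⊗[K] TensorAlgebra K V →ₗ[K] V) :
    TensorAlgebra K V ⊗[K] TensorAlgebra K V →ₗ[K] TensorAlgebra K V :=
  TensorProduct.lift <|
    byDegree (fun i : ℕ => LinearMap.range (TensorAlgebra.ι K (M := V)) ^ i) fun i =>
      (byDegree (fun j : ℕ => LinearMap.range (TensorAlgebra.ι K (M := V)) ^ j) fun j =>
        (TensorProduct.curry (∑ k ∈ Finset.range (i + j + 1),
          convPow deconcat₂ eps₂ (TensorAlgebra.ι K ∘ₗ br) k)).flip).flip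

/-- A `B_∞`-algebra structure on `V`. -/
structure BInftyStructure (K : Type u) [Field K] (V : Type v) [AddCommGroup V] [Module K V] where
  /-- The bracket `⟨-,-⟩ : T(V) ⊗ T(V) → V`. -/
  br : TensorAlgebra K V ⊗[K] TensorAlgebra K V →ₗ[K] V
  one_br : ∀ x, br (1 ⊗ₜ x) = piV K V x
  br_one : ∀ x, br (x ⊗ₜ 1) = piV K V x
  assoc : ∀ x y z, eps K V x = 0 → eps K V y = 0 → eps K V z = 0 →
    br (x ⊗ₜ binfMul br (y ⊗ₜ z)) = br (binfMul br (x ⊗ₜ y) ⊗ₜ z)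

/-- A commutative `B_∞`-algebra. -/
def BInftyStructure.IsCommutative (S : BInftyStructure K V) : Prop :=
  ∀ x y, eps K V x = 0 → eps K V y = 0 → S.br (x ⊗ₜ y) = S.br (y ⊗ₜ x)

/-- A graded `B_∞`-algebra: the bracket is a map of graded vector spaces from
`T^g(V) ⊗ T^g(V)` to `V`. -/
def BInftyStructure.IsGraded (S : BInftyStructure K V) (𝒱 : ℕ → Submodule K V) : Prop :=
  ∀ p q x y, x ∈ gr 𝒱 p → y ∈ gr 𝒱 q → S.br (x ⊗ₜ y) ∈ 𝒱 (p + q)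

/-- The bialgebra `(T(V), *, Δ)` associated with a bracket. -/
def envelope (br : TensorAlgebra K V ⊗[K] TensorAlgebra K V →ₗ[K] V) :
    BialgData K (TensorAlgebra K V) where
  mul := binfMul br
  one := 1
  comul := deconcat K V
  counit := eps K V

/-- The trivial bracket: `⟨1, w⟩ = ⟨w, 1⟩ = π_V(w)`, and `⟨w, w'⟩ = 0` for nonempty words. -/
def trivialBr (K : Type u) [Field K] (V : Type v) [AddCommGroup V] [Module K V] :
    TensorAlgebra K V ⊗[K] TensorAlgebra K V →ₗ[K] V :=
  (TensorProduct.lid K V).toLinearMap ∘ₗ TensorProduct.map (eps K V) (piV K V) +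
    (TensorProduct.rid K V).toLinearMap ∘ₗ TensorProduct.map (piV K V) (eps K V)

/-- The shuffle Hopf algebra `(T(V), ⧢, Δ)`: the shuffle product is the product associated with
the trivial bracket. -/
def shuffle (K : Type u) [Field K] (V : Type v) [AddCommGroup V] [Module K V] :
    BialgData K (TensorAlgebra K V) := envelope (trivialBr K V)

/-- The morphism from a connected graded coalgebra `C` to `T(V)` induced by a graded linear map
`π` from `C` to a reduced graded vector space `V`: `Φ = ε + ∑_{k ≥ 1} π^{⊗ k} ∘ Δ̄ₖ`, that is,
`Φ(c) = ∑ₖ ∑ π(c₁) ⋯ π(cₖ)`. As `π` vanishes in degree `0`, the iterated coproduct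
may replace the reduced one, and only the terms with `k ≤ n` contribute in degree `n`. -/
def induced {C : Type w} [AddCommGroup C] [Module K C] (𝒞 : ℕ → Submodule K C)
    [DirectSum.Decomposition 𝒞] (Δ : C →ₗ[K] C ⊗[K] C) (ε : C →ₗ[K] K) (π : C →ₗ[K] V) :
    C →ₗ[K] TensorAlgebra K V :=
  byDegree 𝒞 fun n => ∑ k ∈ Finset.range (n + 1), convPow Δ ε (TensorAlgebra.ι K ∘ₗ π) k

end BInfinity

/-! ## Cofree graded coalgebras -/

section Cofree

variable {K : Type u} [Field K]

/-- Connected graded coalgebras. -/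
structure IsConnectedGradedCoalgebra {C : Type v} [AddCommGroup C] [Module K C] [Coalgebra K C]
    (𝒞 : ℕ → Submodule K C) : Prop where
  isInternal : DirectSum.IsInternal 𝒞
  comul_mem : ∀ n, ∀ x ∈ 𝒞 n, Coalgebra.comul (R := K) x ∈ tensorGr 𝒞 n
  counit_eq_zero : ∀ n, n ≠ 0 → ∀ x ∈ 𝒞 n, Coalgebra.counit (R := K) x = 0
  connected : Module.finrank K (𝒞 0) = 1

/-- `(C, π)` is a cofree graded coalgebra over the graded vector space `V`: any graded linear map
`φ : D → V`, `D` a connected graded coalgebra, lifts uniquely to a morphism of graded coalgebras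
`Φ : D → C` with `π ∘ Φ = φ`. It is applied to reduced `V` only; then a graded map from `D` to `V`
vanishes on `D₀` and is the same thing as a graded map from `D̄ = ker ε` to `V`. -/
def IsCofreeGraded {C : Type v} [AddCommGroup C] [Module K C] [Coalgebra K C]
    (𝒞 : ℕ → Submodule K C) {V : Type v} [AddCommGroup V] [Module K V] (𝒱 : ℕ → Submodule K V)
    (π : C →ₗ[K] V) : Prop :=
  (∀ n, ∀ x ∈ 𝒞 n, π x ∈ 𝒱 n) ∧
  ∀ (D : Type (max u v)) [AddCommGroup D] [Module K D] [Coalgebra K D] (𝒟 : ℕ → Submodule K D),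
    IsConnectedGradedCoalgebra 𝒟 →
    ∀ φ : D →ₗ[K] V, (∀ n, ∀ x ∈ 𝒟 n, φ x ∈ 𝒱 n) →
      ∃! Φ : D →ₗc[K] C, (∀ n, ∀ x ∈ 𝒟 n, Φ x ∈ 𝒞 n) ∧ ∀ x, π (Φ x) = φ x

/-- The space of primitive elements of a bialgebra. -/
def primitives (K : Type u) [Field K] (A : Type v) [CommRing A] [Bialgebra K A] :
    Submodule K A where
  carrier := {x | Coalgebra.comul (R := K) x = x ⊗ₜ[K] 1 + 1 ⊗ₜ[K] x}
  add_mem' {x y} hx hy := by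
    simp only [Set.mem_ofPred_eq] at hx hy ⊢
    rw [map_add, hx, hy, TensorProduct.add_tmul, TensorProduct.tmul_add]; abel
  zero_mem' := by simp
  smul_mem' c x hx := by
    simp only [Set.mem_ofPred_eq] at hx ⊢
    rw [map_smul, hx, smul_add, TensorProduct.smul_tmul', TensorProduct.tmul_smul]

/-- The grading of the space of primitive elements induced by a grading of the bialgebra. -/
def primitivesGr (K : Type u) [Field K] {A : Type v} [CommRing A] [Bialgebra K A]
    (𝒜 : ℕ → Submodule K A) (n : ℕ) : Submodule K (primitives K A) :=
  (𝒜 n).comap (primitives K A).subtype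

end Cofree

/-! ## The descent algebra and Lie idempotents -/

section Descent

/-- The descents of a permutation of `n` letters: position `i`, `0 < i < n`, is a descent if the
`(i+1)`-st value is less than the `i`-th one. -/
def descents {n : ℕ} (σ : Equiv.Perm (Fin n)) : Finset (Fin (n + 1)) :=
  Finset.univ.filter fun i =>
    ∃ a b : Fin n, (a : ℕ) + 1 = (i : ℕ) ∧ (b : ℕ) = (i : ℕ) ∧ σ b < σ a

variable (K : Type u) [Field K]

/-- The element `De_S = ∑_{desc(σ) ⊆ S} σ` of the group algebra of the symmetric group. Subsets `S`
of `[n]` that contain `n` are encoded by the compositions of `n`: `S` is the set of partial sums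
`c₁, c₁ + c₂, …`. (`c.boundaries` also contains `0`, which is never a descent.) -/
def De {n : ℕ} (c : Composition n) : MonoidAlgebra K (Equiv.Perm (Fin n)) :=
  ∑ σ ∈ Finset.univ.filter (fun σ : Equiv.Perm (Fin n) => descents σ ⊆ c.boundaries),
    MonoidAlgebra.single σ 1

/-- The degree `n` component of the descent algebra. -/
def Desc (n : ℕ) : Submodule K (MonoidAlgebra K (Equiv.Perm (Fin n))) :=
  Submodule.span K (Set.range (De K (n := n)))


/-- The permutation `i ↦ n + i - (a + b)`, for `i` in the block `[a, b)` of `c`. Its descents are the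
partial sums `0 < c₁ + ⋯ + cᵢ < n`. -/
def blockPermFun {n : ℕ} (c : Composition n) (i : Fin n) : Fin n :=
  ⟨n + i - (c.sizeUpTo (c.index i) + c.sizeUpTo (c.index i + 1)), by
    have h1 := c.sizeUpTo_index_le i
    have h2 := c.lt_sizeUpTo_index_succ i
    simp only [Fin.val_succ] at h2
    omega⟩

theorem blockPermFun_lt {n : ℕ} (c : Composition n) {i j : Fin n} (hij : i < j) :
    (c.index i = c.index j → blockPermFun c i < blockPermFun c j) ∧
      (c.index i ≠ c.index j → blockPermFun c j < blockPermFun c i) := by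
  have hi1 := c.sizeUpTo_index_le i
  have hi2 := c.lt_sizeUpTo_index_succ i
  have hj1 := c.sizeUpTo_index_le j
  have hj2 := c.lt_sizeUpTo_index_succ j
  have hi3 := c.sizeUpTo_le (c.index i + 1)
  have hj3 := c.sizeUpTo_le (c.index j + 1)
  have hij' : (i : ℕ) < j := hij
  simp only [Fin.val_succ] at hi2 hj2
  constructor
  · intro h
    rw [Fin.lt_def]
    simp only [blockPermFun, h] at *
    omega
  · intro h
    have hlt : (c.index i : ℕ) < c.index j := by
      by_contra hcon
      have hlt : (c.index j : ℕ) < c.index i := by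
        have : (c.index i : ℕ) ≠ c.index j := fun h' => h (Fin.ext h')
        omega
      have := c.monotone_sizeUpTo (show (c.index j : ℕ) + 1 ≤ c.index i from hlt)
      omega
    have := c.monotone_sizeUpTo (show (c.index i : ℕ) + 1 ≤ c.index j from hlt)
    rw [Fin.lt_def]
    simp only [blockPermFun]
    omega

theorem blockPermFun_injective {n : ℕ} (c : Composition n) :
    Function.Injective (blockPermFun c) := by
  intro i j h
  rcases lt_trichotomy i j with hij | hij | hij
  · by_cases hc : c.index i = c.index j
    · exact absurd h ((blockPermFun_lt c hij).1 hc).ne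
    · exact absurd h ((blockPermFun_lt c hij).2 hc).ne'
  · exact hij
  · by_cases hc : c.index j = c.index i
    · exact absurd h ((blockPermFun_lt c hij).1 hc).ne'
    · exact absurd h ((blockPermFun_lt c hij).2 hc).ne

/-- The permutation of `blockPermFun`. -/
def blockPerm {n : ℕ} (c : Composition n) : Equiv.Perm (Fin n) :=
  Equiv.ofBijective (blockPermFun c) (Finite.injective_iff_bijective.1 (blockPermFun_injective c))

theorem mem_boundaries_iff {n : ℕ} (c : Composition n) (i : Fin (n + 1)) :
    i ∈ c.boundaries ↔ ∃ k ≤ c.length, c.sizeUpTo k = i := by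
  simp only [Composition.boundaries, Finset.mem_map, Finset.mem_univ, true_and]
  constructor
  · rintro ⟨k, rfl⟩
    exact ⟨k, Nat.lt_succ_iff.1 k.2, rfl⟩
  · rintro ⟨k, hk, h⟩
    exact ⟨⟨k, Nat.lt_succ_iff.2 hk⟩, Fin.ext h⟩

/-- The descents of `blockPerm c` are contained in `c'.boundaries` iff `c'` refines `c`. -/
theorem descents_blockPerm_subset {n : ℕ} (c c' : Composition n) :
    descents (blockPerm c) ⊆ c'.boundaries ↔ c.boundaries ⊆ c'.boundaries := by
  have hd : ∀ i : Fin (n + 1), i ∈ descents (blockPerm c) →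
      i ∈ c.boundaries := by
    intro i hi
    simp only [descents, Finset.mem_filter, Finset.mem_univ, true_and] at hi
    obtain ⟨a, b, ha, hb, hab⟩ := hi
    have hlt : a < b := by rw [Fin.lt_def]; omega
    have hne : c.index a ≠ c.index b := by
      intro h
      exact absurd ((blockPermFun_lt c hlt).1 h) (not_lt.2 (le_of_lt hab))
    rw [mem_boundaries_iff]
    have ha1 := c.sizeUpTo_index_le a
    have ha2 := c.lt_sizeUpTo_index_succ a
    have hb1 := c.sizeUpTo_index_le b
    have hb2 := c.lt_sizeUpTo_index_succ b
    simp only [Fin.val_succ] at ha2 hb2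
    have hl : (c.index a : ℕ) < c.index b := by
      by_contra hcon
      have hl : (c.index b : ℕ) + 1 ≤ c.index a := by
        have : (c.index a : ℕ) ≠ c.index b := fun h' => hne (Fin.ext h')
        omega
      have := c.monotone_sizeUpTo hl
      omega
    have := c.monotone_sizeUpTo (show (c.index a : ℕ) + 1 ≤ c.index b from hl)
    exact ⟨c.index b, (c.index b).2.le, by omega⟩
  constructor
  · intro h i hi
    by_cases h0 : (i : ℕ) = 0
    · rw [mem_boundaries_iff]
      exact ⟨0, Nat.zero_le _, by simp [h0]⟩
    by_cases hn : (i : ℕ) = n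
    · rw [mem_boundaries_iff]
      exact ⟨c'.length, le_rfl, by simp [hn]⟩
    apply h
    have hin : (i : ℕ) < n := by have := i.2; omega
    simp only [descents, Finset.mem_filter, Finset.mem_univ, true_and]
    have hab : (⟨i - 1, by omega⟩ : Fin n) < ⟨i, hin⟩ := by rw [Fin.lt_def]; simp only; omega
    refine ⟨⟨i - 1, by omega⟩, ⟨i, hin⟩, by simp only; omega, rfl,
      (blockPermFun_lt c hab).2 fun hc => ?_⟩
    have ha1 := c.sizeUpTo_index_le ⟨i - 1, by omega⟩
    have hb2 := c.lt_sizeUpTo_index_succ ⟨i, hin⟩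
    rw [hc] at ha1
    simp only [Fin.val_succ] at ha1 hb2
    obtain ⟨k, hk, hki⟩ := (mem_boundaries_iff c i).1 hi
    rcases le_or_gt k (c.index ⟨i, hin⟩) with hk' | hk'
    · have := c.monotone_sizeUpTo hk'
      omega
    · have := c.monotone_sizeUpTo (show (c.index ⟨i, hin⟩ : ℕ) + 1 ≤ k from hk')
      omega
  · exact fun h i hi => h (hd i hi)

theorem De_apply {n : ℕ} (c : Composition n) (σ : Equiv.Perm (Fin n)) :
    (De K c).coeff σ = if descents σ ⊆ c.boundaries then 1 else 0 := by
  classical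
  rw [De, MonoidAlgebra.coeff_sum, Finsupp.finsetSum_apply]
  simp [Finsupp.single_apply]

theorem boundaries_injective (n : ℕ) :
    Function.Injective (Composition.boundaries : Composition n → Finset (Fin (n + 1))) := by
  intro c c' h
  apply (compositionEquiv n).injective
  exact CompositionAsSet.ext h

/-- The elements `De_S` are linearly independent. -/
theorem linearIndependent_De (n : ℕ) : LinearIndependent K (De K (n := n)) := by
  classical
  rw [Fintype.linearIndependent_iff]
  intro a ha
  have hsum : ∀ c : Composition n, ∑ c' : Composition n,
      (if c.boundaries ⊆ c'.boundaries then a c' else 0) = 0 := by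
    intro c
    have h := congrArg (fun x : MonoidAlgebra K (Equiv.Perm (Fin n)) => x.coeff (blockPerm c)) ha
    simpa [MonoidAlgebra.coeff_sum, Finsupp.finsetSum_apply, De_apply,
      descents_blockPerm_subset] using h
  by_contra hne
  push Not at hne
  obtain ⟨c, hc, hmax⟩ := Finset.exists_max_image (Finset.univ.filter fun c => a c ≠ 0)
    (fun c => c.boundaries.card) (by obtain ⟨c, hc⟩ := hne; exact ⟨c, by simpa using hc⟩)
  have hc0 : a c ≠ 0 := by simpa using hc
  have := hsum c
  rw [Finset.sum_eq_single c] at this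
  · simp at this; exact hc0 this
  · intro c' _ hcc'
    split_ifs with hs
    · by_contra h0
      have h1 := hmax c' (by simpa using h0)
      exact hcc' (boundaries_injective n (Finset.eq_of_subset_of_card_le hs h1).symm)
    · rfl
  · simp

/-- The basis `(De_S)` of the descent algebra in degree `n`. -/
def DeBasis (n : ℕ) : Module.Basis (Composition n) K (Desc K n) :=
  Module.Basis.span (linearIndependent_De K n)

/-- The identity permutation `1ₘ` of `Sₘ`, as an element of the free associative algebra on the `1ₘ`,
`m ≥ 1`; by convention `1₀` is the unit. -/
def idPerm (m : ℕ) : FreeAlgebra K ℕ+ := if h : 0 < m then FreeAlgebra.ι K ⟨m, h⟩ else 1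

/-- As an algebra for the convolution product, the descent algebra is free on the identity
permutations `1ₘ`, `m ≥ 1`, and `De_S = 1_{c₁} * ⋯ * 1_{cₖ}` if `S = {c₁, c₁ + c₂, …}`.
This is the embedding of its degree `n` component in the free algebra. -/
def descToFree (n : ℕ) : Desc K n →ₗ[K] FreeAlgebra K ℕ+ :=
  (DeBasis K n).constr K fun c => (c.blocks.map (idPerm K)).prod

/-- The coproduct of the descent algebra: the algebra morphism with
`Δ(1ₘ) = ∑_{i + j = m} 1ᵢ ⊗ 1ⱼ`. -/
def descComul : FreeAlgebra K ℕ+ →ₐ[K] FreeAlgebra K ℕ+ ⊗[K] FreeAlgebra K ℕ+ :=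
  FreeAlgebra.lift K fun m : ℕ+ =>
    ∑ p ∈ Finset.HasAntidiagonal.antidiagonal (m : ℕ), idPerm K p.1 ⊗ₜ[K] idPerm K p.2

variable {K}

/-- A Lie idempotent family: for each `n ≥ 1`, a primitive element `ψₙ` of degree `n` of the descent
algebra in which `1ₙ = De_{{n}}` has coefficient `1` in the basis `(De_S)`, so that `ψₙ` acts as a
projector. (The value at `n = 0` is irrelevant.) -/
def IsLieIdempotentFamily (ψ : ∀ n, Desc K n) : Prop :=
  ∀ (n : ℕ) (hn : 0 < n),
    descComul K (descToFree K n (ψ n)) =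
      descToFree K n (ψ n) ⊗ₜ 1 + 1 ⊗ₜ descToFree K n (ψ n) ∧
    (DeBasis K n).repr (ψ n) (Composition.single n hn) = 1

end Descent

/-! ## The graded dual and the action of the descent algebra -/

section Dual

variable {K : Type u} [Field K] {A : Type v} [AddCommGroup A] [Module K A] (B : BialgData K A)
  (𝒜 : ℕ → Submodule K A)

/-- The graded dual `H = ⨁ₙ Aₙ^*` of a graded vector space `A = ⨁ₙ Aₙ`. -/
abbrev GDual := ⨁ n, Module.Dual K (𝒜 n)

variable [DirectSum.Decomposition 𝒜]

/-- The component `A_{p+q} → A_p ⊗ A_q` of the coproduct of `A`. -/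
def comulComponent (p q : ℕ) : 𝒜 (p + q) →ₗ[K] 𝒜 p ⊗[K] 𝒜 q :=
  TensorProduct.map (proj 𝒜 p) (proj 𝒜 q) ∘ₗ B.comul ∘ₗ (𝒜 (p + q)).subtype

/-- The component `A_p ⊗ A_q → Aₙ` of the product of `A`. -/
def mulComponent (p q n : ℕ) : 𝒜 p ⊗[K] 𝒜 q →ₗ[K] 𝒜 n :=
  proj 𝒜 n ∘ₗ B.mul ∘ₗ TensorProduct.map (𝒜 p).subtype (𝒜 q).subtype

/-- The product of the graded dual, dual to the coproduct of `A`: `f g = (f ⊗ g) ∘ Δ`. -/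
def dualMul : GDual 𝒜 ⊗[K] GDual 𝒜 →ₗ[K] GDual 𝒜 :=
  TensorProduct.lift <|
    DirectSum.toModule K ℕ _ fun p => (DirectSum.toModule K ℕ _ fun q =>
      (TensorProduct.curry (DirectSum.lof K ℕ (fun n => Module.Dual K (𝒜 n)) (p + q) ∘ₗ
        (comulComponent B 𝒜 p q).dualMap ∘ₗ TensorProduct.dualDistrib K (𝒜 p) (𝒜 q))).flip).flip

/-- The coproduct of the graded dual, dual to the product of `A`: the component of `Δ(f)` in
`A_p^* ⊗ A_q^* = (A_p ⊗ A_q)^*`, `p + q = n`, is `x ⊗ y ↦ f (x y)`, for `f` in `Aₙ^*`. -/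
def dualComul [∀ n, Module.Finite K (𝒜 n)] : GDual 𝒜 →ₗ[K] GDual 𝒜 ⊗[K] GDual 𝒜 :=
  DirectSum.toModule K ℕ _ fun n => ∑ p ∈ Finset.HasAntidiagonal.antidiagonal n,
    TensorProduct.map (DirectSum.lof K ℕ (fun n => Module.Dual K (𝒜 n)) p.1)
      (DirectSum.lof K ℕ (fun n => Module.Dual K (𝒜 n)) p.2) ∘ₗ
    (TensorProduct.dualDistribEquiv K (𝒜 p.1) (𝒜 p.2)).symm.toLinearMap ∘ₗ
      (mulComponent B 𝒜 p.1 p.2 n).dualMap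

/-- The unit of the graded dual: the counit of `A`, an element of `A₀^*`. -/
def dualOne : GDual 𝒜 :=
  DirectSum.lof K ℕ (fun n => Module.Dual K (𝒜 n)) 0 (B.counit ∘ₗ (𝒜 0).subtype)

/-- The counit of the graded dual: evaluation at the unit of `A`. -/
def dualCounit : GDual 𝒜 →ₗ[K] K :=
  DirectSum.toModule K ℕ K fun n => Module.Dual.eval K (𝒜 n) (proj 𝒜 n B.one)

/-- The graded dual of a graded bialgebra with finite dimensional components. -/
def dualData [∀ n, Module.Finite K (𝒜 n)] : BialgData K (GDual 𝒜) where
  mul := dualMul B 𝒜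
  one := dualOne B 𝒜
  comul := dualComul B 𝒜
  counit := dualCounit B 𝒜

/-- The convolution product `f ⊛ g = mul ∘ (f ⊗ g) ∘ Δ` of linear endomorphisms of a bialgebra. -/
def conv {H : Type w} [AddCommGroup H] [Module K H] (B : BialgData K H) (f g : H →ₗ[K] H) :
    H →ₗ[K] H :=
  B.mul ∘ₗ TensorProduct.map f g ∘ₗ B.comul

/-- The unit of the convolution product. -/
def convOne {H : Type w} [AddCommGroup H] [Module K H] (B : BialgData K H) : H →ₗ[K] H :=
  B.counit.smulRight B.one

/-- The action of the descent algebra on a graded bialgebra `H = ⨁ₙ Hₙ`, as an algebra map to the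
convolution algebra of `H`: the identity permutation `1ₙ` acts as the projection `pₙ` onto `Hₙ`,
hence `De_S` acts as `p_{c₁} ⊛ ⋯ ⊛ p_{cₖ}` if `S = {c₁, c₁ + c₂, …}`. -/
def descAct {H : ℕ → Type w} [∀ n, AddCommGroup (H n)] [∀ n, Module K (H n)]
    (B : BialgData K (⨁ n, H n)) (n : ℕ) : Desc K n →ₗ[K] Module.End K (⨁ n, H n) :=
  (DeBasis K n).constr K fun c => c.blocks.foldr
    (fun m F => conv B (DirectSum.lof K ℕ H m ∘ₗ DirectSum.component K ℕ H m) F) (convOne B)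

/-- The transpose `ψ^* : Aₙ → Aₙ` of the action `Hₙ → Hₙ` of an element `ψ` of degree `n` of the
descent algebra on the graded dual `H` of `A`, where `Hₙ = Aₙ^*`. -/
def descTranspose [∀ n, Module.Finite K (𝒜 n)] (n : ℕ) (ψ : Desc K n) : 𝒜 n →ₗ[K] 𝒜 n :=
  (Module.evalEquiv K (𝒜 n)).symm.toLinearMap ∘ₗ
    (DirectSum.component K ℕ (fun n => Module.Dual K (𝒜 n)) n ∘ₗ
      descAct (dualData B 𝒜) n ψ ∘ₗ
        DirectSum.lof K ℕ (fun n => Module.Dual K (𝒜 n)) n).dualMap ∘ₗ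
    (Module.evalEquiv K (𝒜 n)).toLinearMap

/-- The endomorphism `∑_{n ≥ 1} ψₙ^*` of `A`: it is `ψₙ^*` on `Aₙ`, `n ≥ 1`, and `0` on `A₀`. -/
def sumTranspose [∀ n, Module.Finite K (𝒜 n)] (ψ : ∀ n, Desc K n) : A →ₗ[K] A :=
  byDegree 𝒜 fun n =>
    if n = 0 then 0 else (𝒜 n).subtype ∘ₗ descTranspose B 𝒜 n (ψ n) ∘ₗ proj 𝒜 n

/-- The structure map `∑_{n ≥ 1} φ ∘ ψₙ^*` attached to a structure map `φ : A → V`. -/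
def lieStructureMap [∀ n, Module.Finite K (𝒜 n)] {V : Type w} [AddCommGroup V] [Module K V]
    (φ : A →ₗ[K] V) (ψ : ∀ n, Desc K n) : A →ₗ[K] V :=
  φ ∘ₗ sumTranspose B 𝒜 ψ

/-- The morphism `A → T(V)` induced by the structure map `∑_{n ≥ 1} φ ∘ ψₙ^*`. -/
def lieMorphism [∀ n, Module.Finite K (𝒜 n)] {V : Type w} [AddCommGroup V] [Module K V]
    (φ : A →ₗ[K] V) (ψ : ∀ n, Desc K n) : A →ₗ[K] TensorAlgebra K V :=
  induced 𝒜 B.comul B.counit (lieStructureMap B 𝒜 φ ψ)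

end Dual

end CofreeHopf

end

open CofreeHopf

/-! A coalgebra morphism `Φ` from a coalgebra `C` to the deconcatenation coalgebra `T(V)` is the
same thing as a solution of `Φ = 1 + (ι ∘ π) ⊛ Φ` in the convolution algebra `Hom(C, T(V))`, with `π
= π_V ∘ Φ` (`IsSeries.coalgHom`, `isSeries_coalgHom`). Convolving with `ι ∘ π` on the left adds a
letter, so the equation has at most one solution, and morphisms into `T(V)` agree once their
corestrictions to `V` agree (`coalgHom_ext`). The product attached to a bracket is the solution for
`π = br`; hence the Hopf algebra laws of the envelope become identities between brackets, which are
the `B_∞` axioms.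

In the same way, a coalgebra morphism `Φ` from a Hopf algebra `A` to the shuffle algebra is
multiplicative as soon as its corestriction satisfies `π(xy) = ε(y) π(x) + ε(x) π(y)`. This is what
primitivity of `ψ_n` provides. The transpose of the action on the graded dual is the action on `A`
itself by convolution products of the projections `p_m` (`isTranspose_descAct`). Since `p_m ∘ μ = μ
∘ ∑ p_i ⊗ p_j` mirrors `Δ(1_m) = ∑ 1_i ⊗ 1_j`, composing the action with the product `μ` corresponds
to the coproduct of the descent algebra (`freeAct_comul`). A primitive `ψ_n` therefore acts by a map
satisfying the identity above (`IsGradedCommHopf.dualAct_mul`).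

Bijectivity comes from the normalization of `ψ_n`. On a primitive element every convolution product
of at least two projections of positive degree vanishes, so `ψ_n^*` fixes the primitives of degree
`n` (`dualAct_primitive`) and `Φ` restricts there to `ι ∘ φ`. A morphism of graded coalgebras
injective on primitives is injective (`IsGradedCommHopf.injective_of_primitive`), and equality of
dimensions in each degree does the rest.

For the envelope the dimensions agree trivially. For a cofree `A`, the universal property and the
morphism induced by `φ` give mutually inverse graded coalgebra maps between `A` and `T^g(Prim A)`
(`exists_section_of_isCofreeGraded`). This supplies the dimension count and the automorphism `Θ`,
and cofreeness passes from `T^g(Prim A)` back to `A` through `Φ`. -/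

noncomputable section

namespace CofreeHopf

/-! ### Homogeneous components of graded spaces and of their tensor squares -/

section Graded

variable {K : Type u} [Field K] {A : Type v} [AddCommGroup A] [Module K A]

theorem tensorGr_le {𝒜 : ℕ → Submodule K A} {n : ℕ} {S : Submodule K (A ⊗[K] A)}
    (h : ∀ p q, p + q = n → ∀ a ∈ 𝒜 p, ∀ b ∈ 𝒜 q, a ⊗ₜ[K] b ∈ S) : tensorGr 𝒜 n ≤ S := by
  refine iSup₂_le fun p hp => ?_
  rintro _ ⟨z, rfl⟩
  induction z with
  | zero => simp
  | tmul a b => exact h p.1 p.2 (by simpa using hp) a a.2 b b.2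
  | add x y hx hy => rw [map_add]; exact S.add_mem hx hy

theorem tmul_mem_tensorGr {𝒜 : ℕ → Submodule K A} {p q n : ℕ} (h : p + q = n) {a b : A}
    (ha : a ∈ 𝒜 p) (hb : b ∈ 𝒜 q) : a ⊗ₜ[K] b ∈ tensorGr 𝒜 n := by
  have hm : (p, q) ∈ Finset.HasAntidiagonal.antidiagonal n := by simpa using h
  exact (le_iSup₂ (f := fun (p : ℕ × ℕ) (_ : p ∈ Finset.HasAntidiagonal.antidiagonal n) =>
    LinearMap.range (TensorProduct.map (𝒜 p.1).subtype (𝒜 p.2).subtype)) (p, q) hm)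
    ⟨⟨a, ha⟩ ⊗ₜ ⟨b, hb⟩, rfl⟩

/-- Linear maps that agree on tensors of homogeneous elements agree on `tensorGr`. -/
theorem eqOn_tensorGr {𝒜 : ℕ → Submodule K A} {n : ℕ} {M : Type*} [AddCommGroup M] [Module K M]
    {f g : A ⊗[K] A →ₗ[K] M}
    (h : ∀ p q, p + q = n → ∀ a ∈ 𝒜 p, ∀ b ∈ 𝒜 q, f (a ⊗ₜ b) = g (a ⊗ₜ b)) {x : A ⊗[K] A}
    (hx : x ∈ tensorGr 𝒜 n) : f x = g x :=
  (tensorGr_le (S := LinearMap.eqLocus f g) h) hx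

theorem map_mem_of_tensorGr {𝒜 : ℕ → Submodule K A} {n : ℕ} {M : Type*} [AddCommGroup M]
    [Module K M] {f : A ⊗[K] A →ₗ[K] M} {S : Submodule K M}
    (h : ∀ p q, p + q = n → ∀ a ∈ 𝒜 p, ∀ b ∈ 𝒜 q, f (a ⊗ₜ b) ∈ S) {x : A ⊗[K] A}
    (hx : x ∈ tensorGr 𝒜 n) : f x ∈ S :=
  (tensorGr_le (S := S.comap f) h) hx

theorem linearMap_ext_of_iSup {𝒜 : ℕ → Submodule K A} (h : ⨆ n, 𝒜 n = ⊤) {M : Type*}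
    [AddCommGroup M] [Module K M] {f g : A →ₗ[K] M} (hfg : ∀ n, ∀ x ∈ 𝒜 n, f x = g x) : f = g := by
  rw [← LinearMap.eqLocus_eq_top, eq_top_iff, ← h]
  exact iSup_le hfg

theorem iSup_tensorGr {𝒜 : ℕ → Submodule K A} (h : ⨆ n, 𝒜 n = ⊤) :
    ⨆ n, tensorGr 𝒜 n = ⊤ := by
  rw [eq_top_iff]
  rintro z -
  induction z with
  | zero => simp
  | add x y hx hy => exact Submodule.add_mem _ hx hy
  | tmul a b =>
    have ha : a ∈ ⨆ n, 𝒜 n := h ▸ Submodule.mem_top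
    have hb : b ∈ ⨆ n, 𝒜 n := h ▸ Submodule.mem_top
    induction ha using Submodule.iSup_induction' with
    | zero => simp
    | add x y _ _ hx hy => rw [TensorProduct.add_tmul]; exact Submodule.add_mem _ hx hy
    | mem p a ha =>
      induction hb using Submodule.iSup_induction' with
      | zero => simp
      | add x y _ _ hx hy => rw [TensorProduct.tmul_add]; exact Submodule.add_mem _ hx hy
      | mem q b hb =>
        exact Submodule.mem_iSup_of_mem (p + q) (tmul_mem_tensorGr rfl ha hb)

theorem iSup_eq_top_of_decomposition (𝒜 : ℕ → Submodule K A) [DirectSum.Decomposition 𝒜] :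
    ⨆ n, 𝒜 n = ⊤ :=
  (DirectSum.Decomposition.isInternal 𝒜).submodule_iSup_eq_top

theorem byDegree_of_mem (𝒜 : ℕ → Submodule K A) [DirectSum.Decomposition 𝒜] {M : Type*}
    [AddCommGroup M] [Module K M] (F : ℕ → (A →ₗ[K] M)) {n : ℕ} {x : A} (hx : x ∈ 𝒜 n) :
    byDegree 𝒜 F x = F n x := by
  simp only [byDegree, LinearMap.comp_apply, LinearEquiv.coe_coe,
    DirectSum.decomposeLinearEquiv_apply, DirectSum.decompose_of_mem 𝒜 hx]
  rw [← DirectSum.lof_eq_of K, DirectSum.toModule_lof]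
  rfl

theorem proj_of_mem (𝒜 : ℕ → Submodule K A) [DirectSum.Decomposition 𝒜] {n : ℕ} {x : A}
    (hx : x ∈ 𝒜 n) : (proj 𝒜 n x : A) = x := by
  exact DirectSum.decompose_of_mem_same 𝒜 hx

theorem proj_of_mem_ne (𝒜 : ℕ → Submodule K A) [DirectSum.Decomposition 𝒜] {m n : ℕ} {x : A}
    (hx : x ∈ 𝒜 m) (h : m ≠ n) : proj 𝒜 n x = 0 := by
  apply Subtype.ext
  exact DirectSum.decompose_of_mem_ne 𝒜 hx h

theorem eq_zero_of_proj (𝒜 : ℕ → Submodule K A) [DirectSum.Decomposition 𝒜] {x : A}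
    (h : ∀ n, proj 𝒜 n x = 0) : x = 0 := by
  apply (DirectSum.decomposeLinearEquiv 𝒜).injective
  rw [map_zero]
  refine DFinsupp.ext fun n => ?_
  exact h n

end Graded

/-! ### Convolution powers and geometric series -/

section Convolution

open WithConv Coalgebra

variable {K : Type u} [Field K] {C : Type v} [AddCommGroup C] [Module K C] [Coalgebra K C]
  {R : Type w} [Ring R] [Algebra K R]

theorem toConv_convPow (f : C →ₗ[K] R) (k : ℕ) :
    toConv (convPow comul counit f k) = toConv f ^ k := by
  induction k with
  | zero => rfl
  | succ k ih => rw [pow_succ', ← ih]; rfl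

theorem convMul_apply_mem {𝒞 : ℕ → Submodule K C}
    (hΔ : ∀ n, ∀ x ∈ 𝒞 n, comul (R := K) x ∈ tensorGr 𝒞 n) {f g : WithConv (C →ₗ[K] R)} {n : ℕ}
    {S : Submodule K R} (h : ∀ p q, p + q = n → ∀ a ∈ 𝒞 p, ∀ b ∈ 𝒞 q, f a * g b ∈ S)
    {x : C} (hx : x ∈ 𝒞 n) : (f * g) x ∈ S :=
  map_mem_of_tensorGr (f := LinearMap.mul' K R ∘ₗ TensorProduct.map f.ofConv g.ofConv) h
    (hΔ n x hx)

theorem convMul_apply_congr {𝒞 : ℕ → Submodule K C}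
    (hΔ : ∀ n, ∀ x ∈ 𝒞 n, comul (R := K) x ∈ tensorGr 𝒞 n) {f g f' g' : WithConv (C →ₗ[K] R)}
    {n : ℕ} (h : ∀ p q, p + q = n → ∀ a ∈ 𝒞 p, ∀ b ∈ 𝒞 q, f a * g b = f' a * g' b)
    {x : C} (hx : x ∈ 𝒞 n) : (f * g) x = (f' * g') x :=
  eqOn_tensorGr (f := LinearMap.mul' K R ∘ₗ TensorProduct.map f.ofConv g.ofConv)
    (g := LinearMap.mul' K R ∘ₗ TensorProduct.map f'.ofConv g'.ofConv) h (hΔ n x hx)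

/-- The `k`-th convolution power of a map that vanishes in degree `0` vanishes in degrees `< k`. -/
theorem convPow_eq_zero {𝒞 : ℕ → Submodule K C}
    (hΔ : ∀ n, ∀ x ∈ 𝒞 n, comul (R := K) x ∈ tensorGr 𝒞 n) {f : WithConv (C →ₗ[K] R)}
    (hf : ∀ x ∈ 𝒞 0, f x = 0) {k n : ℕ} (hn : n < k) {x : C} (hx : x ∈ 𝒞 n) : (f ^ k) x = 0 := by
  induction k generalizing n x with
  | zero => omega
  | succ k ih =>
    rw [pow_succ', ← Submodule.mem_bot K]
    refine convMul_apply_mem hΔ (fun p q hpq a ha b hb => ?_) hx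
    rw [Submodule.mem_bot]
    rcases Nat.eq_zero_or_pos p with rfl | hp
    · rw [hf a ha, zero_mul]
    · rw [ih (by omega) hb, mul_zero]

/-- A map that is given in degree `n` by the sum of the convolution powers `f^k`, `k ≤ n`, is a
geometric series in `f`. -/
theorem eq_one_add_mul_of_sum {𝒞 : ℕ → Submodule K C} (htop : ⨆ n, 𝒞 n = ⊤)
    (hΔ : ∀ n, ∀ x ∈ 𝒞 n, comul (R := K) x ∈ tensorGr 𝒞 n) {f Φ : WithConv (C →ₗ[K] R)}
    (hf : ∀ x ∈ 𝒞 0, f x = 0)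
    (hΦ : ∀ n, ∀ x ∈ 𝒞 n, Φ x = ∑ k ∈ Finset.range (n + 1), (f ^ k) x) : Φ = 1 + f * Φ := by
  have hsum : ∀ (s : Finset ℕ) (F : ℕ → WithConv (C →ₗ[K] R)) (x : C),
      (∑ k ∈ s, F k) x = ∑ k ∈ s, F k x := by
    intro s F x
    induction s using Finset.cons_induction with
    | empty => rfl
    | cons a s ha ih => rw [Finset.sum_cons, Finset.sum_cons, ← ih]; rfl
  -- The truncation may be lengthened freely, since powers above the degree vanish; this allows a
  -- single bound for all the degrees `q ≤ n` occurring in the coproduct.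
  have hbig : ∀ n N, n < N → ∀ x ∈ 𝒞 n, Φ x = (∑ k ∈ Finset.range N, f ^ k) x := by
    intro n N hN x hx
    rw [hΦ n x hx, hsum]
    refine Finset.sum_subset (by simpa using hN) fun k _ hk => ?_
    exact convPow_eq_zero hΔ hf (by simpa using hk) hx
  apply ofConv_injective
  refine linearMap_ext_of_iSup htop fun n x hx => ?_
  change Φ x = (1 + f * Φ) x
  have h1 : (f * Φ) x = (f * ∑ k ∈ Finset.range (n + 1), f ^ k) x := by
    refine convMul_apply_congr hΔ (fun p q hpq a ha b hb => ?_) hx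
    rw [hbig q (n + 1) (by omega) b hb]
  have h2 : (1 + f * Φ) x = (1 + f * ∑ k ∈ Finset.range (n + 1), f ^ k) x := by
    change (1 : WithConv (C →ₗ[K] R)) x + (f * Φ) x = (1 : WithConv (C →ₗ[K] R)) x + _
    rw [h1]
    rfl
  -- The bound is `n + 2` because multiplying the sum of the powers `k ≤ n` by `f` yields the powers
  -- up to `n + 1`.
  rw [h2, Finset.mul_sum, hbig n (n + 2) (by omega) x hx, Finset.sum_range_succ' _ (n + 1)]
  simp_rw [pow_succ', pow_zero]
  rw [add_comm]

end Convolution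

/-! ### The deconcatenation coalgebra and word length -/

section DeconcatCoalgebra

variable {K : Type u} [Field K] {V : Type v} [AddCommGroup V] [Module K V]

/-- Induction on the first letter, matching the recursion that defines the deconcatenation. The
predicate is shown to be stable under left multiplication by every element and then applied to `1`.
-/
theorem tensorAlgebra_induction_left {p : TensorAlgebra K V → Prop} (one : p 1)
    (ι_mul : ∀ v w, p w → p (TensorAlgebra.ι K v * w)) (add : ∀ x y, p x → p y → p (x + y))
    (smul : ∀ (c : K) x, p x → p (c • x)) (x : TensorAlgebra K V) : p x := by
  have key : ∀ x y : TensorAlgebra K V, p y → p (x * y) := by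
    intro x
    induction x using TensorAlgebra.induction with
    | algebraMap r => intro y hy; rw [← Algebra.smul_def]; exact smul r y hy
    | ι v => exact fun y => ι_mul v y
    | mul a b ha hb => intro y hy; rw [mul_assoc]; exact ha _ (hb y hy)
    | add a b ha hb => intro y hy; rw [add_mul]; exact add _ _ (ha y hy) (hb y hy)
  simpa using key x 1 one

theorem tensorAlgebra_hom_ext_left {M : Type*} [AddCommGroup M] [Module K M]
    {f g : TensorAlgebra K V →ₗ[K] M} (one : f 1 = g 1)
    (ι_mul : ∀ v w, f w = g w → f (TensorAlgebra.ι K v * w) = g (TensorAlgebra.ι K v * w)) :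
    f = g :=
  LinearMap.ext fun x => tensorAlgebra_induction_left (p := fun x => f x = g x) one ι_mul
    (fun x y hx hy => by rw [map_add, map_add, hx, hy])
    (fun c x hx => by rw [map_smul, map_smul, hx]) x

theorem word_nil : word (K := K) ([] : List V) = 1 := by simp [word]

theorem word_cons (v : V) (l : List V) :
    word (K := K) (v :: l) = TensorAlgebra.ι K v * word l := by simp [word]

variable (K V) in
@[simp] theorem deconcat_one : deconcat K V 1 = 1 ⊗ₜ 1 := by
  simp [deconcat]

theorem deconcatStep_apply (v : V)
    (x : TensorAlgebra K V × (TensorAlgebra K V ⊗[K] TensorAlgebra K V)) :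
    deconcatStep K V v x = (TensorAlgebra.ι K v * x.1,
      1 ⊗ₜ (TensorAlgebra.ι K v * x.1) + (TensorAlgebra.ι K v ⊗ₜ 1) * x.2) :=
  rfl

theorem deconcat_ι_mul (v : V) (w : TensorAlgebra K V) :
    deconcat K V (TensorAlgebra.ι K v * w) =
      1 ⊗ₜ (TensorAlgebra.ι K v * w) + (TensorAlgebra.ι K v ⊗ₜ 1) * deconcat K V w := by
  -- The first component of the state carried by the recursion is the element already read.
  have hfst : ∀ w : TensorAlgebra K V,
      ((TensorAlgebra.lift K (deconcatStep K V)) w (1, 1 ⊗ₜ 1)).1 = w := by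
    intro w
    induction w using tensorAlgebra_induction_left with
    | one => simp
    | ι_mul v w ih => simp [deconcatStep_apply, ih]
    | add x y hx hy => simp [hx, hy]
    | smul c x hx => simp [hx]
  have hw := hfst w
  simp only [deconcat, LinearMap.comp_apply, AlgHom.toLinearMap_apply, map_mul,
    TensorAlgebra.lift_ι_apply, LinearMap.applyₗ_apply_apply, Module.End.mul_apply] at hw ⊢
  simp [deconcatStep_apply, hw]

@[simp] theorem eps_one : eps K V 1 = 1 := by simp [eps]

@[simp] theorem eps_mul (x y : TensorAlgebra K V) : eps K V (x * y) = eps K V x * eps K V y := by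
  simp [eps]

@[simp] theorem eps_ι (v : V) : eps K V (TensorAlgebra.ι K v) = 0 := by
  simp [eps, TensorAlgebra.algebraMapInv]

@[simp] theorem piV_ι (v : V) : piV K V (TensorAlgebra.ι K v) = v :=
  TensorAlgebra.ι_leftInverse v

@[simp] theorem piV_one : piV K V 1 = 0 := by
  -- `TensorAlgebra.ιInv` goes through the trivial square-zero extension, which needs a right action
  -- of `K` on `V`; this is the same one as in its definition.
  let _ : Module Kᵐᵒᵖ V := Module.compHom _ ((RingHom.id K).fromOpposite mul_comm)
  have : IsCentralScalar K V := ⟨fun r m => rfl⟩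
  change (TensorAlgebra.toTrivSqZeroExt (1 : TensorAlgebra K V)).snd = 0
  rw [map_one, TrivSqZeroExt.snd_one]

@[simp] theorem piV_ι_mul (v : V) (w : TensorAlgebra K V) :
    piV K V (TensorAlgebra.ι K v * w) = eps K V w • v := by
  let _ : Module Kᵐᵒᵖ V := Module.compHom _ ((RingHom.id K).fromOpposite mul_comm)
  have : IsCentralScalar K V := ⟨fun r m => rfl⟩
  have h : ∀ w : TensorAlgebra K V, (TensorAlgebra.toTrivSqZeroExt w).fst = eps K V w := by
    intro w
    induction w using tensorAlgebra_induction_left with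
    | one => simp
    | ι_mul v w ih => simp
    | add x y hx hy => simp [hx, hy]
    | smul c x hx => simp [hx]
  change (TensorAlgebra.toTrivSqZeroExt (TensorAlgebra.ι K v * w)).snd = _
  simp [h]

variable (K V) in
/-- The deconcatenation coalgebra. -/
@[reducible] def deconcatCoalgebra : Coalgebra K (TensorAlgebra K V) where
  comul := deconcat K V
  counit := eps K V
  coassoc := by
    refine tensorAlgebra_hom_ext_left (by simp) fun v w h => ?_
    -- Pulling out a first letter produces an extra term beginning with `1 ⊗` here, and none in
    -- `h2`, because only here is the coproduct applied to the factor that carries the letter.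
    have h1 : ∀ z : TensorAlgebra K V ⊗[K] TensorAlgebra K V,
        TensorProduct.assoc K _ _ _ ((deconcat K V).rTensor _ ((TensorAlgebra.ι K v ⊗ₜ 1) * z)) =
          1 ⊗ₜ ((TensorAlgebra.ι K v ⊗ₜ 1) * z) + (TensorAlgebra.ι K v ⊗ₜ 1) *
            TensorProduct.assoc K _ _ _ ((deconcat K V).rTensor _ z) := by
      intro z
      induction z with
      | zero => simp
      | add x y hx hy => simp only [mul_add, map_add, hx, hy, TensorProduct.tmul_add]; abel
      | tmul a b =>
        simp only [Algebra.TensorProduct.tmul_mul_tmul, one_mul, LinearMap.rTensor_tmul,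
          deconcat_ι_mul, TensorProduct.add_tmul, map_add, TensorProduct.assoc_tmul]
        congr 1
        generalize deconcat K V a = d
        induction d with
        | zero => simp
        | add x y hx hy => simp only [mul_add, map_add, hx, hy, TensorProduct.add_tmul]
        | tmul x y => simp
    have h2 : ∀ z : TensorAlgebra K V ⊗[K] TensorAlgebra K V,
        (deconcat K V).lTensor _ ((TensorAlgebra.ι K v ⊗ₜ 1) * z) =
          (TensorAlgebra.ι K v ⊗ₜ 1) * (deconcat K V).lTensor _ z := by
      intro z
      induction z with
      | zero => simp
      | add x y hx hy => simp only [mul_add, map_add, hx, hy]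
      | tmul a b => simp
    simp only [LinearMap.comp_apply, LinearEquiv.coe_coe] at h ⊢
    rw [deconcat_ι_mul, map_add, map_add, map_add, h1, h2, h]
    simp [deconcat_ι_mul, TensorProduct.tmul_add, Algebra.TensorProduct.one_def, add_assoc]
  rTensor_counit_comp_comul := by
    refine tensorAlgebra_hom_ext_left (by simp) fun v w h => ?_
    have h1 : ∀ z : TensorAlgebra K V ⊗[K] TensorAlgebra K V,
        (eps K V).rTensor (TensorAlgebra K V) ((TensorAlgebra.ι K v ⊗ₜ 1) * z) = 0 := by
      intro z
      induction z with
      | zero => simp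
      | add x y hx hy => simp only [mul_add, map_add, hx, hy, add_zero]
      | tmul a b => simp
    simp [deconcat_ι_mul, h1]
  lTensor_counit_comp_comul := by
    refine tensorAlgebra_hom_ext_left (by simp) fun v w h => ?_
    have h1 : ∀ z : TensorAlgebra K V ⊗[K] TensorAlgebra K V,
        (eps K V).lTensor (TensorAlgebra K V) ((TensorAlgebra.ι K v ⊗ₜ 1) * z) =
          (TensorAlgebra.ι K v ⊗ₜ 1) * (eps K V).lTensor (TensorAlgebra K V) z := by
      intro z
      induction z with
      | zero => simp
      | add x y hx hy => simp only [mul_add, map_add, hx, hy]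
      | tmul a b => simp
    simp only [LinearMap.comp_apply] at h
    simp [deconcat_ι_mul, h1, h]

attribute [local instance] deconcatCoalgebra

theorem comul_eq_deconcat (x : TensorAlgebra K V) : Coalgebra.comul (R := K) x = deconcat K V x :=
  rfl

theorem counit_eq_eps (x : TensorAlgebra K V) : Coalgebra.counit (R := K) x = eps K V x :=
  rfl

/-- The projection of `T(V)` onto words of length `n`. -/
def lengthProj (K : Type u) [Field K] (V : Type v) [AddCommGroup V] [Module K V] (n : ℕ) :
    TensorAlgebra K V →ₗ[K] TensorAlgebra K V :=
  (LinearMap.range (TensorAlgebra.ι K (M := V)) ^ n).subtype ∘ₗ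
    proj (fun i : ℕ => LinearMap.range (TensorAlgebra.ι K (M := V)) ^ i) n

/-- With `lengthProj_succ_ι_mul`, this expresses that a prefixed letter shifts the length by one,
which drives the uniqueness of series. -/
theorem lengthProj_zero_ι_mul (v : V) (w : TensorAlgebra K V) :
    lengthProj K V 0 (TensorAlgebra.ι K v * w) = 0 := by
  have hv : TensorAlgebra.ι K v ∈ (LinearMap.range (TensorAlgebra.ι K (M := V))) ^ 1 := by simp
  exact DirectSum.coe_decompose_mul_of_left_mem_of_not_le
    (𝒜 := fun i : ℕ => LinearMap.range (TensorAlgebra.ι K (M := V)) ^ i) hv (by norm_num)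

theorem lengthProj_succ_ι_mul (n : ℕ) (v : V) (w : TensorAlgebra K V) :
    lengthProj K V (n + 1) (TensorAlgebra.ι K v * w) =
      TensorAlgebra.ι K v * lengthProj K V n w := by
  have hv : TensorAlgebra.ι K v ∈ (LinearMap.range (TensorAlgebra.ι K (M := V))) ^ 1 := by simp
  rw [add_comm]
  exact DirectSum.coe_decompose_mul_add_of_left_mem
    (𝒜 := fun i : ℕ => LinearMap.range (TensorAlgebra.ι K (M := V)) ^ i) hv

/-- Only finitely many lengths occur in a tensor. Quantifying over all `n ≥ N` lets the bounds of
two summands be merged. -/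
theorem exists_sum_lengthProj_rTensor {M : Type w} [AddCommGroup M] [Module K M]
    (z : TensorAlgebra K V ⊗[K] M) :
    ∃ N, ∀ n, N ≤ n → z = ∑ i ∈ Finset.range n, (lengthProj K V i).rTensor M z := by
  classical
  induction z with
  | zero => exact ⟨0, by simp⟩
  | add x y hx hy =>
    obtain ⟨N, hN⟩ := hx
    obtain ⟨N', hN'⟩ := hy
    refine ⟨max N N', fun n hn => ?_⟩
    simp only [map_add, Finset.sum_add_distrib]
    rw [← hN n (le_trans (le_max_left _ _) hn), ← hN' n (le_trans (le_max_right _ _) hn)]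
  | tmul a b =>
    let 𝒜 := fun i : ℕ => LinearMap.range (TensorAlgebra.ι K (M := V)) ^ i
    refine ⟨(DirectSum.decompose 𝒜 a).support.sup id + 1, fun n hn => ?_⟩
    simp only [LinearMap.rTensor_tmul, ← TensorProduct.sum_tmul]
    congr 1
    conv_lhs => rw [← DirectSum.sum_support_decompose 𝒜 a]
    refine Finset.sum_subset (fun i hi => ?_) fun i _ hi => ?_
    · have := Finset.le_sup (f := id) hi
      simp only [id] at this
      simp only [Finset.mem_range]
      omega
    · have : (DirectSum.decompose 𝒜 a) i = 0 := by simpa using hi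
      rw [this]; rfl

theorem eq_zero_of_lengthProj_rTensor {M : Type w} [AddCommGroup M] [Module K M]
    {z : TensorAlgebra K V ⊗[K] M} (h : ∀ n, (lengthProj K V n).rTensor M z = 0) : z = 0 := by
  obtain ⟨N, hN⟩ := exists_sum_lengthProj_rTensor z
  rw [hN N le_rfl]
  exact Finset.sum_eq_zero fun i _ => h i

theorem eq_zero_of_lengthProj {x : TensorAlgebra K V} (h : ∀ n, lengthProj K V n x = 0) :
    x = 0 := by
  have : x ⊗ₜ[K] (1 : K) = 0 := eq_zero_of_lengthProj_rTensor fun n => by simp [h n]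
  simpa using congrArg (TensorProduct.rid K _) this

end DeconcatCoalgebra

/-! ### Coalgebra morphisms into the tensor coalgebra as series -/

section CoalgebraMorphisms

attribute [local instance] deconcatCoalgebra

open WithConv Coalgebra

variable {K : Type u} [Field K] {V : Type v} [AddCommGroup V] [Module K V]
  {C : Type w} [AddCommGroup C] [Module K C] [Coalgebra K C]

/-- `Φ` is the geometric series `∑ₖ π^{⊗ k}` in the convolution algebra `Hom(C, T(V))`. -/
def IsSeries (π : C →ₗ[K] V) (Φ : C →ₗ[K] TensorAlgebra K V) : Prop :=
  toConv Φ = 1 + toConv (TensorAlgebra.ι K ∘ₗ π) * toConv Φ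

/-- Every term of the right-hand side starts with a letter, so the part of `D` of length `0`
vanishes and the part of length `n + 1` is determined by that of length `n`. The induction is on
length in `T(V)`, so `C` needs no grading. -/
theorem eq_zero_of_eq_conv {π : C →ₗ[K] V} {D : C →ₗ[K] TensorAlgebra K V}
    (h : toConv D = toConv (TensorAlgebra.ι K ∘ₗ π) * toConv D) : D = 0 := by
  have hD : ∀ x, D x = LinearMap.mul' K _ (TensorProduct.map (TensorAlgebra.ι K ∘ₗ π) D (comul x)) :=
    fun x => congrArg (fun F : WithConv (C →ₗ[K] TensorAlgebra K V) => F x) h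
  have h0 : lengthProj K V 0 ∘ₗ LinearMap.mul' K _ ∘ₗ
      TensorProduct.map (TensorAlgebra.ι K ∘ₗ π) D = 0 := by
    ext a b; simp [lengthProj_zero_ι_mul]
  have hs : ∀ n, lengthProj K V (n + 1) ∘ₗ LinearMap.mul' K _ ∘ₗ
      TensorProduct.map (TensorAlgebra.ι K ∘ₗ π) D =
      LinearMap.mul' K _ ∘ₗ TensorProduct.map (TensorAlgebra.ι K ∘ₗ π) (lengthProj K V n ∘ₗ D) := by
    intro n; ext a b; simp [lengthProj_succ_ι_mul]
  have key : ∀ n, lengthProj K V n ∘ₗ D = 0 := by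
    intro n
    induction n with
    | zero => ext x; rw [LinearMap.comp_apply, hD]; exact LinearMap.congr_fun h0 (comul x)
    | succ n ih =>
      ext x
      rw [LinearMap.comp_apply, hD]
      refine (LinearMap.congr_fun (hs n) (comul x)).trans ?_
      simp [ih]
  exact LinearMap.ext fun x => eq_zero_of_lengthProj fun n => LinearMap.congr_fun (key n) x

/-- The argument of `eq_zero_of_eq_conv`, measuring the length of the left tensor factor; it serves
to compare the two sides of the compatibility with coproducts. -/
theorem eq_zero_of_eq_conv_tensor {π : C →ₗ[K] V}
    {D : C →ₗ[K] TensorAlgebra K V ⊗[K] TensorAlgebra K V}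
    (h : toConv D = toConv ((TensorProduct.mk K _ (TensorAlgebra K V)).flip 1 ∘ₗ
      TensorAlgebra.ι K ∘ₗ π) * toConv D) : D = 0 := by
  set F := (TensorProduct.mk K _ (TensorAlgebra K V)).flip 1 ∘ₗ TensorAlgebra.ι K ∘ₗ π with hF
  have hD : ∀ x, D x = LinearMap.mul' K _ (TensorProduct.map F D (comul x)) :=
    fun x => congrArg (fun F : WithConv (C →ₗ[K] TensorAlgebra K V ⊗[K] TensorAlgebra K V) => F x) h
  have h0' : ∀ v (z : TensorAlgebra K V ⊗[K] TensorAlgebra K V),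
      (lengthProj K V 0).rTensor _ ((TensorAlgebra.ι K v ⊗ₜ 1) * z) = 0 := by
    intro v z
    induction z with
    | zero => simp
    | add x y hx hy => rw [mul_add, map_add, hx, hy, add_zero]
    | tmul x y => simp [lengthProj_zero_ι_mul]
  have hs' : ∀ n v (z : TensorAlgebra K V ⊗[K] TensorAlgebra K V),
      (lengthProj K V (n + 1)).rTensor _ ((TensorAlgebra.ι K v ⊗ₜ 1) * z) =
        (TensorAlgebra.ι K v ⊗ₜ 1) * (lengthProj K V n).rTensor _ z := by
    intro n v z
    induction z with
    | zero => simp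
    | add x y hx hy => rw [mul_add, map_add, hx, hy, map_add, mul_add]
    | tmul x y => simp [lengthProj_succ_ι_mul]
  have h0 : (lengthProj K V 0).rTensor _ ∘ₗ LinearMap.mul' K _ ∘ₗ TensorProduct.map F D = 0 := by
    ext a b; simp [hF, h0']
  have hs : ∀ n, (lengthProj K V (n + 1)).rTensor _ ∘ₗ LinearMap.mul' K _ ∘ₗ
      TensorProduct.map F D =
      LinearMap.mul' K _ ∘ₗ TensorProduct.map F ((lengthProj K V n).rTensor _ ∘ₗ D) := by
    intro n; ext a b; simp [hF, hs']
  have key : ∀ n, (lengthProj K V n).rTensor _ ∘ₗ D = 0 := by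
    intro n
    induction n with
    | zero => ext x; rw [LinearMap.comp_apply, hD]; exact LinearMap.congr_fun h0 (comul x)
    | succ n ih =>
      ext x
      rw [LinearMap.comp_apply, hD]
      refine (LinearMap.congr_fun (hs n) (comul x)).trans ?_
      simp [ih]
  exact LinearMap.ext fun x => eq_zero_of_lengthProj_rTensor fun n => LinearMap.congr_fun (key n) x

theorem IsSeries.unique {π : C →ₗ[K] V} {Φ Φ' : C →ₗ[K] TensorAlgebra K V} (h : IsSeries π Φ)
    (h' : IsSeries π Φ') : Φ = Φ' := by
  refine sub_eq_zero.1 (eq_zero_of_eq_conv (π := π) ?_)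
  rw [toConv_sub, mul_sub]
  conv_lhs => rw [h, h']
  abel

theorem IsSeries.apply {π : C →ₗ[K] V} {Φ : C →ₗ[K] TensorAlgebra K V} (h : IsSeries π Φ) (x : C) :
    Φ x = algebraMap K _ (counit (R := K) x) + LinearMap.mul' K _
      (TensorProduct.map (TensorAlgebra.ι K ∘ₗ π) Φ (comul (R := K) x)) :=
  congrArg (fun F : WithConv (C →ₗ[K] TensorAlgebra K V) => F x) h

/-- All terms of the series other than the constant one begin with a letter and are killed by `ε`.
-/
theorem IsSeries.counit {π : C →ₗ[K] V} {Φ : C →ₗ[K] TensorAlgebra K V} (h : IsSeries π Φ) :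
    eps K V ∘ₗ Φ = counit := by
  ext x
  have h0 : eps K V ∘ₗ LinearMap.mul' K _ ∘ₗ TensorProduct.map (TensorAlgebra.ι K ∘ₗ π) Φ = 0 := by
    ext a b; simp
  rw [LinearMap.comp_apply, h.apply, map_add]
  have := LinearMap.congr_fun h0 (comul x)
  simp only [LinearMap.comp_apply, LinearMap.zero_apply] at this
  rw [this, Algebra.algebraMap_eq_smul_one]
  simp

/-- As `π_V(v w) = ε(w) v`, the projection of `(ι ∘ π) ⊛ Φ` is `π ⊛ (ε ∘ Φ)`, which is `π` by the
counit axiom. -/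
theorem IsSeries.piV {π : C →ₗ[K] V} {Φ : C →ₗ[K] TensorAlgebra K V} (h : IsSeries π Φ) :
    piV K V ∘ₗ Φ = π := by
  ext x
  have h0 : CofreeHopf.piV K V ∘ₗ LinearMap.mul' K _ ∘ₗ
      TensorProduct.map (TensorAlgebra.ι K ∘ₗ π) Φ =
      π ∘ₗ (TensorProduct.rid K C).toLinearMap ∘ₗ LinearMap.lTensor C (eps K V ∘ₗ Φ) := by
    ext a b; simp
  rw [LinearMap.comp_apply, h.apply, map_add]
  have := LinearMap.congr_fun h0 (comul x)
  rw [h.counit] at this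
  simp only [LinearMap.comp_apply] at this
  rw [this, Algebra.algebraMap_eq_smul_one]
  simp

/-- Both sides solve `D = RΦ + F ⊛ D`, where `F = (ι ∘ π) ⊗ 1` and `RΦ = 1 ⊗ Φ`; their difference
solves the homogeneous equation and vanishes. -/
theorem IsSeries.comul {π : C →ₗ[K] V} {Φ : C →ₗ[K] TensorAlgebra K V} (h : IsSeries π Φ) :
    TensorProduct.map Φ Φ ∘ₗ comul = deconcat K V ∘ₗ Φ := by
  let L : TensorAlgebra K V →ₐ[K] TensorAlgebra K V ⊗[K] TensorAlgebra K V :=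
    Algebra.TensorProduct.includeLeft
  let R : TensorAlgebra K V →ₐ[K] TensorAlgebra K V ⊗[K] TensorAlgebra K V :=
    Algebra.TensorProduct.includeRight
  let F : WithConv (C →ₗ[K] TensorAlgebra K V ⊗[K] TensorAlgebra K V) :=
    toConv (L.toLinearMap ∘ₗ TensorAlgebra.ι K ∘ₗ π)
  let RΦ : WithConv (C →ₗ[K] TensorAlgebra K V ⊗[K] TensorAlgebra K V) :=
    toConv (R.toLinearMap ∘ₗ Φ)
  let LΦ : WithConv (C →ₗ[K] TensorAlgebra K V ⊗[K] TensorAlgebra K V) :=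
    toConv (L.toLinearMap ∘ₗ Φ)
  have h1 : toConv (TensorProduct.map Φ Φ ∘ₗ Coalgebra.comul) = LΦ * RΦ := by
    have : TensorProduct.map Φ Φ =
        LinearMap.mul' K _ ∘ₗ TensorProduct.map (L.toLinearMap ∘ₗ Φ) (R.toLinearMap ∘ₗ Φ) := by
      ext a b; simp [L, R]
    rw [this]; rfl
  -- The series equation is pushed forward along the algebra morphism `x ↦ x ⊗ 1`.
  have h2 : LΦ = 1 + F * LΦ := by
    have := congrArg (fun G : WithConv (C →ₗ[K] TensorAlgebra K V) =>
      toConv (L.toLinearMap ∘ₗ G.ofConv)) h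
    refine this.trans ?_
    have e : ∀ G : WithConv (C →ₗ[K] TensorAlgebra K V), toConv (L.toLinearMap ∘ₗ (1 + G).ofConv) =
        1 + toConv (L.toLinearMap ∘ₗ G.ofConv) := by
      intro G
      apply ofConv_injective
      ext x
      simp [L, LinearMap.convOne_def, TensorProduct.add_tmul]
    rw [e]
    congr 1
    exact congrArg toConv (LinearMap.algHom_comp_convMul_distrib L _ _)
  -- This is the recursion `Δ(v w) = 1 ⊗ v w + (v ⊗ 1) Δ(w)` applied to the series; its first terms,
  -- with the constant one, reassemble into `RΦ`.
  have h3 : toConv (deconcat K V ∘ₗ Φ) = RΦ + F * toConv (deconcat K V ∘ₗ Φ) := by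
    apply ofConv_injective
    refine LinearMap.ext fun x => ?_
    have e : deconcat K V ∘ₗ LinearMap.mul' K _ ∘ₗ TensorProduct.map (TensorAlgebra.ι K ∘ₗ π) Φ =
        R.toLinearMap ∘ₗ LinearMap.mul' K _ ∘ₗ TensorProduct.map (TensorAlgebra.ι K ∘ₗ π) Φ +
        LinearMap.mul' K _ ∘ₗ TensorProduct.map (L.toLinearMap ∘ₗ TensorAlgebra.ι K ∘ₗ π)
          (deconcat K V ∘ₗ Φ) := by
      ext a b; simp [L, R, deconcat_ι_mul]
    have e' := LinearMap.congr_fun e (Coalgebra.comul x)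
    change deconcat K V (Φ x) = R (Φ x) + LinearMap.mul' K _ (TensorProduct.map
      (L.toLinearMap ∘ₗ TensorAlgebra.ι K ∘ₗ π) (deconcat K V ∘ₗ Φ) (Coalgebra.comul x))
    simp only [LinearMap.comp_apply, LinearMap.add_apply] at e'
    rw [h.apply, map_add, map_add, e', Algebra.algebraMap_eq_smul_one, map_smul, deconcat_one,
      map_smul, map_one, add_assoc]
    rfl
  have h4 : LΦ * RΦ = RΦ + F * (LΦ * RΦ) := by
    conv_lhs => rw [h2]
    rw [add_mul, one_mul, mul_assoc]
  refine sub_eq_zero.1 (eq_zero_of_eq_conv_tensor (π := π) ?_)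
  change _ = F * _
  rw [toConv_sub, h1]
  refine Eq.trans ?_ (mul_sub F _ _).symm
  conv_lhs => rw [h3, h4]
  abel

/-- The coalgebra morphism `C → T(V)` with a given corestriction to `V`. -/
def IsSeries.coalgHom {π : C →ₗ[K] V} {Φ : C →ₗ[K] TensorAlgebra K V} (h : IsSeries π Φ) :
    C →ₗc[K] TensorAlgebra K V :=
  { Φ with
    counit_comp := h.counit
    map_comp_comul := h.comul }

/-- A nonempty word is its first letter times the remaining word, and `π_V` selects exactly this
term of the deconcatenation. -/
theorem isSeries_id : IsSeries (piV K V) (LinearMap.id : TensorAlgebra K V →ₗ[K] _) := by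
  apply ofConv_injective
  change LinearMap.id = Algebra.linearMap K _ ∘ₗ eps K V + LinearMap.mul' K _ ∘ₗ
    TensorProduct.map (TensorAlgebra.ι K ∘ₗ piV K V) LinearMap.id ∘ₗ deconcat K V
  refine tensorAlgebra_hom_ext_left (by simp) fun v w h => ?_
  have h0 : ∀ z : TensorAlgebra K V ⊗[K] TensorAlgebra K V,
      LinearMap.mul' K _ (TensorProduct.map (TensorAlgebra.ι K ∘ₗ piV K V) LinearMap.id
        ((TensorAlgebra.ι K v ⊗ₜ 1) * z)) = TensorAlgebra.ι K v * TensorProduct.lid K _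
          ((eps K V).rTensor _ z) := by
    intro z
    induction z with
    | zero => simp
    | add x y hx hy => simp only [mul_add, map_add, hx, hy]
    | tmul x y => simp
  have h1 := LinearMap.congr_fun (rTensor_counit_comp_comul (R := K) (A := TensorAlgebra K V)) w
  have h2 : (eps K V).rTensor _ (deconcat K V w) = 1 ⊗ₜ w := h1
  simp [deconcat_ι_mul, h0, h2]

/-- Precomposition with a coalgebra morphism is multiplicative for convolution, so the series
equation of the identity pulls back along `Φ`. -/
theorem isSeries_coalgHom (Φ : C →ₗc[K] TensorAlgebra K V) :
    IsSeries (piV K V ∘ₗ Φ.toLinearMap) Φ.toLinearMap := by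
  have h := congrArg (fun F : WithConv (TensorAlgebra K V →ₗ[K] TensorAlgebra K V) =>
    toConv (F.ofConv ∘ₗ Φ.toLinearMap)) (isSeries_id (K := K) (V := V))
  refine h.trans ?_
  apply ofConv_injective
  change (ofConv (1 : WithConv (TensorAlgebra K V →ₗ[K] TensorAlgebra K V)) +
    ofConv (_ * _)) ∘ₗ Φ.toLinearMap = _
  rw [LinearMap.add_comp, LinearMap.convMul_comp_coalgHom_distrib]
  change _ = ofConv (1 : WithConv (C →ₗ[K] TensorAlgebra K V)) + ofConv (_ * _)
  congr 1
  ext x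
  simp [LinearMap.convOne_def]

/-- The uniqueness half of cofreeness, for an arbitrary coalgebra `C`. Every identity between
products or morphisms with values in `T(V)` is reduced to `V` through it. -/
theorem coalgHom_ext {Φ Φ' : C →ₗc[K] TensorAlgebra K V}
    (h : ∀ x, piV K V (Φ x) = piV K V (Φ' x)) : Φ = Φ' := by
  have h1 := isSeries_coalgHom Φ
  have h2 := isSeries_coalgHom Φ'
  have : piV K V ∘ₗ Φ.toLinearMap = piV K V ∘ₗ Φ'.toLinearMap := LinearMap.ext h
  rw [this] at h1
  exact CoalgHom.ext fun x => LinearMap.congr_fun (h1.unique h2) x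

end CoalgebraMorphisms

attribute [local instance] deconcatCoalgebra

/-! ### Series on graded coalgebras and on their tensor squares -/

section GradedSeries

open WithConv Coalgebra

variable {K : Type u} [Field K] {V : Type v} [AddCommGroup V] [Module K V]
  {C : Type w} [AddCommGroup C] [Module K C] [Coalgebra K C]

theorem isSeries_induced (𝒞 : ℕ → Submodule K C) [DirectSum.Decomposition 𝒞]
    (hΔ : ∀ n, ∀ x ∈ 𝒞 n, comul (R := K) x ∈ tensorGr 𝒞 n) {π : C →ₗ[K] V}
    (hπ : ∀ x ∈ 𝒞 0, π x = 0) : IsSeries π (induced 𝒞 comul counit π) := by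
  refine eq_one_add_mul_of_sum (iSup_eq_top_of_decomposition 𝒞) hΔ
    (fun x hx => by simp [hπ x hx]) fun n x hx => ?_
  change induced 𝒞 comul counit π x = _
  rw [induced, byDegree_of_mem 𝒞 _ hx, LinearMap.sum_apply]
  refine Finset.sum_congr rfl fun k _ => ?_
  rw [← toConv_convPow]

/-- Strong induction through the series equation: as `π` vanishes in degree `0`, the remaining
factor `Φ` is evaluated in strictly smaller degree. -/
theorem IsSeries.mem_gr {π : C →ₗ[K] V} {Φ : C →ₗ[K] TensorAlgebra K V} (h : IsSeries π Φ)
    {𝒞 : ℕ → Submodule K C} (hΔ : ∀ n, ∀ x ∈ 𝒞 n, Coalgebra.comul (R := K) x ∈ tensorGr 𝒞 n)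
    (hε : ∀ n, n ≠ 0 → ∀ x ∈ 𝒞 n, Coalgebra.counit (R := K) x = 0) {𝒱 : ℕ → Submodule K V}
    (h0 : 𝒱 0 = ⊥) (hπ : ∀ n, ∀ x ∈ 𝒞 n, π x ∈ 𝒱 n) :
    ∀ n, ∀ x ∈ 𝒞 n, Φ x ∈ gr 𝒱 n := by
  intro n
  induction n using Nat.strong_induction_on with
  | _ n ih =>
    intro x hx
    rw [h.apply]
    refine Submodule.add_mem _ ?_ ?_
    · rcases eq_or_ne n 0 with rfl | hn
      · rw [Algebra.algebraMap_eq_smul_one]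
        exact Submodule.smul_mem _ _ SetLike.GradedOne.one_mem
      · rw [hε n hn x hx, map_zero]; exact Submodule.zero_mem _
    · refine map_mem_of_tensorGr (f := LinearMap.mul' K _ ∘ₗ
        TensorProduct.map (TensorAlgebra.ι K ∘ₗ π) Φ) (fun p q hpq a ha b hb => ?_) (hΔ n x hx)
      simp only [LinearMap.comp_apply, TensorProduct.map_tmul, LinearMap.mul'_apply]
      rcases Nat.eq_zero_or_pos p with rfl | hp
      · have := hπ 0 a ha
        rw [h0, Submodule.mem_bot] at this
        rw [this, map_zero, zero_mul]
        exact Submodule.zero_mem _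
      · rw [← hpq]
        exact SetLike.GradedMul.mul_mem (ι_mem_gr (hπ p a ha)) (ih q (by omega) b hb)

/-- The total grading of the tensor square of a graded coalgebra is a coalgebra grading. -/
theorem comul_mem_tensorGr_tensorGr {𝒞 : ℕ → Submodule K C}
    (hΔ : ∀ n, ∀ x ∈ 𝒞 n, comul (R := K) x ∈ tensorGr 𝒞 n) (n : ℕ) (x : C ⊗[K] C)
    (hx : x ∈ tensorGr 𝒞 n) : comul (R := K) x ∈ tensorGr (tensorGr 𝒞) n := by
  refine map_mem_of_tensorGr (f := comul (R := K) (A := C ⊗[K] C)) (fun p q hpq a ha b hb => ?_) hx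
  rw [TensorProduct.comul_tmul, TensorProduct.AlgebraTensorModule.tensorTensorTensorComm_eq]
  have ha' := hΔ p a ha
  have hb' := hΔ q b hb
  generalize comul (R := K) a = s at ha'
  generalize comul (R := K) b = t at hb'
  refine map_mem_of_tensorGr (f := (TensorProduct.tensorTensorTensorComm K C C C C).toLinearMap ∘ₗ
    (TensorProduct.mk K _ _).flip t) (fun i j hij a ha b hb => ?_) ha'
  refine map_mem_of_tensorGr (f := (TensorProduct.tensorTensorTensorComm K C C C C).toLinearMap ∘ₗ
    (TensorProduct.mk K _ _ (a ⊗ₜ b))) (fun i' j' hij' a' ha' b' hb' => ?_) hb'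
  simp only [LinearMap.comp_apply, TensorProduct.mk_apply, LinearEquiv.coe_coe,
    TensorProduct.tensorTensorTensorComm_tmul]
  exact tmul_mem_tensorGr (show (i + i') + (j + j') = n by omega)
    (tmul_mem_tensorGr rfl ha ha') (tmul_mem_tensorGr rfl hb hb')

theorem counit_eq_zero_of_mem_tensorGr {𝒞 : ℕ → Submodule K C}
    (hε : ∀ n, n ≠ 0 → ∀ x ∈ 𝒞 n, Coalgebra.counit (R := K) x = 0) (n : ℕ) (hn : n ≠ 0)
    (x : C ⊗[K] C) (hx : x ∈ tensorGr 𝒞 n) : Coalgebra.counit (R := K) x = 0 := by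
  rw [← Submodule.mem_bot K]
  refine map_mem_of_tensorGr (f := Coalgebra.counit (R := K) (A := C ⊗[K] C))
    (fun p q hpq a ha b hb => ?_) hx
  rw [TensorProduct.counit_tmul, Submodule.mem_bot]
  rcases eq_or_ne p 0 with rfl | hp
  · rw [hε q (by omega) b hb, zero_smul]
  · rw [hε p hp a ha, smul_zero]

/-- The flip of the tensor square of a coalgebra. -/
def commCoalgHom (K : Type u) [Field K] (C : Type w) [AddCommGroup C] [Module K C]
    [Coalgebra K C] : C ⊗[K] C →ₗc[K] C ⊗[K] C :=
  { (TensorProduct.comm K C C).toLinearMap with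
    counit_comp := by ext a b; simp [mul_comm]
    map_comp_comul := by
      ext a b
      simp only [TensorProduct.AlgebraTensorModule.curry_apply, TensorProduct.curry_apply,
        LinearMap.coe_restrictScalars, LinearMap.comp_apply, LinearEquiv.coe_coe,
        TensorProduct.comm_tmul, TensorProduct.comul_tmul,
        TensorProduct.AlgebraTensorModule.tensorTensorTensorComm_eq]
      generalize comul (R := K) a = s
      generalize comul (R := K) b = t
      induction s with
      | zero => simp
      | add x y hx hy => simp only [TensorProduct.add_tmul, TensorProduct.tmul_add, map_add, hx, hy]
      | tmul x y =>
        induction t with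
        | zero => simp
        | add x y hx hy =>
          simp only [TensorProduct.add_tmul, TensorProduct.tmul_add, map_add, hx, hy]
        | tmul x y => simp }

end GradedSeries

/-! ### Compatibility of deconcatenation with the gradings by length and by weight -/

section TensorGrading

variable {K : Type u} [Field K] {V : Type v} [AddCommGroup V] [Module K V]

/-- Stated for any multiplicative grading, so as to cover both `gr` and the grading by word length.
-/
theorem deconcat_ι_mul_mem {𝒢 : ℕ → Submodule K (TensorAlgebra K V)} [SetLike.GradedMonoid 𝒢]
    {p n : ℕ} {v : V} {w : TensorAlgebra K V} (hv : TensorAlgebra.ι K v ∈ 𝒢 p) (hw : w ∈ 𝒢 n)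
    (hΔ : deconcat K V w ∈ tensorGr 𝒢 n) :
    deconcat K V (TensorAlgebra.ι K v * w) ∈ tensorGr 𝒢 (p + n) := by
  rw [deconcat_ι_mul]
  refine Submodule.add_mem _ (tmul_mem_tensorGr (zero_add _) SetLike.GradedOne.one_mem
    (SetLike.GradedMul.mul_mem hv hw)) ?_
  refine map_mem_of_tensorGr (f := LinearMap.mulLeft K (TensorAlgebra.ι K v ⊗ₜ[K] 1))
    (fun i j hij a ha b hb => ?_) hΔ
  rw [LinearMap.mulLeft_apply, Algebra.TensorProduct.tmul_mul_tmul, one_mul]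
  exact tmul_mem_tensorGr (by omega) (SetLike.GradedMul.mul_mem hv ha) hb

theorem gr_induction {𝒱 : ℕ → Submodule K V} {p : ℕ → TensorAlgebra K V → Prop} (one : p 0 1)
    (ι_mul : ∀ m n v w, v ∈ 𝒱 m → w ∈ gr 𝒱 n → p n w → p (m + n) (TensorAlgebra.ι K v * w))
    (zero : ∀ n, p n 0) (add : ∀ n x y, p n x → p n y → p n (x + y))
    (smul : ∀ n (c : K) x, p n x → p n (c • x)) {n : ℕ} {x : TensorAlgebra K V}
    (hx : x ∈ gr 𝒱 n) : p n x := by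
  induction hx using Submodule.span_induction with
  | zero => exact zero n
  | add x y _ _ hx hy => exact add n x y hx hy
  | smul c x _ hx => exact smul n c x hx
  | mem x hx =>
    obtain ⟨l, hl, rfl, rfl⟩ := hx
    induction l with
    | nil => simpa [word_nil] using one
    | cons q l ih =>
      have hl' : ∀ q ∈ l, q.2 ∈ 𝒱 q.1 := fun q hq => hl q (List.mem_cons_of_mem _ hq)
      rw [List.map_cons, List.map_cons, List.sum_cons, word_cons]
      exact ι_mul _ _ _ _ (hl q List.mem_cons_self) (Submodule.subset_span ⟨l, hl', rfl, rfl⟩)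
        (ih hl')

theorem one_mem_gr (𝒱 : ℕ → Submodule K V) : (1 : TensorAlgebra K V) ∈ gr 𝒱 0 :=
  SetLike.GradedOne.one_mem

theorem deconcat_mem_tensorGr_gr (𝒱 : ℕ → Submodule K V) (n : ℕ) (x : TensorAlgebra K V)
    (hx : x ∈ gr 𝒱 n) : deconcat K V x ∈ tensorGr (gr 𝒱) n :=
  gr_induction (p := fun n x => deconcat K V x ∈ tensorGr (gr 𝒱) n)
    (by
      rw [deconcat_one]
      exact tmul_mem_tensorGr (zero_add 0) (one_mem_gr 𝒱) (one_mem_gr 𝒱))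
    (fun _ _ _ _ hv hw h => deconcat_ι_mul_mem (ι_mem_gr hv) hw h)
    (fun n => by simp)
    (fun _ _ _ hx hy => by rw [map_add]; exact Submodule.add_mem _ hx hy)
    (fun _ _ _ hx => by rw [map_smul]; exact Submodule.smul_mem _ _ hx) hx

theorem deconcat_mem_tensorGr_length (n : ℕ) (x : TensorAlgebra K V)
    (hx : x ∈ LinearMap.range (TensorAlgebra.ι K (M := V)) ^ n) :
    deconcat K V x ∈ tensorGr (fun i : ℕ => LinearMap.range (TensorAlgebra.ι K (M := V)) ^ i) n := by
  induction hx using Submodule.pow_induction_on_left' with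
  | algebraMap r =>
    rw [Algebra.algebraMap_eq_smul_one, map_smul, deconcat_one]
    have h1 : (1 : TensorAlgebra K V) ∈ LinearMap.range (TensorAlgebra.ι K (M := V)) ^ 0 := by
      rw [pow_zero]; exact Submodule.one_le.1 le_rfl
    exact Submodule.smul_mem _ _ (tmul_mem_tensorGr (𝒜 := fun i : ℕ =>
      LinearMap.range (TensorAlgebra.ι K (M := V)) ^ i) (zero_add 0) h1 h1)
  | add x y i _ _ hx hy => rw [map_add]; exact Submodule.add_mem _ hx hy
  | mem_mul m hm i x hx ih =>
    obtain ⟨v, rfl⟩ := hm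
    rw [Nat.succ_eq_one_add]
    exact deconcat_ι_mul_mem (𝒢 := fun i : ℕ => LinearMap.range (TensorAlgebra.ι K (M := V)) ^ i)
      (by simp) hx ih

theorem eps_eq_zero_of_mem_gr (𝒱 : ℕ → Submodule K V) (n : ℕ) (hn : n ≠ 0)
    (x : TensorAlgebra K V) (hx : x ∈ gr 𝒱 n) : eps K V x = 0 :=
  gr_induction (p := fun n x => n ≠ 0 → eps K V x = 0) (fun h => absurd rfl h)
    (fun _ _ _ _ _ _ _ _ => by simp) (fun _ _ => map_zero _)
    (fun _ _ _ hx hy h => by rw [map_add, hx h, hy h, add_zero])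
    (fun _ _ _ hx h => by rw [map_smul, hx h, smul_zero]) hx hn

theorem gr_zero (𝒱 : ℕ → Submodule K V) (h0 : 𝒱 0 = ⊥) :
    gr 𝒱 0 = Submodule.span K {(1 : TensorAlgebra K V)} := by
  refine le_antisymm (fun x hx => ?_) ?_
  · refine gr_induction (p := fun n x => n = 0 → x ∈ Submodule.span K {(1 : TensorAlgebra K V)})
      (fun _ => Submodule.mem_span_singleton_self _) (fun m n v w hv _ _ h => ?_)
      (fun _ _ => Submodule.zero_mem _) (fun _ _ _ hx hy h => Submodule.add_mem _ (hx h) (hy h))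
      (fun _ _ _ hx h => Submodule.smul_mem _ _ (hx h)) hx rfl
    obtain rfl : m = 0 := by omega
    rw [h0, Submodule.mem_bot] at hv
    rw [hv, map_zero, zero_mul]
    exact Submodule.zero_mem _
  · rw [Submodule.span_singleton_le_iff_mem]
    exact SetLike.GradedOne.one_mem

theorem piV_mem_of_mem_gr (𝒱 : ℕ → Submodule K V) (n : ℕ)
    (x : TensorAlgebra K V) (hx : x ∈ gr 𝒱 n) : piV K V x ∈ 𝒱 n :=
  gr_induction (p := fun n x => piV K V x ∈ 𝒱 n) (by simp)
    (fun m n v w hv hw _ => by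
      rw [piV_ι_mul]
      rcases eq_or_ne n 0 with rfl | hn
      · exact Submodule.smul_mem _ _ hv
      · rw [eps_eq_zero_of_mem_gr 𝒱 n hn w hw, zero_smul]; exact Submodule.zero_mem _)
    (fun _ => by simp) (fun _ _ _ hx hy => by rw [map_add]; exact Submodule.add_mem _ hx hy)
    (fun _ _ _ hx => by rw [map_smul]; exact Submodule.smul_mem _ _ hx) hx

end TensorGrading

/-! ### The Hopf algebra attached to a `B_∞`-structure -/

section Envelope

open WithConv Coalgebra

variable {K : Type u} [Field K] {V : Type v} [AddCommGroup V] [Module K V]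
  {br : TensorAlgebra K V ⊗[K] TensorAlgebra K V →ₗ[K] V}

theorem comul_eq_deconcat₂ :
    comul (R := K) (A := TensorAlgebra K V ⊗[K] TensorAlgebra K V) = deconcat₂ := by
  rw [TensorProduct.comul_def, TensorProduct.AlgebraTensorModule.tensorTensorTensorComm_eq,
    TensorProduct.AlgebraTensorModule.map_eq]
  rfl

theorem counit_eq_eps₂ :
    Coalgebra.counit (R := K) (A := TensorAlgebra K V ⊗[K] TensorAlgebra K V) = eps₂ := by
  ext a b
  simp [eps₂, mul_comm, counit_eq_eps]

/-- The tensor square is graded by total length, and `⟨1, 1⟩ = 0` says that the bracket vanishes in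
degree `0`; the truncations in `binfMul` are then those of a geometric series. Length is used rather
than weight, so `V` needs no grading. -/
theorem isSeries_binfMul (h : br (1 ⊗ₜ 1) = 0) : IsSeries br (binfMul br) := by
  let 𝒢 := fun i : ℕ => LinearMap.range (TensorAlgebra.ι K (M := V)) ^ i
  have hbr : ∀ x ∈ tensorGr 𝒢 0, br x = 0 := by
    intro x hx
    rw [← Submodule.mem_bot K]
    refine map_mem_of_tensorGr (fun p q hpq a ha b hb => ?_) hx
    obtain ⟨rfl, rfl⟩ : p = 0 ∧ q = 0 := by omega
    simp only [𝒢, pow_zero, Submodule.mem_one] at ha hb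
    obtain ⟨r, rfl⟩ := ha
    obtain ⟨s, rfl⟩ := hb
    rw [Submodule.mem_bot, Algebra.algebraMap_eq_smul_one, Algebra.algebraMap_eq_smul_one,
      TensorProduct.smul_tmul_smul, map_smul, h, smul_zero]
  refine eq_one_add_mul_of_sum (𝒞 := tensorGr 𝒢)
    (iSup_tensorGr (iSup_eq_top_of_decomposition 𝒢))
    (comul_mem_tensorGr_tensorGr deconcat_mem_tensorGr_length)
    (fun x hx => by simp [hbr x hx]) fun n x hx => ?_
  have hk : ∀ k, (toConv (TensorAlgebra.ι K ∘ₗ br) ^ k).ofConv =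
      convPow deconcat₂ eps₂ (TensorAlgebra.ι K ∘ₗ br) k := by
    intro k
    rw [← comul_eq_deconcat₂, ← counit_eq_eps₂, ← toConv_convPow]
  change binfMul br x = _
  simp_rw [hk]
  rw [← LinearMap.sum_apply]
  refine eqOn_tensorGr (fun p q hpq a ha b hb => ?_) hx
  rw [binfMul, TensorProduct.lift.tmul, byDegree_of_mem 𝒢 _ ha, LinearMap.flip_apply,
    byDegree_of_mem 𝒢 _ hb, LinearMap.flip_apply, TensorProduct.curry_apply, hpq]

/-- The product `*` as a morphism of coalgebras. -/
def binfMulHom (h : br (1 ⊗ₜ 1) = 0) :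
    TensorAlgebra K V ⊗[K] TensorAlgebra K V →ₗc[K] TensorAlgebra K V :=
  (isSeries_binfMul h).coalgHom

theorem piV_binfMul (h : br (1 ⊗ₜ 1) = 0) (x : TensorAlgebra K V ⊗[K] TensorAlgebra K V) :
    piV K V (binfMul br x) = br x :=
  LinearMap.congr_fun (isSeries_binfMul h).piV x

theorem eps_binfMul (h : br (1 ⊗ₜ 1) = 0) (x y : TensorAlgebra K V) :
    eps K V (binfMul br (x ⊗ₜ y)) = eps K V x * eps K V y := by
  have := LinearMap.congr_fun (isSeries_binfMul h).counit (x ⊗ₜ y)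
  rw [counit_eq_eps₂] at this
  simpa [eps₂] using this

/-- The unit of `T(V)` as a morphism of coalgebras. -/
def unitCoalgHom (K : Type u) [Field K] (V : Type v) [AddCommGroup V] [Module K V] :
    K →ₗc[K] TensorAlgebra K V :=
  { Algebra.linearMap K (TensorAlgebra K V) with
    counit_comp := by ext; simp [counit_eq_eps]
    map_comp_comul := by ext; simp [comul_eq_deconcat] }

/-- From `x = (x - ε(x) 1) + ε(x) 1`. It extends the axioms, which are imposed on `T_+(V)` only, to
all of `T(V)`. -/
theorem tensorAlgebra_hom_ext_eps {M : Type*} [AddCommGroup M] [Module K M]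
    {f g : TensorAlgebra K V →ₗ[K] M} (one : f 1 = g 1)
    (h : ∀ x, eps K V x = 0 → f x = g x) (x : TensorAlgebra K V) : f x = g x := by
  have h1 := h (x - eps K V x • 1) (by simp)
  rw [map_sub, map_sub, map_smul, map_smul, one] at h1
  exact sub_left_injective h1

namespace BInftyStructure

variable (S : BInftyStructure K V)

theorem br_one_one : S.br (1 ⊗ₜ 1) = 0 := by rw [S.one_br, piV_one]

/-- Left multiplication by `1` and the identity are coalgebra morphisms with the same corestriction
`π_V`. -/
theorem binfMul_one_left (x : TensorAlgebra K V) : binfMul S.br (1 ⊗ₜ x) = x := by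
  let Φ : TensorAlgebra K V →ₗc[K] TensorAlgebra K V :=
    (binfMulHom S.br_one_one).comp ((Coalgebra.TensorProduct.map (unitCoalgHom K V)
      (CoalgHom.id K _)).comp (Coalgebra.TensorProduct.lid K (TensorAlgebra K V)).symm)
  have hΦ : ∀ x, Φ x = binfMul S.br (1 ⊗ₜ x) := by
    intro x
    simp [Φ, binfMulHom, unitCoalgHom, IsSeries.coalgHom]
  have : Φ = CoalgHom.id K _ := coalgHom_ext fun x => by
    rw [hΦ, piV_binfMul S.br_one_one, S.one_br]; rfl
  rw [← hΦ, this]; rfl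

theorem binfMul_one_right (x : TensorAlgebra K V) : binfMul S.br (x ⊗ₜ 1) = x := by
  let Φ : TensorAlgebra K V →ₗc[K] TensorAlgebra K V :=
    (binfMulHom S.br_one_one).comp ((Coalgebra.TensorProduct.map (CoalgHom.id K _)
      (unitCoalgHom K V)).comp (Coalgebra.TensorProduct.rid K K (TensorAlgebra K V)).symm)
  have hΦ : ∀ x, Φ x = binfMul S.br (x ⊗ₜ 1) := by
    intro x
    simp [Φ, binfMulHom, unitCoalgHom, IsSeries.coalgHom]
  have : Φ = CoalgHom.id K _ := coalgHom_ext fun x => by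
    rw [hΦ, piV_binfMul S.br_one_one, S.br_one]; rfl
  rw [← hΦ, this]; rfl

theorem br_assoc (x y z : TensorAlgebra K V) :
    S.br (x ⊗ₜ binfMul S.br (y ⊗ₜ z)) = S.br (binfMul S.br (x ⊗ₜ y) ⊗ₜ z) := by
  let T := TensorAlgebra K V
  let L : T →ₗ[K] T →ₗ[K] T →ₗ[K] V := TensorProduct.curry (TensorProduct.curry
    (S.br ∘ₗ (binfMul S.br).lTensor T ∘ₗ (TensorProduct.assoc K T T T).toLinearMap))
  let R : T →ₗ[K] T →ₗ[K] T →ₗ[K] V := TensorProduct.curry (TensorProduct.curry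
    (S.br ∘ₗ (binfMul S.br).rTensor T))
  have hL : ∀ x y z, L x y z = S.br (x ⊗ₜ binfMul S.br (y ⊗ₜ z)) := fun _ _ _ => rfl
  have hR : ∀ x y z, R x y z = S.br (binfMul S.br (x ⊗ₜ y) ⊗ₜ z) := fun _ _ _ => rfl
  rw [← hL, ← hR]
  -- When an argument is `1`, the identity follows from the unit laws; the axiom covers the case of
  -- three arguments in `T_+(V)`.
  have hx : L 1 = R 1 := LinearMap.ext₂ fun y z => by
    rw [hL, hR, S.one_br, piV_binfMul S.br_one_one, S.binfMul_one_left]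
  have hy : ∀ x, L x 1 = R x 1 := fun x => LinearMap.ext fun z => by
    rw [hL, hR, S.binfMul_one_left, S.binfMul_one_right]
  have hz : ∀ x y, L x y 1 = R x y 1 := fun x y => by
    rw [hL, hR, S.br_one, piV_binfMul S.br_one_one, S.binfMul_one_right]
  refine LinearMap.congr_fun₂ (tensorAlgebra_hom_ext_eps hx (fun x hx0 => ?_) x) y z
  refine LinearMap.ext fun y => tensorAlgebra_hom_ext_eps (hy x) (fun y hy0 => ?_) y
  refine LinearMap.ext fun z => tensorAlgebra_hom_ext_eps (hz x y) (fun z hz0 => ?_) z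
  exact S.assoc x y z hx0 hy0 hz0

/-- The two triple products are coalgebra morphisms from the threefold tensor product, and
`br_assoc` equates their corestrictions. -/
theorem binfMul_assoc (x y z : TensorAlgebra K V) :
    binfMul S.br (binfMul S.br (x ⊗ₜ y) ⊗ₜ z) = binfMul S.br (x ⊗ₜ binfMul S.br (y ⊗ₜ z)) := by
  let M := binfMulHom S.br_one_one
  let Φ := M.comp (Coalgebra.TensorProduct.map M (CoalgHom.id K (TensorAlgebra K V)))
  let Φ' := (M.comp (Coalgebra.TensorProduct.map (CoalgHom.id K (TensorAlgebra K V)) M)).comp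
    (Coalgebra.TensorProduct.assoc K K (TensorAlgebra K V) (TensorAlgebra K V)
      (TensorAlgebra K V)).toCoalgHom
  have hΦ : ∀ x y z, Φ (x ⊗ₜ y ⊗ₜ z) = binfMul S.br (binfMul S.br (x ⊗ₜ y) ⊗ₜ z) :=
    fun _ _ _ => rfl
  have hΦ' : ∀ x y z, Φ' (x ⊗ₜ y ⊗ₜ z) = binfMul S.br (x ⊗ₜ binfMul S.br (y ⊗ₜ z)) :=
    fun _ _ _ => rfl
  have : Φ = Φ' := by
    refine coalgHom_ext (K := K) (V := V)
      (C := (TensorAlgebra K V ⊗[K] TensorAlgebra K V) ⊗[K] TensorAlgebra K V) fun t => ?_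
    have : piV K V ∘ₗ Φ.toLinearMap = piV K V ∘ₗ Φ'.toLinearMap := by
      refine TensorProduct.ext_threefold fun x y z => ?_
      change piV K V (Φ (x ⊗ₜ y ⊗ₜ z)) = piV K V (Φ' (x ⊗ₜ y ⊗ₜ z))
      rw [hΦ, hΦ', piV_binfMul S.br_one_one, piV_binfMul S.br_one_one, S.br_assoc]
    exact LinearMap.congr_fun this t
  rw [← hΦ, ← hΦ', this]

theorem br_comm (hS : S.IsCommutative) (x y : TensorAlgebra K V) :
    S.br (x ⊗ₜ y) = S.br (y ⊗ₜ x) := by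
  let L := TensorProduct.curry S.br
  have hL : ∀ x y, L x y = S.br (x ⊗ₜ y) := fun _ _ => rfl
  refine LinearMap.congr_fun (f := L x) (g := L.flip x) (tensorAlgebra_hom_ext_eps (f := L)
    (g := L.flip) (LinearMap.ext fun y => ?_) (fun x hx => LinearMap.ext fun y =>
      tensorAlgebra_hom_ext_eps ?_ (fun y hy => hS x y hx hy) y) x) y
  · rw [LinearMap.flip_apply, hL, hL, S.one_br, S.br_one]
  · rw [LinearMap.flip_apply, hL, hL, S.one_br, S.br_one]

theorem binfMul_comm (hS : S.IsCommutative) (x y : TensorAlgebra K V) :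
    binfMul S.br (x ⊗ₜ y) = binfMul S.br (y ⊗ₜ x) := by
  let M : TensorAlgebra K V ⊗[K] TensorAlgebra K V →ₗc[K] TensorAlgebra K V :=
    binfMulHom S.br_one_one
  let M' : TensorAlgebra K V ⊗[K] TensorAlgebra K V →ₗc[K] TensorAlgebra K V :=
    M.comp (commCoalgHom K (TensorAlgebra K V))
  have : M = M' := by
    refine coalgHom_ext (K := K) (V := V)
      (C := TensorAlgebra K V ⊗[K] TensorAlgebra K V) fun t => ?_
    have : piV K V ∘ₗ M.toLinearMap = piV K V ∘ₗ M'.toLinearMap := by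
      refine TensorProduct.ext' fun x y => ?_
      change piV K V (binfMul S.br (x ⊗ₜ y)) = piV K V (binfMul S.br (y ⊗ₜ x))
      rw [piV_binfMul S.br_one_one, piV_binfMul S.br_one_one, S.br_comm hS]
    exact LinearMap.congr_fun this t
  exact congrArg (fun F => F (x ⊗ₜ y)) this

theorem isGradedCommHopf_envelope (hS : S.IsCommutative) {𝒱 : ℕ → Submodule K V}
    [DirectSum.Decomposition 𝒱] (h0 : 𝒱 0 = ⊥) (hg : S.IsGraded 𝒱) :
    IsGradedCommHopf (envelope S.br) (gr 𝒱) where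
  mul_assoc := S.binfMul_assoc
  one_mul := S.binfMul_one_left
  mul_one := S.binfMul_one_right
  mul_comm := S.binfMul_comm hS
  coassoc := Coalgebra.coassoc (R := K) (A := TensorAlgebra K V)
  counit_comul := Coalgebra.rTensor_counit_comp_comul (R := K) (A := TensorAlgebra K V)
  comul_counit := Coalgebra.lTensor_counit_comp_comul (R := K) (A := TensorAlgebra K V)
  comul_mul := by
    have := (isSeries_binfMul S.br_one_one).comul
    rw [comul_eq_deconcat₂] at this
    exact this.symm
  comul_one := deconcat_one K V
  counit_mul := eps_binfMul S.br_one_one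
  counit_one := eps_one
  isInternal := DirectSum.Decomposition.isInternal (gr 𝒱)
  mul_mem p q x y hx hy := by
    -- Here the tensor square carries the total weight grading, for which the bracket is a graded
    -- map.
    refine (isSeries_binfMul S.br_one_one).mem_gr (𝒞 := tensorGr (gr 𝒱))
      (comul_mem_tensorGr_tensorGr (deconcat_mem_tensorGr_gr 𝒱))
      (counit_eq_zero_of_mem_tensorGr (eps_eq_zero_of_mem_gr 𝒱)) h0 (fun n z hz => ?_) (p + q) _
      (tmul_mem_tensorGr rfl hx hy)
    exact map_mem_of_tensorGr (fun i j hij a ha b hb => hij ▸ hg i j a b ha hb) hz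
  comul_mem := deconcat_mem_tensorGr_gr 𝒱
  counit_eq_zero := eps_eq_zero_of_mem_gr 𝒱
  connected := gr_zero 𝒱 h0

end BInftyStructure

theorem trivialBr_tmul (x y : TensorAlgebra K V) :
    trivialBr K V (x ⊗ₜ y) = eps K V x • piV K V y + eps K V y • piV K V x := by
  simp [trivialBr]

theorem trivialBr_one_one : trivialBr K V (1 ⊗ₜ 1) = 0 := by simp [trivialBr_tmul]

/-- The trivial `B_∞`-structure. -/
def trivialBInfty (K : Type u) [Field K] (V : Type v) [AddCommGroup V] [Module K V] :
    BInftyStructure K V where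
  br := trivialBr K V
  one_br x := by simp [trivialBr_tmul]
  br_one x := by simp [trivialBr_tmul]
  assoc x y z hx hy hz := by
    -- Both brackets vanish: `ε` is multiplicative for the product, so all the arguments lie in
    -- `T_+(V)`.
    simp [trivialBr_tmul, eps_binfMul trivialBr_one_one, hx, hy, hz]

theorem isGradedCommHopf_shuffle {𝒱 : ℕ → Submodule K V} [DirectSum.Decomposition 𝒱]
    (h0 : 𝒱 0 = ⊥) : IsGradedCommHopf (shuffle K V) (gr 𝒱) := by
  refine (trivialBInfty K V).isGradedCommHopf_envelope (fun x y hx hy => ?_) h0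
    fun p q x y hx hy => ?_
  · simp [trivialBInfty, trivialBr_tmul, hx, hy]
  · change trivialBr K V (x ⊗ₜ y) ∈ _
    rw [trivialBr_tmul]
    refine Submodule.add_mem _ ?_ ?_
    · rcases eq_or_ne p 0 with rfl | hp
      · rw [zero_add]; exact Submodule.smul_mem _ _ (piV_mem_of_mem_gr 𝒱 q y hy)
      · rw [eps_eq_zero_of_mem_gr 𝒱 p hp x hx, zero_smul]; exact Submodule.zero_mem _
    · rcases eq_or_ne q 0 with rfl | hq
      · exact Submodule.smul_mem _ _ (piV_mem_of_mem_gr 𝒱 p x hx)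
      · rw [eps_eq_zero_of_mem_gr 𝒱 q hq y hy, zero_smul]; exact Submodule.zero_mem _

end Envelope

/-! ### Action of the descent algebra by convolution of degree projections -/

section GradedProjections

variable {K : Type u} [Field K] {A : Type v} [AddCommGroup A] [Module K A] {B : BialgData K A}
  {𝒜 : ℕ → Submodule K A} [DirectSum.Decomposition 𝒜]

/-- The projection onto the degree `n` component, as an endomorphism. -/
def gradeProj (𝒜 : ℕ → Submodule K A) [DirectSum.Decomposition 𝒜] (n : ℕ) : A →ₗ[K] A :=
  (𝒜 n).subtype ∘ₗ proj 𝒜 n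

theorem gradeProj_apply (n : ℕ) (x : A) : gradeProj 𝒜 n x = proj 𝒜 n x := rfl

theorem gradeProj_mem (n : ℕ) (x : A) : gradeProj 𝒜 n x ∈ 𝒜 n := (proj 𝒜 n x).2

theorem gradeProj_of_mem {n : ℕ} {x : A} (hx : x ∈ 𝒜 n) : gradeProj 𝒜 n x = x :=
  proj_of_mem 𝒜 hx

theorem gradeProj_of_mem_ne {m n : ℕ} {x : A} (hx : x ∈ 𝒜 m) (h : m ≠ n) :
    gradeProj 𝒜 n x = 0 := by
  rw [gradeProj_apply, proj_of_mem_ne 𝒜 hx h]; rfl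

namespace IsGradedCommHopf

theorem one_mem {𝒜 : ℕ → Submodule K A} (hB : IsGradedCommHopf B 𝒜) : B.one ∈ 𝒜 0 := by
  rw [hB.connected]; exact Submodule.mem_span_singleton_self _

theorem gradeProj_one (hB : IsGradedCommHopf B 𝒜) {n : ℕ} (hn : n ≠ 0) : gradeProj 𝒜 n B.one = 0 :=
  gradeProj_of_mem_ne hB.one_mem hn.symm

theorem gradeProj_zero (hB : IsGradedCommHopf B 𝒜) (x : A) : gradeProj 𝒜 0 x = B.counit x • B.one := by
  refine LinearMap.congr_fun (f := gradeProj 𝒜 0) (g := B.counit.smulRight B.one)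
    (linearMap_ext_of_iSup (iSup_eq_top_of_decomposition 𝒜) fun n x hx => ?_) x
  rcases eq_or_ne n 0 with rfl | hn
  · rw [gradeProj_of_mem hx]
    rw [hB.connected] at hx
    obtain ⟨c, rfl⟩ := Submodule.mem_span_singleton.1 hx
    simp [hB.counit_one]
  · rw [gradeProj_of_mem_ne hx hn, LinearMap.smulRight_apply, hB.counit_eq_zero n hn x hx,
      zero_smul]

/-- The counterpart on `A` of `Δ(1_n) = ∑ 1_i ⊗ 1_j`, and the source of the compatibility of the
action with coproducts. -/
theorem gradeProj_mul (hB : IsGradedCommHopf B 𝒜) (n : ℕ) :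
    gradeProj 𝒜 n ∘ₗ B.mul = B.mul ∘ₗ ∑ p ∈ Finset.HasAntidiagonal.antidiagonal n,
      TensorProduct.map (gradeProj 𝒜 p.1) (gradeProj 𝒜 p.2) := by
  refine linearMap_ext_of_iSup (iSup_tensorGr (iSup_eq_top_of_decomposition 𝒜)) fun m x hx =>
    eqOn_tensorGr (fun p q hpq a ha b hb => ?_) hx
  simp only [LinearMap.comp_apply, LinearMap.sum_apply, TensorProduct.map_tmul]
  have hz : ∀ i : ℕ × ℕ, i ≠ (p, q) → gradeProj 𝒜 i.1 a ⊗ₜ[K] gradeProj 𝒜 i.2 b = 0 := by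
    intro i hi
    by_cases h1 : p = i.1
    · have h2 : q ≠ i.2 := fun h2 => hi (Prod.ext h1.symm h2.symm)
      rw [gradeProj_of_mem_ne hb h2, TensorProduct.tmul_zero]
    · rw [gradeProj_of_mem_ne ha h1, TensorProduct.zero_tmul]
  by_cases hmn : p + q = n
  · rw [gradeProj_of_mem (hmn ▸ hB.mul_mem p q a b ha hb), Finset.sum_eq_single (p, q)
      (fun i _ hi => hz i hi) (fun h => absurd (by simpa using hmn) h), gradeProj_of_mem ha,
      gradeProj_of_mem hb]
  · rw [gradeProj_of_mem_ne (hB.mul_mem p q a b ha hb) hmn, Finset.sum_eq_zero, map_zero]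
    rintro i hi
    refine hz i ?_
    rintro rfl
    exact hmn (by simpa using hi)

theorem map_gradeProj_comul (hB : IsGradedCommHopf B 𝒜) (p q : ℕ) :
    TensorProduct.map (gradeProj 𝒜 p) (gradeProj 𝒜 q) ∘ₗ B.comul =
      TensorProduct.map (gradeProj 𝒜 p) (gradeProj 𝒜 q) ∘ₗ B.comul ∘ₗ gradeProj 𝒜 (p + q) := by
  refine linearMap_ext_of_iSup (iSup_eq_top_of_decomposition 𝒜) fun n x hx => ?_
  by_cases h : n = p + q
  · subst h
    simp only [LinearMap.comp_apply, gradeProj_of_mem hx]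
  · simp only [LinearMap.comp_apply, gradeProj_of_mem_ne hx h, map_zero]
    rw [← Submodule.mem_bot K]
    refine map_mem_of_tensorGr (fun i j hij a ha b hb => ?_) (hB.comul_mem n x hx)
    rw [Submodule.mem_bot, TensorProduct.map_tmul]
    by_cases hi : i = p
    · rw [gradeProj_of_mem_ne hb (show j ≠ q by omega), TensorProduct.tmul_zero]
    · rw [gradeProj_of_mem_ne ha hi, TensorProduct.zero_tmul]

end IsGradedCommHopf

/-- The convolution product of the projections onto the components of degrees in a list. -/
def actList (B : BialgData K A) (𝒜 : ℕ → Submodule K A) [DirectSum.Decomposition 𝒜]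
    (l : List ℕ) : A →ₗ[K] A :=
  l.foldr (fun m F => conv B (gradeProj 𝒜 m) F) (convOne B)

/-- The transpose action of the descent algebra. -/
def dualAct (B : BialgData K A) (𝒜 : ℕ → Submodule K A) [DirectSum.Decomposition 𝒜] (n : ℕ) :
    Desc K n →ₗ[K] (A →ₗ[K] A) :=
  (DeBasis K n).constr K fun c => actList B 𝒜 c.blocks

theorem actList_cons (m : ℕ) (l : List ℕ) :
    actList B 𝒜 (m :: l) = conv B (gradeProj 𝒜 m) (actList B 𝒜 l) := rfl

theorem actList_one (hB : IsGradedCommHopf B 𝒜) {l : List ℕ} (hl : ∀ m ∈ l, m ≠ 0)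
    (hl' : l ≠ []) : actList B 𝒜 l B.one = 0 := by
  obtain ⟨m, l, rfl⟩ := List.exists_cons_of_ne_nil hl'
  rw [actList_cons, conv, LinearMap.comp_apply, LinearMap.comp_apply, hB.comul_one,
    TensorProduct.map_tmul, hB.gradeProj_one (hl m List.mem_cons_self), TensorProduct.zero_tmul,
    map_zero]

/-- Each term of `x ⊗ 1 + 1 ⊗ x` feeds `1` either to the first projection or to the nonempty product
of the others, and both kill it. -/
theorem actList_primitive (hB : IsGradedCommHopf B 𝒜) {l : List ℕ} (hl : ∀ m ∈ l, m ≠ 0)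
    (hl' : 1 < l.length) {x : A} (hx : B.comul x = x ⊗ₜ B.one + B.one ⊗ₜ x) :
    actList B 𝒜 l x = 0 := by
  obtain ⟨m, l, rfl⟩ := List.exists_cons_of_ne_nil (l := l) (by rintro rfl; simp at hl')
  have h1 : l ≠ [] := by rintro rfl; simp at hl'
  rw [actList_cons, conv, LinearMap.comp_apply, LinearMap.comp_apply, hx, map_add,
    TensorProduct.map_tmul, TensorProduct.map_tmul, hB.gradeProj_one (hl m List.mem_cons_self),
    actList_one hB (fun m hm => hl m (List.mem_cons_of_mem _ hm)) h1]
  simp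

theorem actList_singleton (hB : IsGradedCommHopf B 𝒜) (n : ℕ) :
    actList B 𝒜 [n] = gradeProj 𝒜 n := by
  ext x
  have h := LinearMap.congr_fun hB.comul_counit x
  have e : TensorProduct.map (gradeProj 𝒜 n) (convOne B) =
      TensorProduct.map (gradeProj 𝒜 n) ((LinearMap.id : K →ₗ[K] K).smulRight B.one) ∘ₗ
        B.counit.lTensor A := by
    ext a b; simp [convOne]
  change B.mul (TensorProduct.map (gradeProj 𝒜 n) (convOne B) (B.comul x)) = _
  rw [LinearMap.comp_apply] at h
  rw [e, LinearMap.comp_apply, h]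
  simp [hB.mul_one]

/-- Only the composition with one block survives on a primitive element. Its coefficient in `ψ n` is
`1` and it acts as the projection onto degree `n`. -/
theorem dualAct_primitive (hB : IsGradedCommHopf B 𝒜) {ψ : ∀ n, Desc K n}
    (hψ : IsLieIdempotentFamily ψ) {n : ℕ} (hn : 0 < n) {x : A} (hxn : x ∈ 𝒜 n)
    (hx : B.comul x = x ⊗ₜ B.one + B.one ⊗ₜ x) : dualAct B 𝒜 n (ψ n) x = x := by
  rw [dualAct, Module.Basis.constr_apply_fintype, LinearMap.sum_apply,
    Finset.sum_eq_single (Composition.single n hn)]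
  · have h1 : (DeBasis K n).equivFun (ψ n) (Composition.single n hn) = 1 := (hψ n hn).2
    rw [h1, one_smul, Composition.single_blocks, actList_singleton hB, gradeProj_of_mem hxn]
  · intro c _ hc
    rw [LinearMap.smul_apply, actList_primitive hB
      (fun m hm => (c.blocks_pos hm).ne') _ hx, smul_zero]
    have h1 : c.length ≠ 1 := fun h => hc ((Composition.eq_single_iff_length hn).2 h)
    have h0 : 0 < c.length := c.length_pos_of_pos hn
    change 1 < c.length
    omega
  · simp

end GradedProjections

/-! ### Transposing the action from the graded dual -/

section Pairing

variable {K : Type u} [Field K] {A : Type v} [AddCommGroup A] [Module K A] {B : BialgData K A}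
  {𝒜 : ℕ → Submodule K A} [DirectSum.Decomposition 𝒜]

/-- The pairing of the graded dual with the graded vector space. -/
def pairing (𝒜 : ℕ → Submodule K A) [DirectSum.Decomposition 𝒜] :
    GDual 𝒜 →ₗ[K] Module.Dual K A :=
  DirectSum.toModule K ℕ _ fun n => (proj 𝒜 n).dualMap

@[simp] theorem pairing_lof (n : ℕ) (f : Module.Dual K (𝒜 n)) (x : A) :
    pairing 𝒜 (DirectSum.lof K ℕ (fun n => Module.Dual K (𝒜 n)) n f) x = f (proj 𝒜 n x) := by
  simp [pairing, DirectSum.toModule_lof]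

/-- The pairing of the tensor squares. -/
def pairing₂ (𝒜 : ℕ → Submodule K A) [DirectSum.Decomposition 𝒜] :
    GDual 𝒜 ⊗[K] GDual 𝒜 →ₗ[K] Module.Dual K (A ⊗[K] A) :=
  TensorProduct.dualDistrib K A A ∘ₗ TensorProduct.map (pairing 𝒜) (pairing 𝒜)

theorem pairing₂_tmul (f g : GDual 𝒜) (x y : A) :
    pairing₂ 𝒜 (f ⊗ₜ g) (x ⊗ₜ y) = pairing 𝒜 f x * pairing 𝒜 g y := by
  simp [pairing₂]

theorem gdual_hom_ext {𝒜 : ℕ → Submodule K A} {M : Type*} [AddCommGroup M] [Module K M] {f g : GDual 𝒜 →ₗ[K] M}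
    (h : ∀ n a, f (DirectSum.lof K ℕ (fun n => Module.Dual K (𝒜 n)) n a) =
      g (DirectSum.lof K ℕ (fun n => Module.Dual K (𝒜 n)) n a)) : f = g :=
  DirectSum.linearMap_ext K fun n => LinearMap.ext fun a => h n a

theorem pairing_dualMul (hB : IsGradedCommHopf B 𝒜) (z : GDual 𝒜 ⊗[K] GDual 𝒜) (x : A) :
    pairing 𝒜 (dualMul B 𝒜 z) x = pairing₂ 𝒜 z (B.comul x) := by
  have key : pairing 𝒜 ∘ₗ dualMul B 𝒜 = B.comul.dualMap ∘ₗ pairing₂ 𝒜 := by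
    refine TensorProduct.ext (gdual_hom_ext fun p f => gdual_hom_ext fun q g => ?_)
    refine LinearMap.ext fun x => ?_
    simp only [LinearMap.compr₂ₛₗ_apply, TensorProduct.mk_apply,
      LinearMap.comp_apply, dualMul, TensorProduct.lift.tmul, DirectSum.toModule_lof,
      LinearMap.flip_apply, TensorProduct.curry_apply, pairing_lof, LinearMap.dualMap_apply]
    have h1 : ∀ z : A ⊗[K] A, pairing₂ 𝒜 (DirectSum.lof K ℕ _ p f ⊗ₜ DirectSum.lof K ℕ _ q g) z =
        pairing₂ 𝒜 (DirectSum.lof K ℕ _ p f ⊗ₜ DirectSum.lof K ℕ _ q g)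
          (TensorProduct.map (gradeProj 𝒜 p) (gradeProj 𝒜 q) z) := by
      intro z
      induction z with
      | zero => simp
      | add x y hx hy => rw [map_add, map_add, map_add, hx, hy]
      | tmul a b =>
        rw [TensorProduct.map_tmul, pairing₂_tmul, pairing₂_tmul]
        simp only [pairing_lof]
        congr 2
        · exact Subtype.ext (gradeProj_of_mem (gradeProj_mem (𝒜 := 𝒜) p a)).symm
        · exact Subtype.ext (gradeProj_of_mem (gradeProj_mem (𝒜 := 𝒜) q b)).symm
    have h2 : ∀ z : A ⊗[K] A, pairing₂ 𝒜 (DirectSum.lof K ℕ _ p f ⊗ₜ DirectSum.lof K ℕ _ q g) z =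
        TensorProduct.dualDistrib K _ _ (f ⊗ₜ g)
          (TensorProduct.map (proj 𝒜 p) (proj 𝒜 q) z) := by
      intro z
      induction z with
      | zero => simp
      | add x y hx hy => rw [map_add, map_add, map_add, hx, hy]
      | tmul a b => simp [pairing₂_tmul]
    -- Only the component of `x` of degree `p + q` contributes to the part of its coproduct in
    -- bidegree `(p, q)`.
    have h3 := LinearMap.congr_fun (hB.map_gradeProj_comul p q) x
    simp only [LinearMap.comp_apply] at h3
    rw [h1 (B.comul x), h3, ← h1, h2]
    rfl
  exact LinearMap.congr_fun (LinearMap.congr_fun key z) x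

/-- `G` is the transpose of `F` for the pairing of the graded dual with `A`. -/
def IsTranspose (F : GDual 𝒜 →ₗ[K] GDual 𝒜) (G : A →ₗ[K] A) : Prop :=
  ∀ h x, pairing 𝒜 (F h) x = pairing 𝒜 h (G x)

theorem isTranspose_proj (m : ℕ) :
    IsTranspose (DirectSum.lof K ℕ (fun n => Module.Dual K (𝒜 n)) m ∘ₗ
      DirectSum.component K ℕ (fun n => Module.Dual K (𝒜 n)) m) (gradeProj 𝒜 m) := by
  intro f x
  refine LinearMap.congr_fun (LinearMap.congr_fun (f := pairing 𝒜 ∘ₗ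
    (DirectSum.lof K ℕ (fun n => Module.Dual K (𝒜 n)) m ∘ₗ
      DirectSum.component K ℕ (fun n => Module.Dual K (𝒜 n)) m))
    (g := (gradeProj 𝒜 m).dualMap ∘ₗ pairing 𝒜) (gdual_hom_ext fun n a => LinearMap.ext fun x => ?_)
      f) x
  simp only [LinearMap.comp_apply, LinearMap.dualMap_apply, pairing_lof]
  by_cases h : n = m
  · subst h
    rw [DirectSum.component.lof_self]
    congr 1
    exact Subtype.ext (gradeProj_of_mem (gradeProj_mem (𝒜 := 𝒜) n x)).symm
  · rw [DirectSum.component.of, dif_neg h, proj_of_mem_ne 𝒜 (gradeProj_mem m x) (Ne.symm h)]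
    simp

variable [∀ n, Module.Finite K (𝒜 n)]

theorem pairing₂_dualComul (hB : IsGradedCommHopf B 𝒜) (h : GDual 𝒜) (z : A ⊗[K] A) :
    pairing₂ 𝒜 (dualComul B 𝒜 h) z = pairing 𝒜 h (B.mul z) := by
  have key : pairing₂ 𝒜 ∘ₗ dualComul B 𝒜 = B.mul.dualMap ∘ₗ pairing 𝒜 := by
    refine gdual_hom_ext fun n f => TensorProduct.ext' fun x y => ?_
    have h1 : ∀ (p q : ℕ) (t : Module.Dual K (𝒜 p) ⊗[K] Module.Dual K (𝒜 q)),
        pairing₂ 𝒜 (TensorProduct.map (DirectSum.lof K ℕ (fun n => Module.Dual K (𝒜 n)) p)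
          (DirectSum.lof K ℕ (fun n => Module.Dual K (𝒜 n)) q) t) (x ⊗ₜ y) =
        TensorProduct.dualDistrib K _ _ t (proj 𝒜 p x ⊗ₜ proj 𝒜 q y) := by
      intro p q t
      induction t with
      | zero => simp
      | add s t hs ht => simp only [map_add, LinearMap.add_apply, hs, ht]
      | tmul f g => simp [pairing₂_tmul]
    have h2 : ∀ (p q : ℕ) (s : Module.Dual K (𝒜 p ⊗[K] 𝒜 q)), TensorProduct.dualDistrib K _ _
        ((TensorProduct.dualDistribEquiv K (𝒜 p) (𝒜 q)).symm s) = s :=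
      fun p q s => (TensorProduct.dualDistribEquiv K (𝒜 p) (𝒜 q)).apply_symm_apply s
    simp only [LinearMap.comp_apply, dualComul, DirectSum.toModule_lof, LinearMap.sum_apply,
      map_sum, LinearEquiv.coe_coe, h1, h2, LinearMap.dualMap_apply, pairing_lof]
    have h3 := LinearMap.congr_fun (hB.gradeProj_mul n) (x ⊗ₜ y)
    simp only [LinearMap.comp_apply, LinearMap.sum_apply, map_sum, TensorProduct.map_tmul] at h3
    have h4 : proj 𝒜 n (B.mul (x ⊗ₜ y)) = proj 𝒜 n (gradeProj 𝒜 n (B.mul (x ⊗ₜ y))) :=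
      Subtype.ext (gradeProj_of_mem (gradeProj_mem (𝒜 := 𝒜) n _)).symm
    rw [h4, h3, map_sum, map_sum]
    rfl
  exact LinearMap.congr_fun (LinearMap.congr_fun key h) z

/-- The product and coproduct of the dual are the transposes of the coproduct and product of `A`, so
transposition preserves convolution, without reversing the factors. -/
theorem IsTranspose.conv (hB : IsGradedCommHopf B 𝒜) {F F' : GDual 𝒜 →ₗ[K] GDual 𝒜}
    {G G' : A →ₗ[K] A} (h : IsTranspose F G) (h' : IsTranspose F' G') :
    IsTranspose (CofreeHopf.conv (dualData B 𝒜) F F') (CofreeHopf.conv B G G') := by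
  intro f x
  have key : ∀ (s : GDual 𝒜 ⊗[K] GDual 𝒜) (z : A ⊗[K] A),
      pairing₂ 𝒜 (TensorProduct.map F F' s) z = pairing₂ 𝒜 s (TensorProduct.map G G' z) := by
    intro s z
    induction s with
    | zero => simp
    | add s t hs ht => simp only [map_add, LinearMap.add_apply, hs, ht]
    | tmul f g =>
      induction z with
      | zero => simp
      | add s t hs ht => simp only [map_add, hs, ht]
      | tmul x y =>
        rw [TensorProduct.map_tmul, TensorProduct.map_tmul, pairing₂_tmul, pairing₂_tmul, h, h']
  change pairing 𝒜 (dualMul B 𝒜 (TensorProduct.map F F' (dualComul B 𝒜 f))) x =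
    pairing 𝒜 f (B.mul (TensorProduct.map G G' (B.comul x)))
  rw [pairing_dualMul hB, key, pairing₂_dualComul hB]

theorem isTranspose_convOne (hB : IsGradedCommHopf B 𝒜) :
    IsTranspose (convOne (dualData B 𝒜)) (convOne B) := by
  intro f x
  have h1 : dualCounit B 𝒜 f = pairing 𝒜 f B.one := by
    refine LinearMap.congr_fun (g := Module.Dual.eval K A B.one ∘ₗ pairing 𝒜)
      (gdual_hom_ext fun n a => ?_) f
    simp [dualCounit, DirectSum.toModule_lof]
  have h2 : pairing 𝒜 (dualOne B 𝒜) x = B.counit x := by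
    have := hB.gradeProj_zero x
    rw [gradeProj_apply] at this
    rw [dualOne, pairing_lof, LinearMap.comp_apply, Submodule.subtype_apply, this, map_smul,
      hB.counit_one, smul_eq_mul, mul_one]
  change pairing 𝒜 (dualCounit B 𝒜 f • dualOne B 𝒜) x = pairing 𝒜 f (B.counit x • B.one)
  rw [map_smul, LinearMap.smul_apply, map_smul, h1, h2, smul_eq_mul, smul_eq_mul, mul_comm]

/-- This removes the graded dual from the rest of the argument: `ψ_n^*` can be computed by
convolution on `A`. -/
theorem isTranspose_descAct (hB : IsGradedCommHopf B 𝒜) (n : ℕ) (ψ : Desc K n) :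
    IsTranspose (descAct (dualData B 𝒜) n ψ) (dualAct B 𝒜 n ψ) := by
  intro f x
  have hl : ∀ l : List ℕ, IsTranspose (l.foldr
      (fun m F => conv (dualData B 𝒜) (DirectSum.lof K ℕ (fun n => Module.Dual K (𝒜 n)) m ∘ₗ
        DirectSum.component K ℕ (fun n => Module.Dual K (𝒜 n)) m) F)
      (convOne (dualData B 𝒜))) (actList B 𝒜 l) := by
    intro l
    induction l with
    | nil => exact isTranspose_convOne hB
    | cons m l ih => exact (isTranspose_proj m).conv hB ih
  simp only [descAct, dualAct, Module.Basis.constr_apply_fintype, LinearMap.sum_apply, map_sum,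
    LinearMap.smul_apply, map_smul]
  exact Finset.sum_congr rfl fun c _ => by rw [hl c.blocks f x]

theorem descTranspose_apply (hB : IsGradedCommHopf B 𝒜) (n : ℕ) (ψ : Desc K n) (a : 𝒜 n) :
    descTranspose B 𝒜 n ψ a = proj 𝒜 n (dualAct B 𝒜 n ψ a) := by
  rw [descTranspose, LinearMap.comp_apply, LinearEquiv.coe_coe, LinearEquiv.symm_apply_eq]
  refine LinearMap.ext fun f => ?_
  have h1 : ∀ h : GDual 𝒜, DirectSum.component K ℕ (fun n => Module.Dual K (𝒜 n)) n h a =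
      pairing 𝒜 h a := by
    intro h
    refine LinearMap.congr_fun (f := Module.Dual.eval K (𝒜 n) a ∘ₗ
      DirectSum.component K ℕ (fun n => Module.Dual K (𝒜 n)) n)
      (g := Module.Dual.eval K A a ∘ₗ pairing 𝒜) (gdual_hom_ext fun m b => ?_) h
    simp only [LinearMap.comp_apply, Module.Dual.eval_apply, pairing_lof]
    by_cases hm : m = n
    · subst hm
      rw [DirectSum.component.lof_self]
      congr 1
      exact Subtype.ext (gradeProj_of_mem a.2).symm
    · rw [DirectSum.component.of, dif_neg hm, proj_of_mem_ne 𝒜 a.2 (Ne.symm hm)]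
      simp
  change DirectSum.component K ℕ (fun n => Module.Dual K (𝒜 n)) n
    (descAct (dualData B 𝒜) n ψ (DirectSum.lof K ℕ (fun n => Module.Dual K (𝒜 n)) n f)) a = _
  rw [h1, isTranspose_descAct hB n ψ, pairing_lof]
  rfl

theorem sumTranspose_of_mem (hB : IsGradedCommHopf B 𝒜) (ψ : ∀ n, Desc K n) {n : ℕ} (hn : n ≠ 0)
    {x : A} (hx : x ∈ 𝒜 n) :
    sumTranspose B 𝒜 ψ x = gradeProj 𝒜 n (dualAct B 𝒜 n (ψ n) x) := by
  rw [sumTranspose, byDegree_of_mem 𝒜 _ hx, if_neg hn, LinearMap.comp_apply, LinearMap.comp_apply,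
    descTranspose_apply hB, proj_of_mem 𝒜 hx]
  rfl

theorem sumTranspose_of_mem_zero (ψ : ∀ n, Desc K n) {x : A} (hx : x ∈ 𝒜 0) :
    sumTranspose B 𝒜 ψ x = 0 := by
  rw [sumTranspose, byDegree_of_mem 𝒜 _ hx, if_pos rfl, LinearMap.zero_apply]

theorem sumTranspose_mem (hB : IsGradedCommHopf B 𝒜) (ψ : ∀ n, Desc K n) {n : ℕ} {x : A}
    (hx : x ∈ 𝒜 n) : sumTranspose B 𝒜 ψ x ∈ 𝒜 n := by
  rcases eq_or_ne n 0 with rfl | hn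
  · rw [sumTranspose_of_mem_zero ψ hx]; exact Submodule.zero_mem _
  · rw [sumTranspose_of_mem hB ψ hn hx]; exact gradeProj_mem n _

theorem sumTranspose_primitive (hB : IsGradedCommHopf B 𝒜) {ψ : ∀ n, Desc K n}
    (hψ : IsLieIdempotentFamily ψ) {n : ℕ} (hn : n ≠ 0) {x : A} (hxn : x ∈ 𝒜 n)
    (hx : B.comul x = x ⊗ₜ B.one + B.one ⊗ₜ x) : sumTranspose B 𝒜 ψ x = x := by
  rw [sumTranspose_of_mem hB ψ hn hxn,
    dualAct_primitive hB hψ (Nat.pos_of_ne_zero hn) hxn hx, gradeProj_of_mem hxn]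

end Pairing

/-! ### Primitivity in the descent algebra and the action on products -/

section FreeAction

open WithConv Coalgebra

variable {K : Type u} [Field K] {A : Type v} [CommRing A] [Bialgebra K A]

/-- Precomposition with the product, as a morphism of convolution algebras. -/
def convPrecompMul (K : Type u) [Field K] (A : Type v) [CommRing A] [Bialgebra K A] :
    WithConv (A →ₗ[K] A) →ₐ[K] WithConv (A ⊗[K] A →ₗ[K] A) :=
  AlgHom.ofLinearMap
    { toFun := fun F => toConv (F.ofConv ∘ₗ (Bialgebra.mulCoalgHom K A).toLinearMap)
      map_add' := fun _ _ => rfl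
      map_smul' := fun _ _ => rfl }
    (by
      apply ofConv_injective
      ext x y
      simp [LinearMap.convOne_def, mul_comm])
    fun F G => congrArg toConv (LinearMap.convMul_comp_coalgHom_distrib F G _)

/-- Postcomposition with the product, as a morphism of convolution algebras. -/
def convPostcompMul (K : Type u) [Field K] (A : Type v) [CommRing A] [Bialgebra K A] :
    WithConv (A ⊗[K] A →ₗ[K] A ⊗[K] A) →ₐ[K] WithConv (A ⊗[K] A →ₗ[K] A) :=
  AlgHom.ofLinearMap
    { toFun := fun F => toConv ((Algebra.TensorProduct.lmul' K (S := A)).toLinearMap ∘ₗ F.ofConv)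
      map_add' := fun F G => congrArg toConv (LinearMap.comp_add _ _ _)
      map_smul' := fun c F => congrArg toConv (LinearMap.comp_smul _ _ _) }
    (by
      apply ofConv_injective
      ext x y
      change LinearMap.mul' K A (algebraMap K (A ⊗[K] A) (counit (R := K) (x ⊗ₜ[K] y))) =
        algebraMap K A (counit (R := K) (x ⊗ₜ[K] y))
      rw [Algebra.TensorProduct.algebraMap_apply, LinearMap.mul'_apply, mul_one])
    -- Commutativity of `A` is used here: it makes the product `A ⊗ A → A` an algebra morphism.
    fun F G => congrArg toConv (LinearMap.algHom_comp_convMul_distrib _ F G)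

theorem convPrecompMul_apply (F : WithConv (A →ₗ[K] A)) (x y : A) :
    (convPrecompMul K A F).ofConv (x ⊗ₜ y) = F.ofConv (x * y) := rfl

theorem convPostcompMul_apply (F : WithConv (A ⊗[K] A →ₗ[K] A ⊗[K] A)) (z : A ⊗[K] A) :
    (convPostcompMul K A F).ofConv z = LinearMap.mul' K A (F.ofConv z) := rfl

/-- The tensor product of endomorphisms, as a morphism of convolution algebras. -/
def convTensor {R : Type*} [Ring R] [Algebra K R] (F : R →ₐ[K] WithConv (A →ₗ[K] A)) :
    R ⊗[K] R →ₐ[K] WithConv (A ⊗[K] A →ₗ[K] A ⊗[K] A) :=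
  Algebra.TensorProduct.algHomOfLinearMapTensorProduct
    (TensorProduct.lift (LinearMap.mk₂ K
      (fun f g => toConv (TensorProduct.map (F f).ofConv (F g).ofConv))
      (fun f f' g => by rw [map_add]; exact congrArg toConv (TensorProduct.map_add_left _ _ _))
      (fun c f g => by rw [map_smul]; exact congrArg toConv (TensorProduct.map_smul_left _ _ _))
      (fun f g g' => by rw [map_add]; exact congrArg toConv (TensorProduct.map_add_right _ _ _))
      (fun c f g => by rw [map_smul]; exact congrArg toConv (TensorProduct.map_smul_right _ _ _))))
    (fun f f' g g' => by
      simp only [TensorProduct.lift.tmul, LinearMap.mk₂_apply, map_mul]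
      exact (TensorProduct.map_convMul_map).symm)
    (by
      simp only [TensorProduct.lift.tmul, LinearMap.mk₂_apply, map_one]
      apply ofConv_injective
      ext x y
      simp [LinearMap.convOne_def, Algebra.TensorProduct.one_def,
        Algebra.algebraMap_eq_smul_one]
      rw [← TensorProduct.smul_tmul', smul_smul, mul_comm])

theorem convTensor_tmul {R : Type*} [Ring R] [Algebra K R] (F : R →ₐ[K] WithConv (A →ₗ[K] A))
    (f g : R) : convTensor F (f ⊗ₜ g) = toConv (TensorProduct.map (F f).ofConv (F g).ofConv) :=
  rfl

variable {𝒜 : ℕ → Submodule K A} [DirectSum.Decomposition 𝒜]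

/-- The action on `A` of the free algebra on the identity permutations. -/
def freeAct (𝒜 : ℕ → Submodule K A) [DirectSum.Decomposition 𝒜] :
    FreeAlgebra K ℕ+ →ₐ[K] WithConv (A →ₗ[K] A) :=
  FreeAlgebra.lift K fun m : ℕ+ => toConv (gradeProj 𝒜 m)

theorem freeAct_idPerm (hB : IsGradedCommHopf (BialgData.ofBialgebra K A) 𝒜) (m : ℕ) :
    freeAct 𝒜 (idPerm K m) = toConv (gradeProj 𝒜 m) := by
  rw [idPerm]
  split_ifs with h
  · exact FreeAlgebra.lift_ι_apply (R := K) _ (⟨m, h⟩ : ℕ+)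
  -- By connectedness, the projection onto degree `0` is the convolution unit, in accordance with
  -- the convention `1₀ = 1`.
  · obtain rfl : m = 0 := by omega
    rw [map_one]
    apply ofConv_injective
    ext x
    rw [ofConv_toConv, hB.gradeProj_zero]
    simp [LinearMap.convOne_def, Algebra.algebraMap_eq_smul_one, BialgData.ofBialgebra]

theorem freeAct_descToFree (hB : IsGradedCommHopf (BialgData.ofBialgebra K A) 𝒜) (n : ℕ)
    (ψ : Desc K n) : freeAct 𝒜 (descToFree K n ψ) =
      toConv (dualAct (BialgData.ofBialgebra K A) 𝒜 n ψ) := by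
  have hl : ∀ l : List ℕ, freeAct 𝒜 (l.map (idPerm K)).prod =
      toConv (actList (BialgData.ofBialgebra K A) 𝒜 l) := by
    intro l
    induction l with
    | nil =>
      rw [List.map_nil, List.prod_nil, map_one]
      apply ofConv_injective
      ext x
      simp [actList, convOne, LinearMap.convOne_def, Algebra.algebraMap_eq_smul_one,
        BialgData.ofBialgebra]
    | cons m l ih =>
      rw [List.map_cons, List.prod_cons, map_mul, ih, freeAct_idPerm hB]
      rfl
  have key : (freeAct 𝒜).toLinearMap ∘ₗ descToFree K n =
      (WithConv.linearEquiv K (A →ₗ[K] A)).symm.toLinearMap ∘ₗ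
        dualAct (BialgData.ofBialgebra K A) 𝒜 n := by
    refine (DeBasis K n).ext fun c => ?_
    simp only [LinearMap.comp_apply, descToFree, dualAct, Module.Basis.constr_basis]
    exact hl c.blocks
  exact LinearMap.congr_fun key ψ

/-- Both sides are algebra morphisms in `f`, so they need only be compared on the free generators,
where the identity is `gradeProj_mul`. -/
theorem freeAct_comul (hB : IsGradedCommHopf (BialgData.ofBialgebra K A) 𝒜)
    (f : FreeAlgebra K ℕ+) :
    convPrecompMul K A (freeAct 𝒜 f) =
      convPostcompMul K A (convTensor (freeAct 𝒜) (descComul K f)) := by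
  refine AlgHom.congr_fun (φ₁ := (convPrecompMul K A).comp (freeAct 𝒜)) (φ₂ :=
    (convPostcompMul K A).comp ((convTensor (freeAct 𝒜)).comp (descComul K)))
    (FreeAlgebra.hom_ext (funext fun m => ?_)) f
  simp only [Function.comp_apply, AlgHom.comp_apply, descComul, FreeAlgebra.lift_ι_apply, map_sum,
    convTensor_tmul, freeAct_idPerm hB]
  rw [freeAct, FreeAlgebra.lift_ι_apply]
  apply ofConv_injective
  refine (hB.gradeProj_mul m).trans ?_
  rw [ofConv_sum]
  ext x y
  simp [BialgData.ofBialgebra, convPostcompMul_apply]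

/-- For a primitive element, `freeAct_comul` involves only `ψ ⊗ 1 + 1 ⊗ ψ`, and `1` acts as the
convolution unit `x ↦ ε(x) 1`. -/
theorem dualAct_mul_of_bialgebra (hB : IsGradedCommHopf (BialgData.ofBialgebra K A) 𝒜)
    {ψ : ∀ n, Desc K n} (hψ : IsLieIdempotentFamily ψ) {n : ℕ} (hn : 0 < n) (x y : A) :
    dualAct (BialgData.ofBialgebra K A) 𝒜 n (ψ n) (x * y) =
      counit (R := K) y • dualAct (BialgData.ofBialgebra K A) 𝒜 n (ψ n) x +
        counit (R := K) x • dualAct (BialgData.ofBialgebra K A) 𝒜 n (ψ n) y := by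
  have h := freeAct_comul hB (descToFree K n (ψ n))
  rw [(hψ n hn).1, map_add, convTensor_tmul, convTensor_tmul, map_one,
    freeAct_descToFree hB] at h
  have h1 := congrArg (fun F : WithConv (A ⊗[K] A →ₗ[K] A) => F (x ⊗ₜ y)) h
  simpa [convPrecompMul_apply, convPostcompMul_apply, LinearMap.convOne_def, Algebra.algebraMap_eq_smul_one]
    using h1

end FreeAction

/-! ### Passage from structure maps to bialgebra instances -/

section Transport

theorem map_mul'_tensorTensorTensorComm {K : Type u} [Field K] {A : Type v} [CommRing A]
    [Algebra K A] (s t : A ⊗[K] A) :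
    TensorProduct.map (LinearMap.mul' K A) (LinearMap.mul' K A)
      (TensorProduct.tensorTensorTensorComm K A A A A (s ⊗ₜ t)) = s * t := by
  induction s with
  | zero => simp
  | add s s' hs hs' => simp only [TensorProduct.add_tmul, map_add, add_mul, hs, hs']
  | tmul a b =>
    induction t with
    | zero => simp
    | add s s' hs hs' => simp only [TensorProduct.tmul_add, map_add, mul_add, hs, hs']
    | tmul c d => simp

variable {K : Type u} [Field K] {A : Type v} [inst : AddCommGroup A] [Module K A]
  {B : BialgData K A} {𝒜 : ℕ → Submodule K A}

/-- The ring structure of a graded connected commutative Hopf algebra. -/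
@[reducible] def IsGradedCommHopf.commRing (hB : IsGradedCommHopf B 𝒜) : CommRing A :=
  { inst with
    mul := fun x y => B.mul (x ⊗ₜ y)
    one := B.one
    mul_assoc := hB.mul_assoc
    one_mul := hB.one_mul
    mul_one := hB.mul_one
    mul_comm := hB.mul_comm
    left_distrib := fun x y z => by
      change B.mul (x ⊗ₜ (y + z)) = B.mul (x ⊗ₜ y) + B.mul (x ⊗ₜ z)
      rw [TensorProduct.tmul_add, map_add]
    right_distrib := fun x y z => by
      change B.mul ((x + y) ⊗ₜ z) = B.mul (x ⊗ₜ z) + B.mul (y ⊗ₜ z)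
      rw [TensorProduct.add_tmul, map_add]
    zero_mul := fun x => by
      change B.mul (0 ⊗ₜ x) = 0
      rw [TensorProduct.zero_tmul, map_zero]
    mul_zero := fun x => by
      change B.mul (x ⊗ₜ 0) = 0
      rw [TensorProduct.tmul_zero, map_zero] }

/-- The coalgebra structure of a graded connected commutative Hopf algebra. -/
@[reducible] def IsGradedCommHopf.coalgebra (hB : IsGradedCommHopf B 𝒜) : Coalgebra K A where
  comul := B.comul
  counit := B.counit
  coassoc := hB.coassoc
  rTensor_counit_comp_comul := hB.counit_comul
  lTensor_counit_comp_comul := hB.comul_counit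

theorem IsGradedCommHopf.dualAct_mul [DirectSum.Decomposition 𝒜] (hB : IsGradedCommHopf B 𝒜)
    {ψ : ∀ n, Desc K n} (hψ : IsLieIdempotentFamily ψ) {n : ℕ} (hn : 0 < n) (x y : A) :
    dualAct B 𝒜 n (ψ n) (B.mul (x ⊗ₜ y)) =
      B.counit y • dualAct B 𝒜 n (ψ n) x + B.counit x • dualAct B 𝒜 n (ψ n) y := by
  let _ : CommRing A := hB.commRing
  let _ : Algebra K A := Algebra.ofModule
    (fun c x y => by
      change B.mul ((c • x) ⊗ₜ y) = c • B.mul (x ⊗ₜ y)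
      rw [← TensorProduct.smul_tmul', map_smul])
    (fun c x y => by
      change B.mul (x ⊗ₜ (c • y)) = c • B.mul (x ⊗ₜ y)
      rw [TensorProduct.tmul_smul, map_smul])
  have hm : B.mul = LinearMap.mul' K A := TensorProduct.ext' fun x y => rfl
  let _ : Coalgebra K A := hB.coalgebra
  let _ : Bialgebra K A := Bialgebra.mk' K A hB.counit_one (fun {x y} => hB.counit_mul x y)
    hB.comul_one (fun {x y} => by
      have h := LinearMap.congr_fun hB.comul_mul (x ⊗ₜ y)
      refine h.trans ?_
      change TensorProduct.map B.mul B.mul (TensorProduct.tensorTensorTensorComm K A A A A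
        (B.comul x ⊗ₜ B.comul y)) = B.comul x * B.comul y
      rw [hm]
      exact map_mul'_tensorTensorTensorComm _ _)
  -- The identification allows the result for bialgebras to be rewritten back in terms of the
  -- original structure maps.
  have hE : B = BialgData.ofBialgebra K A := by
    calc B = ⟨B.mul, B.one, B.comul, B.counit⟩ := rfl
      _ = _ := by rw [hm]; rfl
  have h := dualAct_mul_of_bialgebra (𝒜 := 𝒜) (hE ▸ hB) hψ hn x y
  rw [← hE] at h
  exact h

end Transport

/-! ### The induced morphism is an isomorphism onto the shuffle algebra -/

section Core

variable {K : Type u} [Field K] {A : Type v} [AddCommGroup A] [Module K A] {B : BialgData K A}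
  {𝒜 : ℕ → Submodule K A}

theorem IsGradedCommHopf.sumTranspose_mul [DirectSum.Decomposition 𝒜]
    [∀ n, Module.Finite K (𝒜 n)] (hB : IsGradedCommHopf B 𝒜) {ψ : ∀ n, Desc K n}
    (hψ : IsLieIdempotentFamily ψ) (x y : A) :
    sumTranspose B 𝒜 ψ (B.mul (x ⊗ₜ y)) =
      B.counit y • sumTranspose B 𝒜 ψ x + B.counit x • sumTranspose B 𝒜 ψ y := by
  set e := sumTranspose B 𝒜 ψ with he
  have key : e ∘ₗ B.mul = (TensorProduct.rid K A).toLinearMap ∘ₗ TensorProduct.map e B.counit +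
      (TensorProduct.lid K A).toLinearMap ∘ₗ TensorProduct.map B.counit e := by
    refine linearMap_ext_of_iSup (iSup_tensorGr (iSup_eq_top_of_decomposition 𝒜)) fun n z hz =>
      eqOn_tensorGr (fun p q hpq a ha b hb => ?_) hz
    simp only [LinearMap.comp_apply, LinearMap.add_apply, TensorProduct.map_tmul,
      LinearEquiv.coe_coe, TensorProduct.rid_tmul, TensorProduct.lid_tmul]
    -- Degree `0` is treated apart: the action is evaluated in the degree `p + q` of the product,
    -- whereas the terms on the right involve degrees `p` and `q`. They drop out when `p` and `q`
    -- are positive, and connectedness reduces the other cases to scalars.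
    rcases eq_or_ne p 0 with rfl | hp
    · have ha0 : e a = 0 := sumTranspose_of_mem_zero ψ ha
      rw [hB.connected] at ha
      obtain ⟨c, rfl⟩ := Submodule.mem_span_singleton.1 ha
      rw [ha0, ← TensorProduct.smul_tmul', map_smul, hB.one_mul, map_smul, map_smul, hB.counit_one]
      simp
    rcases eq_or_ne q 0 with rfl | hq
    · have hb0 : e b = 0 := sumTranspose_of_mem_zero ψ hb
      rw [hB.connected] at hb
      obtain ⟨c, rfl⟩ := Submodule.mem_span_singleton.1 hb
      rw [hb0, TensorProduct.tmul_smul, map_smul, hB.mul_one, map_smul, map_smul, hB.counit_one]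
      simp
    have hn : n ≠ 0 := by omega
    rw [he, sumTranspose_of_mem hB ψ hn (hpq ▸ hB.mul_mem p q a b ha hb),
      hB.dualAct_mul hψ (Nat.pos_of_ne_zero hn), hB.counit_eq_zero p hp a ha,
      hB.counit_eq_zero q hq b hb]
    simp
  simpa using LinearMap.congr_fun key (x ⊗ₜ y)

/-- The reduced coproduct of a homogeneous element of positive degree involves only components of
strictly smaller positive degrees. -/
theorem IsGradedCommHopf.exists_reduced_comul (hB : IsGradedCommHopf B 𝒜) {n : ℕ} (hn : n ≠ 0)
    {x : A} (hx : x ∈ 𝒜 n) {W : Submodule K A} (hW : ∀ p, 0 < p → p < n → 𝒜 p ≤ W)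
    (hεW : ∀ w ∈ W, B.counit w = 0) :
    ∃ z : W ⊗[K] W, B.comul x =
      x ⊗ₜ B.one + B.one ⊗ₜ x + TensorProduct.map W.subtype W.subtype z := by
  have hle : tensorGr 𝒜 n ≤ (𝒜 n).map ((TensorProduct.mk K A A).flip B.one) ⊔
      (𝒜 n).map (TensorProduct.mk K A A B.one) ⊔
      LinearMap.range (TensorProduct.map W.subtype W.subtype) := by
    refine tensorGr_le fun p q hpq a ha b hb => ?_
    rcases Nat.eq_zero_or_pos p with rfl | hp
    · obtain rfl : q = n := by omega
      rw [hB.connected] at ha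
      obtain ⟨c, rfl⟩ := Submodule.mem_span_singleton.1 ha
      refine Submodule.mem_sup_left (Submodule.mem_sup_right ⟨c • b, Submodule.smul_mem _ c hb, ?_⟩)
      simp [TensorProduct.smul_tmul']
    rcases Nat.eq_zero_or_pos q with rfl | hq
    · obtain rfl : p = n := by omega
      rw [hB.connected] at hb
      obtain ⟨c, rfl⟩ := Submodule.mem_span_singleton.1 hb
      refine Submodule.mem_sup_left (Submodule.mem_sup_left ⟨c • a, Submodule.smul_mem _ c ha, ?_⟩)
      simp [TensorProduct.smul_tmul']
    · exact Submodule.mem_sup_right ⟨⟨a, hW p hp (by omega) ha⟩ ⊗ₜ ⟨b, hW q hq (by omega) hb⟩, rfl⟩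
  obtain ⟨s, hs, _, ⟨z, rfl⟩, hsz⟩ := Submodule.mem_sup.1 (hle (hB.comul_mem n x hx))
  obtain ⟨_, ⟨a, ha, rfl⟩, _, ⟨b, hb, rfl⟩, rfl⟩ := Submodule.mem_sup.1 hs
  rw [TensorProduct.mk_apply, LinearMap.flip_apply, TensorProduct.mk_apply] at hsz
  have hr : ∀ z : W ⊗[K] W,
      B.counit.rTensor A (TensorProduct.map W.subtype W.subtype z) = 0 := by
    intro z
    induction z with
    | zero => simp
    | add s t hs ht => rw [map_add, map_add, hs, ht, add_zero]
    | tmul s t => simp [hεW s s.2]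
  have hl : ∀ z : W ⊗[K] W,
      B.counit.lTensor A (TensorProduct.map W.subtype W.subtype z) = 0 := by
    intro z
    induction z with
    | zero => simp
    | add s t hs ht => rw [map_add, map_add, hs, ht, add_zero]
    | tmul s t => simp [hεW t t.2]
  -- Applying the counit on either side identifies both outer terms of the coproduct with `x`.
  have h1 := LinearMap.congr_fun hB.counit_comul x
  have h2 := LinearMap.congr_fun hB.comul_counit x
  rw [LinearMap.comp_apply, ← hsz, map_add, map_add, hr] at h1
  rw [LinearMap.comp_apply, ← hsz, map_add, map_add, hl] at h2
  have hb' : b = x := by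
    simpa [hB.counit_eq_zero n hn a ha, hB.counit_one] using congrArg (TensorProduct.lid K A) h1
  have ha' : a = x := by
    simpa [hB.counit_eq_zero n hn b hb, hB.counit_one] using congrArg (TensorProduct.rid K A) h2
  exact ⟨z, by rw [← hsz, ha', hb']⟩

variable {V : Type w} [AddCommGroup V] [Module K V] {𝒱 : ℕ → Submodule K V}

theorem comp_gradeProj {A' : Type w} [AddCommGroup A'] [Module K A'] {𝒜' : ℕ → Submodule K A'}
    [DirectSum.Decomposition 𝒜] [DirectSum.Decomposition 𝒜'] {Φ : A →ₗ[K] A'}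
    (hΦ : ∀ n, ∀ x ∈ 𝒜 n, Φ x ∈ 𝒜' n) (n : ℕ) (x : A) :
    Φ (gradeProj 𝒜 n x) = gradeProj 𝒜' n (Φ x) := by
  refine LinearMap.congr_fun (f := Φ ∘ₗ gradeProj 𝒜 n) (g := gradeProj 𝒜' n ∘ₗ Φ)
    (linearMap_ext_of_iSup (iSup_eq_top_of_decomposition 𝒜) fun m x hx => ?_) x
  rw [LinearMap.comp_apply, LinearMap.comp_apply]
  by_cases h : m = n
  · subst h; rw [gradeProj_of_mem hx, gradeProj_of_mem (hΦ m x hx)]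
  · rw [gradeProj_of_mem_ne hx h, gradeProj_of_mem_ne (hΦ m x hx) h, map_zero]

/-- A morphism of graded coalgebras that is injective on primitive elements is injective. -/
theorem IsGradedCommHopf.injective_of_primitive [DirectSum.Decomposition 𝒜]
    (hB : IsGradedCommHopf B 𝒜) {A' : Type w} [AddCommGroup A'] [Module K A']
    {𝒜' : ℕ → Submodule K A'} [DirectSum.Decomposition 𝒜'] {Δ' : A' →ₗ[K] A' ⊗[K] A'}
    {Φ : A →ₗ[K] A'} (hΦ : ∀ n, ∀ x ∈ 𝒜 n, Φ x ∈ 𝒜' n)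
    (hcomul : TensorProduct.map Φ Φ ∘ₗ B.comul = Δ' ∘ₗ Φ) (hone : Φ B.one ≠ 0)
    (hprim : ∀ n, n ≠ 0 → ∀ x ∈ 𝒜 n, B.comul x = x ⊗ₜ B.one + B.one ⊗ₜ x → Φ x = 0 → x = 0) :
    Function.Injective Φ := by
  have hhom : ∀ n, ∀ x ∈ 𝒜 n, Φ x = 0 → x = 0 := by
    intro n
    induction n using Nat.strong_induction_on with
    | _ n ih =>
      intro x hx hx0
      rcases eq_or_ne n 0 with rfl | hn
      · rw [hB.connected] at hx
        obtain ⟨c, rfl⟩ := Submodule.mem_span_singleton.1 hx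
        rw [map_smul, smul_eq_zero] at hx0
        rcases hx0 with rfl | h
        · rw [zero_smul]
        · exact absurd h hone
      -- `W` contains both factors of the reduced coproduct of `x`, and by induction `Φ` is
      -- injective on it.
      let W : Submodule K A := ⨆ p, ⨆ (_ : 0 < p ∧ p < n), 𝒜 p
      have hWle : ∀ S : Submodule K A, (∀ p, 0 < p → p < n → 𝒜 p ≤ S) → W ≤ S :=
        fun S hS => iSup₂_le fun p hp => hS p hp.1 hp.2
      have hW : ∀ p, 0 < p → p < n → 𝒜 p ≤ W := fun p h1 h2 =>
        le_iSup₂ (f := fun p (_ : 0 < p ∧ p < n) => 𝒜 p) p ⟨h1, h2⟩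
      have hεW : ∀ w ∈ W, B.counit w = 0 := fun w hw =>
        hWle (LinearMap.ker B.counit) (fun p hp _ a ha => hB.counit_eq_zero p hp.ne' a ha) hw
      obtain ⟨z, hz⟩ := hB.exists_reduced_comul hn hx hW hεW
      have hinj : Function.Injective (Φ ∘ₗ W.subtype) := by
        rw [← LinearMap.ker_eq_bot, LinearMap.ker_eq_bot']
        intro w hw
        refine Subtype.ext (eq_zero_of_proj 𝒜 fun p => Subtype.ext ?_)
        change gradeProj 𝒜 p w = 0
        by_cases hp : 0 < p ∧ p < n
        · refine ih p hp.2 _ (gradeProj_mem p _) ?_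
          rw [comp_gradeProj hΦ]
          exact (congrArg (gradeProj 𝒜' p) hw).trans (map_zero _)
        · refine hWle (LinearMap.ker (gradeProj 𝒜 p)) (fun q h1 h2 a ha => ?_) w.2
          exact gradeProj_of_mem_ne ha (by rintro rfl; exact hp ⟨h1, h2⟩)
      have hz0 : TensorProduct.map (Φ ∘ₗ W.subtype) (Φ ∘ₗ W.subtype) z = 0 := by
        have h := LinearMap.congr_fun hcomul x
        rw [LinearMap.comp_apply, LinearMap.comp_apply, hx0, map_zero, hz, map_add, map_add,
          TensorProduct.map_tmul, TensorProduct.map_tmul, hx0, TensorProduct.zero_tmul,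
          TensorProduct.tmul_zero, zero_add, zero_add] at h
        rw [TensorProduct.map_comp]
        exact h
      -- Over a field the tensor square of an injective map is injective, so `Φ x = 0` forces the
      -- reduced coproduct of `x` to vanish.
      have hz' : z = 0 :=
        TensorProduct.map_injective_of_flat_flat _ _ hinj hinj (hz0.trans (map_zero _).symm)
      rw [hz', map_zero, add_zero] at hz
      exact hprim n hn x hx hz hx0
  rw [← LinearMap.ker_eq_bot, LinearMap.ker_eq_bot']
  intro x hx
  refine eq_zero_of_proj 𝒜 fun n => Subtype.ext (hhom n _ (gradeProj_mem n x) ?_)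
  exact (comp_gradeProj hΦ n x).trans (by rw [hx, map_zero])

/-- An injective graded map between locally finite graded spaces of equal dimensions is
bijective. -/
theorem bijective_of_finrank_eq {A' : Type w} [AddCommGroup A'] [Module K A']
    {𝒜' : ℕ → Submodule K A'} (htop : ⨆ n, 𝒜' n = ⊤) [∀ n, Module.Finite K (𝒜 n)]
    [∀ n, Module.Finite K (𝒜' n)]
    {Φ : A →ₗ[K] A'} (hΦ : ∀ n, ∀ x ∈ 𝒜 n, Φ x ∈ 𝒜' n) (hinj : Function.Injective Φ)
    (hdim : ∀ n, Module.finrank K (𝒜 n) = Module.finrank K (𝒜' n)) : Function.Bijective Φ := by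
  refine ⟨hinj, ?_⟩
  rw [← LinearMap.range_eq_top, eq_top_iff, ← htop]
  refine iSup_le fun n y hy => ?_
  have h1 : Function.Injective (Φ.restrict (hΦ n)) := fun a b hab =>
    Subtype.ext (hinj (congrArg Subtype.val hab))
  obtain ⟨a, ha⟩ := (LinearMap.injective_iff_surjective_of_finrank_eq_finrank (hdim n)).1 h1 ⟨y, hy⟩
  exact ⟨a, congrArg Subtype.val ha⟩

/-- Only the term with `x` on the left and `g` on the right survives, as `π g = 0`. The element `g`
stands in for the unit, which a coalgebra lacks. -/
theorem IsSeries.apply_primitive {C : Type v} [AddCommGroup C] [Module K C] [Coalgebra K C]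
    {π : C →ₗ[K] V} {Φ : C →ₗ[K] TensorAlgebra K V} (h : IsSeries π Φ) {g x : C}
    (hg : π g = 0) (hg' : Φ g = 1)
    (hx : Coalgebra.comul (R := K) x = x ⊗ₜ g + g ⊗ₜ x)
    (hx0 : Coalgebra.counit (R := K) x = 0) : Φ x = TensorAlgebra.ι K (π x) := by
  rw [h.apply, hx, hx0]
  simp [hg, hg']

theorem IsSeries.apply_groupLike {C : Type v} [AddCommGroup C] [Module K C] [Coalgebra K C]
    {π : C →ₗ[K] V} {Φ : C →ₗ[K] TensorAlgebra K V} (h : IsSeries π Φ) {g : C}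
    (hg : π g = 0) (hΔ : Coalgebra.comul (R := K) g = g ⊗ₜ g)
    (hε : Coalgebra.counit (R := K) g = 1) : Φ g = 1 := by
  rw [h.apply, hΔ, hε]
  simp [hg]

/-- Applying `ε ⊗ 1` to the coproduct gives `x = ε(x) 1 + x`. -/
theorem IsGradedCommHopf.counit_primitive (hB : IsGradedCommHopf B 𝒜) {x : A}
    (hx : B.comul x = x ⊗ₜ B.one + B.one ⊗ₜ x) : B.counit x = 0 := by
  have h := congrArg (TensorProduct.lid K A) (LinearMap.congr_fun hB.counit_comul x)
  rw [LinearMap.comp_apply, hx] at h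
  have h1 : B.counit x • B.one = 0 := by simpa [hB.counit_one] using h
  have h2 := congrArg B.counit h1
  simpa [hB.counit_one] using h2

section LieMorphism

variable [DirectSum.Decomposition 𝒜] [∀ n, Module.Finite K (𝒜 n)]
  {φ : A →ₗ[K] V} {ψ : ∀ n, Desc K n}

theorem lieStructureMap_mem (hB : IsGradedCommHopf B 𝒜) (hφ : ∀ n, ∀ x ∈ 𝒜 n, φ x ∈ 𝒱 n)
    (ψ : ∀ n, Desc K n) (n : ℕ) (x : A) (hx : x ∈ 𝒜 n) : lieStructureMap B 𝒜 φ ψ x ∈ 𝒱 n :=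
  hφ n _ (sumTranspose_mem hB ψ hx)

theorem lieStructureMap_of_mem_zero {x : A} (hx : x ∈ 𝒜 0) : lieStructureMap B 𝒜 φ ψ x = 0 := by
  rw [lieStructureMap, LinearMap.comp_apply, sumTranspose_of_mem_zero ψ hx, map_zero]

theorem isSeries_lieMorphism (hB : IsGradedCommHopf B 𝒜) :
    @IsSeries K _ V _ _ A _ _ hB.coalgebra (lieStructureMap B 𝒜 φ ψ) (lieMorphism B 𝒜 φ ψ) := by
  let _ : Coalgebra K A := hB.coalgebra
  exact isSeries_induced 𝒜 hB.comul_mem fun x hx => lieStructureMap_of_mem_zero hx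

/-- The common core of both statements. The two inputs that depend on the situation are that `φ` is
injective on homogeneous primitives of positive degree and that dimensions agree degree by degree.
-/
theorem isGradedHopfIso_lieMorphism (hB : IsGradedCommHopf B 𝒜) [DirectSum.Decomposition 𝒱]
    [ReducedLocallyFinite 𝒱] (hψ : IsLieIdempotentFamily ψ) (hφ : ∀ n, ∀ x ∈ 𝒜 n, φ x ∈ 𝒱 n)
    (hinj : ∀ n, n ≠ 0 → ∀ x ∈ 𝒜 n, B.comul x = x ⊗ₜ B.one + B.one ⊗ₜ x → φ x = 0 → x = 0)
    (hdim : ∀ n, Module.finrank K (𝒜 n) = Module.finrank K (gr 𝒱 n)) :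
    piV K V ∘ₗ lieMorphism B 𝒜 φ ψ = lieStructureMap B 𝒜 φ ψ ∧
      IsGradedHopfIso B 𝒜 (shuffle K V) (gr 𝒱) (lieMorphism B 𝒜 φ ψ) := by
  let _ : Coalgebra K A := hB.coalgebra
  have h : IsSeries (lieStructureMap B 𝒜 φ ψ) (lieMorphism B 𝒜 φ ψ) := isSeries_lieMorphism hB
  have hπ1 : lieStructureMap B 𝒜 φ ψ B.one = 0 := lieStructureMap_of_mem_zero hB.one_mem
  have hone : lieMorphism B 𝒜 φ ψ B.one = 1 := h.apply_groupLike hπ1 hB.comul_one hB.counit_one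
  have hmem : ∀ n, ∀ x ∈ 𝒜 n, lieMorphism B 𝒜 φ ψ x ∈ gr 𝒱 n :=
    h.mem_gr hB.comul_mem hB.counit_eq_zero ReducedLocallyFinite.zero (lieStructureMap_mem hB hφ ψ)
  refine ⟨h.piV, ?_, ?_, hone, h.comul, h.counit, hmem⟩
  · refine bijective_of_finrank_eq (iSup_eq_top_of_decomposition (gr 𝒱)) hmem
      (hB.injective_of_primitive hmem h.comul (by rw [hone]; exact one_ne_zero)
        fun n hn x hxn hx hx0 => hinj n hn x hxn hx ?_) hdim
    -- On a primitive element the morphism is `ι ∘ φ`, because `sumTranspose` fixes it; this reduces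
    -- injectivity on primitives to that of `φ`.
    rw [h.apply_primitive hπ1 hone hx (hB.counit_primitive hx), TensorAlgebra.ι_eq_zero_iff] at hx0
    rwa [lieStructureMap, LinearMap.comp_apply, sumTranspose_primitive hB hψ hn hxn hx] at hx0
  · let M : A ⊗[K] A →ₗc[K] A :=
      { B.mul with
        counit_comp := by
          ext x y
          exact (hB.counit_mul x y).trans (mul_comm _ _)
        map_comp_comul := by
          rw [TensorProduct.comul_def, TensorProduct.AlgebraTensorModule.tensorTensorTensorComm_eq,
            TensorProduct.AlgebraTensorModule.map_eq]
          exact hB.comul_mul.symm }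
    let Φ : A ⊗[K] A →ₗc[K] TensorAlgebra K V := h.coalgHom.comp M
    let Φ' : A ⊗[K] A →ₗc[K] TensorAlgebra K V := (binfMulHom (trivialBr_one_one (K := K))).comp
      (Coalgebra.TensorProduct.map h.coalgHom h.coalgHom)
    -- Multiplicativity is an equality of coalgebra morphisms from `A ⊗ A`. After projection to `V`
    -- it is the rule of `sumTranspose_mul` against the formula for the trivial bracket.
    have hΦ : Φ = Φ' := by
      refine coalgHom_ext (K := K) (V := V) (C := A ⊗[K] A) fun t => ?_
      have : piV K V ∘ₗ Φ.toLinearMap = piV K V ∘ₗ Φ'.toLinearMap := by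
        refine TensorProduct.ext' fun x y => ?_
        change piV K V (lieMorphism B 𝒜 φ ψ (B.mul (x ⊗ₜ y))) = piV K V (binfMul (trivialBr K V)
          (lieMorphism B 𝒜 φ ψ x ⊗ₜ lieMorphism B 𝒜 φ ψ y))
        have hp : ∀ x, piV K V (lieMorphism B 𝒜 φ ψ x) = lieStructureMap B 𝒜 φ ψ x :=
          LinearMap.congr_fun h.piV
        have hε : ∀ x, eps K V (lieMorphism B 𝒜 φ ψ x) = B.counit x := LinearMap.congr_fun h.counit
        rw [piV_binfMul trivialBr_one_one, trivialBr_tmul, hp, hp, hp, hε, hε, lieStructureMap,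
          LinearMap.comp_apply, hB.sumTranspose_mul hψ, map_add, map_smul, map_smul, add_comm]
        rfl
      exact LinearMap.congr_fun this t
    intro x y
    exact congrArg (fun F => F (x ⊗ₜ[K] y)) hΦ

end LieMorphism

/-- The isomorphism of a graded commutative `B_∞`-algebra envelope with the shuffle algebra. -/
theorem isGradedHopfIso_envelope [DirectSum.Decomposition 𝒱] [ReducedLocallyFinite 𝒱]
    {ψ : ∀ n, Desc K n} (hψ : IsLieIdempotentFamily ψ) (S : BInftyStructure K V)
    (hS : S.IsCommutative) (hg : S.IsGraded 𝒱) :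
    piV K V ∘ₗ lieMorphism (envelope S.br) (gr 𝒱) (piV K V) ψ =
        lieStructureMap (envelope S.br) (gr 𝒱) (piV K V) ψ ∧
      IsGradedHopfIso (envelope S.br) (gr 𝒱) (shuffle K V) (gr 𝒱)
        (lieMorphism (envelope S.br) (gr 𝒱) (piV K V) ψ) := by
  have hB := S.isGradedCommHopf_envelope hS (ReducedLocallyFinite.zero (𝒱 := 𝒱)) hg
  refine isGradedHopfIso_lieMorphism hB hψ (piV_mem_of_mem_gr 𝒱)
    (fun n _ x _ hx h0 => ?_) fun _ => rfl
  -- A primitive element of the tensor coalgebra is a single letter, namely `ι (π_V x)`.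
  have := isSeries_id.apply_primitive (K := K) (V := V) piV_one rfl hx (hB.counit_primitive hx)
  rwa [h0, map_zero] at this

end Core

/-! ### Cofreeness of the tensor coalgebra and its transport -/

section CofreeTensor

variable {K : Type u} [Field K]

theorem isConnectedGradedCoalgebra_gr {V : Type v} [AddCommGroup V] [Module K V]
    (𝒱 : ℕ → Submodule K V) [DirectSum.Decomposition 𝒱] (h0 : 𝒱 0 = ⊥) :
    IsConnectedGradedCoalgebra (gr 𝒱) where
  isInternal := DirectSum.Decomposition.isInternal (gr 𝒱)
  comul_mem := deconcat_mem_tensorGr_gr 𝒱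
  counit_eq_zero := eps_eq_zero_of_mem_gr 𝒱
  connected := by
    rw [gr_zero 𝒱 h0]
    exact finrank_span_singleton one_ne_zero

/-- Lifts into `T^g(V)` exist as induced series and are unique by `coalgHom_ext`; composing with the
inverse of `Φ` carries both facts over to `C`. -/
theorem isCofreeGraded_of_bijective {C : Type v} [AddCommGroup C] [Module K C] [Coalgebra K C]
    {𝒞 : ℕ → Submodule K C} [DirectSum.Decomposition 𝒞] {V : Type v} [AddCommGroup V] [Module K V]
    {𝒱 : ℕ → Submodule K V} [DirectSum.Decomposition 𝒱] (h0 : 𝒱 0 = ⊥)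
    (Φ : C →ₗc[K] TensorAlgebra K V) (hΦ : Function.Bijective Φ)
    (hmem : ∀ n, ∀ x ∈ 𝒞 n, Φ x ∈ gr 𝒱 n) {π : C →ₗ[K] V} (hπ : ∀ x, piV K V (Φ x) = π x) :
    IsCofreeGraded 𝒞 𝒱 π := by
  refine ⟨fun n x hx => by rw [← hπ]; exact piV_mem_of_mem_gr 𝒱 n _ (hmem n x hx), ?_⟩
  intro D _ _ _ 𝒟 hD φ hφ
  let _ : DirectSum.Decomposition 𝒟 := hD.isInternal.chooseDecomposition
  have hφ0 : ∀ x ∈ 𝒟 0, φ x = 0 := fun x hx => by simpa [h0] using hφ 0 x hx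
  have hs := isSeries_induced 𝒟 hD.comul_mem hφ0
  have hsmem := hs.mem_gr hD.comul_mem hD.counit_eq_zero h0 hφ
  let e : C ≃ₗc[K] TensorAlgebra K V := CoalgEquiv.ofBijective (f := Φ) hΦ
  have he : ∀ y, Φ (e.symm y) = y := e.apply_symm_apply
  let X : D →ₗc[K] C := (e.symm : TensorAlgebra K V →ₗc[K] C).comp hs.coalgHom
  have hX : ∀ d, Φ (X d) = hs.coalgHom d := fun d => he _
  refine ⟨X, ⟨fun n x hx => ?_, fun x => ?_⟩, fun Y hY => ?_⟩
  -- The inverse of a graded bijection is graded: the injective map `Φ` commutes with the degree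
  -- projections.
  · have h1 : gradeProj 𝒞 n (X x) = X x := by
      apply hΦ.1
      refine (comp_gradeProj (Φ := Φ.toLinearMap) hmem n (X x)).trans ?_
      refine (congrArg (gradeProj (gr 𝒱) n) (hX x)).trans ?_
      exact (gradeProj_of_mem (hsmem n x hx)).trans (hX x).symm
    rw [← h1]
    exact gradeProj_mem n _
  · rw [← hπ, hX]
    exact LinearMap.congr_fun hs.piV x
  · have h1 : Φ.comp Y = hs.coalgHom := coalgHom_ext fun d => by
      refine (hπ (Y d)).trans ((hY.2 d).trans ?_)
      exact (LinearMap.congr_fun hs.piV d).symm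
    refine CoalgHom.ext fun d => hΦ.1 ?_
    rw [hX]
    exact CoalgHom.congr_fun h1 d

end CofreeTensor

/-! ### The graded space of primitive elements -/

section Primitives

variable {K : Type u} [Field K] {A : Type v} [CommRing A] [Bialgebra K A]
  {𝒜 : ℕ → Submodule K A}

theorem isGradedCommHopf_ofBialgebra [GradedAlgebra 𝒜] (hC : IsConnectedGradedCoalgebra 𝒜) :
    IsGradedCommHopf (BialgData.ofBialgebra K A) 𝒜 where
  mul_assoc x y z := mul_assoc x y z
  one_mul x := one_mul x
  mul_one x := mul_one x
  mul_comm x y := mul_comm x y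
  coassoc := Coalgebra.coassoc
  counit_comul := Coalgebra.rTensor_counit_comp_comul
  comul_counit := Coalgebra.lTensor_counit_comp_comul
  comul_mul := by
    ext x y
    exact (Bialgebra.comul_mul x y).trans (map_mul'_tensorTensorTensorComm _ _).symm
  comul_one := Bialgebra.comul_one
  counit_mul x y := Bialgebra.counit_mul x y
  counit_one := Bialgebra.counit_one
  isInternal := hC.isInternal
  mul_mem _ _ _ _ hx hy := SetLike.GradedMul.mul_mem hx hy
  comul_mem := hC.comul_mem
  counit_eq_zero := hC.counit_eq_zero
  connected := by
    have h1 : (1 : A) ∈ 𝒜 0 := SetLike.GradedOne.one_mem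
    have hne : (1 : A) ≠ 0 := by
      intro h
      have := Bialgebra.counit_one (R := K) (A := A)
      rw [h, map_zero] at this
      exact zero_ne_one this
    refine le_antisymm (fun x hx => ?_) ?_
    · obtain ⟨c, hc⟩ := (finrank_eq_one_iff_of_nonzero' (⟨1, h1⟩ : 𝒜 0)
        (fun h => hne (congrArg Subtype.val h))).1 hC.connected ⟨x, hx⟩
      exact Submodule.mem_span_singleton.2 ⟨c, congrArg Subtype.val hc⟩
    · rw [Submodule.span_singleton_le_iff_mem]
      exact h1

theorem IsGradedCommHopf.comul_gradeProj {K : Type u} [Field K] {A : Type v} [AddCommGroup A]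
    [Module K A] {B : BialgData K A} {𝒜 : ℕ → Submodule K A} [DirectSum.Decomposition 𝒜]
    (hB : IsGradedCommHopf B 𝒜) (n : ℕ) :
    B.comul ∘ₗ gradeProj 𝒜 n = (∑ p ∈ Finset.HasAntidiagonal.antidiagonal n,
      TensorProduct.map (gradeProj 𝒜 p.1) (gradeProj 𝒜 p.2)) ∘ₗ B.comul := by
  refine linearMap_ext_of_iSup (iSup_eq_top_of_decomposition 𝒜) fun m x hx => ?_
  rw [LinearMap.comp_apply, LinearMap.comp_apply]
  have hz : ∀ p q, p + q = m → ∀ a ∈ 𝒜 p, ∀ b ∈ 𝒜 q, ∀ i : ℕ × ℕ, i ≠ (p, q) →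
      gradeProj 𝒜 i.1 a ⊗ₜ[K] gradeProj 𝒜 i.2 b = 0 := by
    intro p q _ a ha b hb i hi
    by_cases h1 : p = i.1
    · have h2 : q ≠ i.2 := fun h2 => hi (Prod.ext h1.symm h2.symm)
      rw [gradeProj_of_mem_ne hb h2, TensorProduct.tmul_zero]
    · rw [gradeProj_of_mem_ne ha h1, TensorProduct.zero_tmul]
  by_cases hmn : m = n
  · subst hmn
    rw [gradeProj_of_mem hx]
    refine eqOn_tensorGr (f := LinearMap.id) (fun p q hpq a ha b hb => ?_) (hB.comul_mem m x hx)
    simp only [LinearMap.sum_apply, TensorProduct.map_tmul, LinearMap.id_apply]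
    rw [Finset.sum_eq_single (p, q) (fun i _ hi => hz p q hpq a ha b hb i hi)
      (fun h => absurd (by simpa using hpq) h), gradeProj_of_mem ha, gradeProj_of_mem hb]
  · rw [gradeProj_of_mem_ne hx hmn, map_zero]
    refine (eqOn_tensorGr (g := 0) (fun p q hpq a ha b hb => ?_) (hB.comul_mem m x hx)).symm
    rw [LinearMap.sum_apply, LinearMap.zero_apply]
    refine Finset.sum_eq_zero fun i hi => hz p q hpq a ha b hb i ?_
    rintro rfl
    exact hmn (hpq.symm.trans (by simpa using hi))

/-- In `∑ p_i ⊗ p_j` applied to `x ⊗ 1 + 1 ⊗ x`, only the pairs `(n, 0)` and `(0, n)` contribute,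
since `1` has degree `0`. -/
theorem gradeProj_mem_primitives [DirectSum.Decomposition 𝒜]
    (hB : IsGradedCommHopf (BialgData.ofBialgebra K A) 𝒜) (n : ℕ) {x : A}
    (hx : x ∈ primitives K A) : gradeProj 𝒜 n x ∈ primitives K A := by
  have h := LinearMap.congr_fun (hB.comul_gradeProj n) x
  rw [LinearMap.comp_apply, LinearMap.comp_apply] at h
  have h1 : gradeProj 𝒜 0 (1 : A) = 1 := gradeProj_of_mem hB.one_mem
  have h2 : ∀ i, i ≠ 0 → gradeProj 𝒜 i (1 : A) = 0 := fun i hi => hB.gradeProj_one hi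
  have hx' : (BialgData.ofBialgebra K A).comul x = x ⊗ₜ 1 + 1 ⊗ₜ x := hx
  refine h.trans ?_
  rw [hx', map_add, LinearMap.sum_apply, LinearMap.sum_apply]
  congr 1
  · rw [Finset.sum_eq_single (n, 0), TensorProduct.map_tmul, h1]
    · rintro ⟨i, j⟩ hij hne
      have hj : j ≠ 0 := by
        rintro rfl
        exact hne (by simpa using hij)
      rw [TensorProduct.map_tmul, h2 j hj, TensorProduct.tmul_zero]
    · simp
  · rw [Finset.sum_eq_single (0, n), TensorProduct.map_tmul, h1]
    · rintro ⟨i, j⟩ hij hne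
      have hi : i ≠ 0 := by
        rintro rfl
        exact hne (by simpa using hij)
      rw [TensorProduct.map_tmul, h2 i hi, TensorProduct.zero_tmul]
    · simp

theorem isInternal_primitivesGr [DirectSum.Decomposition 𝒜]
    (hB : IsGradedCommHopf (BialgData.ofBialgebra K A) 𝒜) :
    DirectSum.IsInternal (primitivesGr K 𝒜) := by
  rw [DirectSum.isInternal_submodule_iff_iSupIndep_and_iSup_eq_top]
  constructor
  · intro n
    rw [Submodule.disjoint_def]
    intro x hx hx'
    have h1 : (⨆ j, ⨆ (_ : j ≠ n), primitivesGr K 𝒜 j) ≤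
        LinearMap.ker (gradeProj 𝒜 n ∘ₗ (primitives K A).subtype) :=
      iSup₂_le fun j hj y hy => gradeProj_of_mem_ne hy hj
    have h2 : gradeProj 𝒜 n (x : A) = 0 := h1 hx'
    have hx : (x : A) ∈ 𝒜 n := hx
    rw [gradeProj_of_mem hx] at h2
    exact Subtype.ext h2
  · rw [eq_top_iff]
    rintro x -
    classical
    have h : x = ∑ n ∈ (DirectSum.decompose 𝒜 (x : A)).support,
        (⟨gradeProj 𝒜 n (x : A), gradeProj_mem_primitives hB n x.2⟩ : primitives K A) := by
      apply Subtype.ext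
      rw [AddSubmonoidClass.coe_finsetSum]
      exact (DirectSum.sum_support_decompose 𝒜 (x : A)).symm
    rw [h]
    exact Submodule.sum_mem _ fun n _ => Submodule.mem_iSup_of_mem n (gradeProj_mem (𝒜 := 𝒜) n _)

theorem reducedLocallyFinite_primitivesGr [DirectSum.Decomposition 𝒜]
    [∀ n, Module.Finite K (𝒜 n)] (hB : IsGradedCommHopf (BialgData.ofBialgebra K A) 𝒜) :
    ReducedLocallyFinite (primitivesGr K 𝒜) where
  zero := by
    rw [eq_bot_iff]
    intro x hx
    have h1 : gradeProj 𝒜 0 (x : A) = x := gradeProj_of_mem hx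
    -- A degree `0` element equals `ε(x) 1`, and the counit kills primitives.
    rw [hB.gradeProj_zero, hB.counit_primitive x.2, zero_smul] at h1
    exact Subtype.ext h1.symm
  finite n := by
    let f : primitivesGr K 𝒜 n →ₗ[K] 𝒜 n :=
      (primitives K A).subtype.restrict fun _ hx => hx
    exact Module.Finite.of_injective f fun a b hab =>
      Subtype.ext (Subtype.ext (congrArg (Subtype.val : 𝒜 n → A) hab))

end Primitives

/-! ### Cofree graded commutative Hopf algebras -/

section CofreeHopfAlgebra

theorem eq_zero_of_surjOn_finite {K : Type u} [Field K] {V : Type v} [AddCommGroup V] [Module K V]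
    {W : Submodule K V} [Module.Finite K W] {f : V →ₗ[K] V} (hf : ∀ x ∈ W, f x ∈ W)
    (hsurj : ∀ y ∈ W, ∃ x ∈ W, f x = y) {x : V} (hx : x ∈ W) (hx0 : f x = 0) : x = 0 := by
  have h : Function.Surjective (f.restrict hf) := fun y => by
    obtain ⟨x, hx, hxy⟩ := hsurj y y.2
    exact ⟨⟨x, hx⟩, Subtype.ext hxy⟩
  have h' := LinearMap.injective_iff_surjective.2 h
  exact congrArg Subtype.val
    (h' (a₁ := ⟨x, hx⟩) (a₂ := 0) ((Subtype.ext hx0).trans (map_zero _).symm))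

variable {K : Type u} [Field K] {A : Type v} [CommRing A] [Bialgebra K A]
  {𝒜 : ℕ → Submodule K A} [GradedAlgebra 𝒜]

/-- A cofree structure map restricts to a bijection on primitive elements, hence it is injective on
them, and it identifies the dimensions of the components with those of the tensor coalgebra. -/
theorem exists_section_of_isCofreeGraded (hC : IsConnectedGradedCoalgebra 𝒜)
    [DirectSum.Decomposition (primitivesGr K 𝒜)] [ReducedLocallyFinite (primitivesGr K 𝒜)]
    {φ : A →ₗ[K] primitives K A} (hφ : IsCofreeGraded 𝒜 (primitivesGr K 𝒜) φ) :
    ∃ e : A ≃ₗc[K] TensorAlgebra K (primitives K A),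
      (∀ n, ∀ x ∈ 𝒜 n, e x ∈ gr (primitivesGr K 𝒜) n) ∧
      (∀ n, ∀ y ∈ gr (primitivesGr K 𝒜) n, e.symm y ∈ 𝒜 n) ∧
      (∀ x, piV K (primitives K A) (e x) = φ x) ∧
      ∀ n, n ≠ 0 → ∀ x ∈ 𝒜 n, x ∈ primitives K A → φ x = 0 → x = 0 := by
  have hB := isGradedCommHopf_ofBialgebra hC
  have h0 : primitivesGr K 𝒜 0 = ⊥ := ReducedLocallyFinite.zero
  -- The lift `Ξ` of `π_V` will be inverse to the morphism `Ψ` induced by `φ`.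
  obtain ⟨Ξ, ⟨hΞmem, hΞ⟩, -⟩ := hφ.2 (TensorAlgebra K (primitives K A)) (gr (primitivesGr K 𝒜))
    (isConnectedGradedCoalgebra_gr _ h0) (piV K _) (piV_mem_of_mem_gr _)
  have hφ0 : ∀ x ∈ 𝒜 0, φ x = 0 := fun x hx => by simpa [h0] using hφ.1 0 x hx
  have hs := isSeries_induced 𝒜 hC.comul_mem hφ0
  have hsmem := hs.mem_gr hC.comul_mem hC.counit_eq_zero h0 hφ.1
  let Ψ : A →ₗc[K] TensorAlgebra K (primitives K A) := hs.coalgHom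
  have hΨ : ∀ x, piV K _ (Ψ x) = φ x := LinearMap.congr_fun hs.piV
  have hΨΞ : Ψ.comp Ξ = CoalgHom.id K _ := coalgHom_ext fun y => (hΨ (Ξ y)).trans (hΞ y)
  have hΞ1 : Ξ 1 = 1 := by
    have h1 : gradeProj 𝒜 0 (Ξ 1) = Ξ 1 := gradeProj_of_mem (hΞmem 0 1 (one_mem_gr _))
    have h2 : (BialgData.ofBialgebra K A).counit (Ξ 1) = 1 :=
      (CoalgHomClass.counit_comp_apply Ξ 1).trans eps_one
    rw [hB.gradeProj_zero, h2, one_smul] at h1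
    exact h1.symm
  have hΞι : ∀ v, Ξ (TensorAlgebra.ι K v) ∈ primitives K A := by
    intro v
    have h1 := CoalgHomClass.map_comp_comul_apply Ξ (TensorAlgebra.ι K v)
    have h2 := deconcat_ι_mul v (1 : TensorAlgebra K (primitives K A))
    rw [mul_one, deconcat_one, Algebra.TensorProduct.tmul_mul_tmul, mul_one, mul_one] at h2
    rw [comul_eq_deconcat, h2, map_add, TensorProduct.map_tmul, TensorProduct.map_tmul] at h1
    refine h1.symm.trans ?_
    change Ξ 1 ⊗ₜ Ξ _ + Ξ _ ⊗ₜ Ξ 1 = _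
    rw [hΞ1, add_comm]
  -- The elements `Ξ (ι v)` are primitive and `φ` sends them to `v`; thus `φ` is onto on primitives
  -- of degree `n`, hence injective there by finite dimensionality.
  have hprim : ∀ n, n ≠ 0 → ∀ x ∈ 𝒜 n, x ∈ primitives K A → φ x = 0 → x = 0 := by
    intro n _ x hx hxp hx0
    have := ReducedLocallyFinite.finite (𝒱 := primitivesGr K 𝒜) n
    refine congrArg Subtype.val (eq_zero_of_surjOn_finite (x := ⟨x, hxp⟩)
      (f := φ ∘ₗ (primitives K A).subtype) (W := primitivesGr K 𝒜 n) (fun y hy => hφ.1 n _ hy)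
      (fun v hv => ⟨⟨Ξ (TensorAlgebra.ι K v), hΞι v⟩, hΞmem n _ (ι_mem_gr hv), ?_⟩) hx hx0)
    exact (hΞ _).trans (piV_ι _)
  have hφ1 : φ 1 = 0 := hφ0 1 hB.one_mem
  have hone : Ψ 1 = 1 := hs.apply_groupLike hφ1 Bialgebra.comul_one Bialgebra.counit_one
  have hinj : Function.Injective Ψ := by
    refine hB.injective_of_primitive (Φ := Ψ.toLinearMap) hsmem hs.comul
      (fun h => one_ne_zero (hone.symm.trans h)) fun n hn x hxn hx hx0 => hprim n hn x hxn hx ?_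
    have h1 := hs.apply_primitive hφ1 hone hx (hB.counit_primitive hx)
    rw [← TensorAlgebra.ι_eq_zero_iff (R := K), ← h1]
    exact hx0
  -- The left inverse comes from injectivity of `Ψ` rather than from uniqueness of lifts out of `A`:
  -- the universal property tests coalgebras in `Type (max u v)`, while `A` lies in `Type v`.
  have hΞΨ : Ξ.comp Ψ = CoalgHom.id K A := CoalgHom.ext fun x => hinj
    (CoalgHom.congr_fun hΨΞ (Ψ x))
  exact ⟨CoalgEquiv.ofCoalgHom Ψ Ξ hΨΞ hΞΨ, hsmem, hΞmem, hΨ, hprim⟩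

theorem lieMorphism_of_isCofreeGraded [∀ n, Module.Finite K (𝒜 n)] {ψ : ∀ n, Desc K n} (hψ : IsLieIdempotentFamily ψ)
    (hC : IsConnectedGradedCoalgebra 𝒜) {φ : A →ₗ[K] primitives K A}
    (hφ : IsCofreeGraded 𝒜 (primitivesGr K 𝒜) φ) :
    IsCofreeGraded 𝒜 (primitivesGr K 𝒜) (lieStructureMap (BialgData.ofBialgebra K A) 𝒜 φ ψ) ∧
      (∃ Θ : A ≃ₗc[K] A, (∀ n, ∀ x ∈ 𝒜 n, Θ x ∈ 𝒜 n) ∧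
        ∀ x, φ (Θ x) = lieStructureMap (BialgData.ofBialgebra K A) 𝒜 φ ψ x) ∧
      piV K (primitives K A) ∘ₗ lieMorphism (BialgData.ofBialgebra K A) 𝒜 φ ψ =
        lieStructureMap (BialgData.ofBialgebra K A) 𝒜 φ ψ ∧
      IsGradedHopfIso (BialgData.ofBialgebra K A) 𝒜
        (shuffle K (primitives K A)) (gr (primitivesGr K 𝒜))
        (lieMorphism (BialgData.ofBialgebra K A) 𝒜 φ ψ) := by
  have hB := isGradedCommHopf_ofBialgebra hC
  let _ : DirectSum.Decomposition (primitivesGr K 𝒜) :=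
    (isInternal_primitivesGr hB).chooseDecomposition
  have : ReducedLocallyFinite (primitivesGr K 𝒜) := reducedLocallyFinite_primitivesGr hB
  obtain ⟨e, he, he', heφ, hprim⟩ := exists_section_of_isCofreeGraded hC hφ
  have hdim : ∀ n, Module.finrank K (𝒜 n) = Module.finrank K (gr (primitivesGr K 𝒜) n) := by
    intro n
    refine le_antisymm
      (LinearMap.finrank_le_finrank_of_injective
        (f := (e : A →ₗ[K] TensorAlgebra K (primitives K A)).restrict (he n)) ?_)
      (LinearMap.finrank_le_finrank_of_injective
        (f := (e.symm : TensorAlgebra K (primitives K A) →ₗ[K] A).restrict (he' n)) ?_)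
    · exact fun a b hab => Subtype.ext (e.injective (congrArg Subtype.val hab))
    · exact fun a b hab => Subtype.ext (e.symm.injective (congrArg Subtype.val hab))
  obtain ⟨hpi, hiso⟩ := isGradedHopfIso_lieMorphism hB hψ hφ.1 hprim hdim
  have hs : IsSeries (lieStructureMap (BialgData.ofBialgebra K A) 𝒜 φ ψ)
      (lieMorphism (BialgData.ofBialgebra K A) 𝒜 φ ψ) := isSeries_lieMorphism hB
  let Φ : A →ₗc[K] TensorAlgebra K (primitives K A) := hs.coalgHom
  have hΦ : Function.Bijective Φ := hiso.bijective
  refine ⟨isCofreeGraded_of_bijective ReducedLocallyFinite.zero Φ hΦ hiso.map_mem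
    -- `Θ` is the new isomorphism with `T^g(Prim A)` followed by the inverse of the one induced by
    -- `φ`.
    (LinearMap.congr_fun hpi), ⟨(CoalgEquiv.ofBijective (f := Φ) hΦ).trans e.symm,
      fun n x hx => he' n _ (hiso.map_mem n x hx), fun x => ?_⟩, hpi, hiso⟩
  rw [← heφ]
  refine (congrArg (piV K _) (e.apply_symm_apply _)).trans ?_
  exact LinearMap.congr_fun hpi x

end CofreeHopfAlgebra

end CofreeHopf

end

theorem mainTheorem2 {K : Type u} [Field K] [CharZero K]
    (ψ : ∀ n, Desc K n) (hψ : IsLieIdempotentFamily ψ) :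
    -- graded commutative `B_∞`-algebras
    (∀ (V : Type v) [AddCommGroup V] [Module K V] (𝒱 : ℕ → Submodule K V)
      [DirectSum.Decomposition 𝒱] [ReducedLocallyFinite 𝒱]
      (S : BInftyStructure K V), S.IsCommutative → S.IsGraded 𝒱 →
      IsGradedCommHopf (envelope S.br) (gr 𝒱) ∧
      IsGradedCommHopf (shuffle K V) (gr 𝒱) ∧
      piV K V ∘ₗ lieMorphism (envelope S.br) (gr 𝒱) (piV K V) ψ =
        lieStructureMap (envelope S.br) (gr 𝒱) (piV K V) ψ ∧
      IsGradedHopfIso (envelope S.br) (gr 𝒱) (shuffle K V) (gr 𝒱)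
        (lieMorphism (envelope S.br) (gr 𝒱) (piV K V) ψ)) ∧
    -- cofree graded commutative Hopf algebras
    (∀ (A : Type v) [CommRing A] [Bialgebra K A] (𝒜 : ℕ → Submodule K A) [GradedAlgebra 𝒜]
      [∀ n, Module.Finite K (𝒜 n)], IsConnectedGradedCoalgebra 𝒜 →
      ∀ φ : A →ₗ[K] primitives K A, IsCofreeGraded 𝒜 (primitivesGr K 𝒜) φ →
      IsCofreeGraded 𝒜 (primitivesGr K 𝒜)
        (lieStructureMap (BialgData.ofBialgebra K A) 𝒜 φ ψ) ∧
      (∃ Θ : A ≃ₗc[K] A, (∀ n, ∀ x ∈ 𝒜 n, Θ x ∈ 𝒜 n) ∧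
        ∀ x, φ (Θ x) = lieStructureMap (BialgData.ofBialgebra K A) 𝒜 φ ψ x) ∧
      piV K (primitives K A) ∘ₗ lieMorphism (BialgData.ofBialgebra K A) 𝒜 φ ψ =
        lieStructureMap (BialgData.ofBialgebra K A) 𝒜 φ ψ ∧
      IsGradedHopfIso (BialgData.ofBialgebra K A) 𝒜
        (shuffle K (primitives K A)) (gr (primitivesGr K 𝒜))
        (lieMorphism (BialgData.ofBialgebra K A) 𝒜 φ ψ)) := by
  refine ⟨fun V _ _ 𝒱 _ _ S hS hg => ?_, fun A _ _ 𝒜 _ _ hC φ hφ =>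
    lieMorphism_of_isCofreeGraded hψ hC hφ⟩
  have h0 : 𝒱 0 = ⊥ := ReducedLocallyFinite.zero
  exact ⟨S.isGradedCommHopf_envelope hS h0 hg, isGradedCommHopf_shuffle h0,
    isGradedHopfIso_envelope hψ S hS hg⟩
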